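/- Let $d\ge 1$, let $H=|x|^2-\Delta$ on $C^\infty(\mathbf R^d)$, and for $h>0$, $s\ge 0$ let $\boldsymbol{\mathcal S}_{h,s}(\mathbf R^d)$ be the normed space of all $f\in C^\infty(\mathbf R^d)$ (complex valued) with $$\|f\|_{h,s}=\sup_{N\ge 0}\frac{\|H^Nf\|_{L^\infty}}{h^N(N!)^{2s}}<\infty .$$ Let $\boldsymbol\Sigma_s(\mathbf R^d)=\bigcap_{h>0}\boldsymbol{\mathcal S}_{h,s}(\mathbf R^d)$ and $\boldsymbol{\mathcal S}_s(\mathbf R^d)=\bigcup_{h>0}\boldsymbol{\mathcal S}_{h,s}(\mathbf R^d)$, with the projective, respectively (locally convex) inductive, limit topology, and let $\boldsymbol\Sigma=\boldsymbol\Sigma_{1/2}$ be the Pilipović space. Let $h_\alpha$, $\alpha\in\mathbf N^d$, be the Hermite functions, and let $\mathcal H_{0,\flat}(\mathbf R^d)$ (respectively $\mathcal H_\flat(\mathbf R^d)$) be the space of all $f=\sum_\alpha c_\alpha h_\alpha$ such that $\sup_\alpha |c_\alpha|R^{-|\alpha|}(\alpha!)^{1/2}<\infty$ for every (respectively some) $R>0$,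 with the projective (respectively inductive) limit topology of these norms. For each of these spaces $V$, let $V'$ be its dual; a function $F$ defines the functional $\varphi\mapsto\int F\varphi\,dx$ on $V$ (when this is an element of $V'$). For a real number $c$, $V$ is called invariant under the dilation by $c$ if $f(c\,\cdot)\in V$ for all $f\in V$, and $V'$ is called invariant under the dilation by $c$ if the map $f\mapsto f(c\,\cdot)$, $f\in V$, extends to a continuous linear map from $V'$ to $V'$. $V$ is called a test-function module if $(f,g)\mapsto fg$ is a well-defined continuous map from $V\times V$ to $V$, and $V'$ is called a test-function module if this multiplication on $V\times V$ extends to a separately continuous bilinear map from $V'\times V$ to $V'$. (On $V'$, continuity is only required from the strong topology to the weak$^*$ topology.) A Gauss function is a function $f(x)=Ce^{-\langle Ax,x\rangle/2+L(x)}$ with $C\in\mathbf C$, $A$ a complex symmetric $d\times d$ matrix with positive definite real part, and $L:\mathbf R^d\to\mathbf C$ a real-linear form. Then the following is true: 1. A Gauss function $f$ belongs to $\boldsymbol\Sigma(\mathbf R^d)$ if and only if $f(x)=Ce^{-|x|^2/2+L(x)}$ for some complex-valued linear form $L$ on $\mathbf R^d$ and some constant $C\in\mathbf C$. 2. If $0<s\le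 1/2$, then neither $\boldsymbol\Sigma_s(\mathbf R^d)$ nor $\boldsymbol\Sigma_s'(\mathbf R^d)$ is invariant under the dilation by $c$, for any real $c\notin\{0,1,-1\}$, and neither of them is a test-function module. 3. If $0\le s<1/2$, then neither $\boldsymbol{\mathcal S}_s(\mathbf R^d)$ nor $\boldsymbol{\mathcal S}_s'(\mathbf R^d)$ is invariant under the dilation by $c$, for any real $c\notin\{0,1,-1\}$, and neither of them is a test-function module. 4. None of $\mathcal H_{0,\flat}(\mathbf R^d)$, $\mathcal H_\flat(\mathbf R^d)$, $\mathcal H_{0,\flat}'(\mathbf R^d)$, $\mathcal H_\flat'(\mathbf R^d)$ is invariant under the dilation by $c$, for any real $c\notin\{0,1,-1\}$, and none of them is a test-function module. -/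

import Mathlib

open MeasureTheory Topology
open scoped ContDiff Laplacian

noncomputable section

/-! ### Projective and inductive limits of spaces with supremum norms

A scale on a complex vector space `X` is a family `Λ h : ι → X →ₗ[ℂ] ℂ`, `h > 0`. The step with
parameter `h` consists of the `f` with `‖f‖_h = sup_i |Λ h i f|` finite. -/

section Limits

variable {X ι : Type} [AddCommGroup X] [Module ℂ X]

/-- The step `{f | sup_i |ℓ i f| < ∞}`. -/
def stepSpace (ℓ : ι → X →ₗ[ℂ] ℂ) : Submodule ℂ X where
  carrier := {f | BddAbove (Set.range fun i => ‖ℓ i f‖)}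
  zero_mem' := ⟨0, by rintro _ ⟨i, rfl⟩; simp⟩
  add_mem' := by
    rintro f g ⟨a, ha⟩ ⟨b, hb⟩
    refine ⟨a + b, ?_⟩
    rintro _ ⟨i, rfl⟩
    simp only [map_add]
    exact (norm_add_le _ _).trans (add_le_add (ha ⟨i, rfl⟩) (hb ⟨i, rfl⟩))
  smul_mem' := by
    rintro c f ⟨a, ha⟩
    refine ⟨‖c‖ * a, ?_⟩
    rintro _ ⟨i, rfl⟩
    simp only [map_smul, norm_smul]
    exact mul_le_mul_of_nonneg_left (ha ⟨i, rfl⟩) (norm_nonneg c)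

/-- The norm of a step, `‖f‖ = sup_i |ℓ i f|`. -/
def stepNorm (ℓ : ι → X →ₗ[ℂ] ℂ) (f : X) : ℝ := ⨆ i, ‖ℓ i f‖

/-- The intersection over all `h > 0` of the steps of a scale. -/
def projLimit (Λ : ℝ → ι → X →ₗ[ℂ] ℂ) : Submodule ℂ X :=
  ⨅ h : {h : ℝ // 0 < h}, stepSpace (Λ h)

/-- The union over all `h > 0` of the steps of a scale (the supremum of subspaces, which is the
union for the increasing scales used below). -/
def indLimit (Λ : ℝ → ι → X →ₗ[ℂ] ℂ) : Submodule ℂ X :=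
  ⨆ h : {h : ℝ // 0 < h}, stepSpace (Λ h)

theorem mem_projLimit (Λ : ℝ → ι → X →ₗ[ℂ] ℂ) (f : X) :
    f ∈ projLimit Λ ↔ ∀ h : ℝ, 0 < h → f ∈ stepSpace (Λ h) := by
  simp [projLimit, Submodule.mem_iInf]

theorem mem_indLimit (Λ : ℝ → ι → X →ₗ[ℂ] ℂ)
    (hΛ : ∀ h k : ℝ, 0 < h → h ≤ k → ∀ i f, ‖Λ k i f‖ ≤ ‖Λ h i f‖) (f : X) :
    f ∈ indLimit Λ ↔ ∃ h : ℝ, 0 < h ∧ f ∈ stepSpace (Λ h) := by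
  have hmono : ∀ h k : ℝ, 0 < h → h ≤ k → stepSpace (Λ h) ≤ stepSpace (Λ k) := by
    rintro h k hh hk g ⟨a, ha⟩
    refine ⟨a, ?_⟩
    rintro _ ⟨i, rfl⟩
    exact (hΛ h k hh hk i g).trans (ha ⟨i, rfl⟩)
  have : Nonempty {h : ℝ // 0 < h} := ⟨⟨1, one_pos⟩⟩
  rw [indLimit, Submodule.mem_iSup_of_directed]
  · simp
  · intro h k
    exact ⟨⟨max h k, lt_max_of_lt_left h.2⟩, hmono _ _ h.2 (le_max_left _ _),
      hmono _ _ k.2 (le_max_right _ _)⟩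

/-- The projective limit, as a type of its own (it carries its own topology). -/
def ProjLimit (Λ : ℝ → ι → X →ₗ[ℂ] ℂ) : Type := ↥(projLimit Λ)

/-- The inductive limit, as a type of its own (it carries its own topology). -/
def IndLimit (Λ : ℝ → ι → X →ₗ[ℂ] ℂ) : Type := ↥(indLimit Λ)

instance (Λ : ℝ → ι → X →ₗ[ℂ] ℂ) : AddCommGroup (ProjLimit Λ) :=
  inferInstanceAs (AddCommGroup ↥(projLimit Λ))

instance (Λ : ℝ → ι → X →ₗ[ℂ] ℂ) : Module ℂ (ProjLimit Λ) :=
  inferInstanceAs (Module ℂ ↥(projLimit Λ))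

instance (Λ : ℝ → ι → X →ₗ[ℂ] ℂ) : AddCommGroup (IndLimit Λ) :=
  inferInstanceAs (AddCommGroup ↥(indLimit Λ))

instance (Λ : ℝ → ι → X →ₗ[ℂ] ℂ) : Module ℂ (IndLimit Λ) :=
  inferInstanceAs (Module ℂ ↥(indLimit Λ))

/-- The inclusion of the projective limit in the ambient space. -/
def ProjLimit.val {Λ : ℝ → ι → X →ₗ[ℂ] ℂ} : ProjLimit Λ →ₗ[ℂ] X := (projLimit Λ).subtype

/-- The inclusion of the inductive limit in the ambient space. -/
def IndLimit.val {Λ : ℝ → ι → X →ₗ[ℂ] ℂ} : IndLimit Λ →ₗ[ℂ] X := (indLimit Λ).subtype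

theorem ProjLimit.bddAbove {Λ : ℝ → ι → X →ₗ[ℂ] ℂ} (f : ProjLimit Λ) {h : ℝ} (hh : 0 < h) :
    BddAbove (Set.range fun i => ‖Λ h i f.val‖) :=
  (mem_projLimit Λ f.val).1 f.2 h hh

/-- The norms `‖·‖_h`, `h > 0`, on the projective limit. -/
def ProjLimit.seminorms (Λ : ℝ → ι → X →ₗ[ℂ] ℂ) :
    SeminormFamily ℂ (ProjLimit Λ) {h : ℝ // 0 < h} := fun h =>
  Seminorm.of (fun f => stepNorm (Λ h) f.val)
    (fun f g => by
      rcases isEmpty_or_nonempty ι with hι | hι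
      · simp [stepNorm]
      · refine ciSup_le fun i => ?_
        rw [map_add, map_add]
        exact (norm_add_le _ _).trans
          (add_le_add (le_ciSup (f.bddAbove h.2) i) (le_ciSup (g.bddAbove h.2) i)))
    (fun c f => by
      simp only [stepNorm, map_smul, norm_smul]
      exact (Real.mul_iSup_of_nonneg (norm_nonneg c) _).symm)

/-- The projective limit topology, defined by the norms `‖·‖_h`, `h > 0`. -/
instance ProjLimit.instTopologicalSpace (Λ : ℝ → ι → X →ₗ[ℂ] ℂ) :
    TopologicalSpace (ProjLimit Λ) :=
  haveI : Nonempty {h : ℝ // 0 < h} := ⟨⟨1, one_pos⟩⟩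
  (ProjLimit.seminorms Λ).moduleFilterBasis.topology

/-- The seminorms on the inductive limit whose restriction to each step is continuous, that is,
bounded by a multiple of the norm of that step. -/
def IndLimit.IsAdmissible (Λ : ℝ → ι → X →ₗ[ℂ] ℂ) (q : Seminorm ℂ (IndLimit Λ)) : Prop :=
  ∀ h : ℝ, 0 < h → ∃ C : ℝ, ∀ f : IndLimit Λ, f.val ∈ stepSpace (Λ h) →
    q f ≤ C * stepNorm (Λ h) f.val

/-- The family of all admissible seminorms. -/
def IndLimit.seminorms (Λ : ℝ → ι → X →ₗ[ℂ] ℂ) :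
    SeminormFamily ℂ (IndLimit Λ) {q : Seminorm ℂ (IndLimit Λ) // IndLimit.IsAdmissible Λ q} :=
  fun q => q.1

/-- The (locally convex) inductive limit topology: the finest locally convex topology for which
the inclusions of all steps are continuous. It is defined by all admissible seminorms. -/
instance IndLimit.instTopologicalSpace (Λ : ℝ → ι → X →ₗ[ℂ] ℂ) :
    TopologicalSpace (IndLimit Λ) :=
  haveI : Nonempty {q : Seminorm ℂ (IndLimit Λ) // IndLimit.IsAdmissible Λ q} :=
    ⟨⟨0, fun _ _ => ⟨0, fun _ _ => by simp⟩⟩⟩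
  (IndLimit.seminorms Λ).moduleFilterBasis.topology

end Limits

/-! ### The harmonic oscillator and the Pilipović spaces -/

/-- The space `C^∞(ℝ^d)` of smooth complex-valued functions. -/
def SmoothFun (d : ℕ) : Submodule ℂ (EuclideanSpace ℝ (Fin d) → ℂ) where
  carrier := {f | ContDiff ℝ ∞ f}
  zero_mem' := (contDiff_const : ContDiff ℝ ∞ fun _ : EuclideanSpace ℝ (Fin d) => (0 : ℂ))
  add_mem' := fun {_ _} (hf : ContDiff ℝ ∞ _) (hg : ContDiff ℝ ∞ _) => hf.add hg
  smul_mem' := fun c _ (hf : ContDiff ℝ ∞ _) => hf.const_smul c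

theorem SmoothFun.contDiff {d : ℕ} (f : SmoothFun d) : ContDiff ℝ ∞ f.1 := f.2

theorem contDiff_laplacian {d : ℕ} {f : EuclideanSpace ℝ (Fin d) → ℂ} (hf : ContDiff ℝ ∞ f) :
    ContDiff ℝ ∞ (Δ f) := by
  rw [InnerProductSpace.laplacian_eq_iteratedFDeriv_stdOrthonormalBasis]
  refine ContDiff.sum fun i _ => ?_
  have h : ContDiff ℝ ∞ (iteratedFDeriv ℝ 2 f) :=
    hf.iteratedFDeriv_right (i := 2) (m := ∞) le_rfl
  exact (ContinuousMultilinearMap.apply ℝ (fun _ : Fin 2 => EuclideanSpace ℝ (Fin d)) ℂ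
    ![_, _]).contDiff.comp h

/-- The harmonic oscillator `H = |x|² - Δ` on `C^∞(ℝ^d)`. -/
def harmonicOscillator (d : ℕ) : Module.End ℂ (SmoothFun d) where
  toFun f := ⟨fun x => ((‖x‖ ^ 2 : ℝ) : ℂ) * f.1 x - (Δ f.1 : EuclideanSpace ℝ (Fin d) → ℂ) x,
    show ContDiff ℝ ∞ _ from
    ((Complex.ofRealCLM.contDiff.comp (contDiff_norm_sq ℝ)).mul (SmoothFun.contDiff f)).sub
      (contDiff_laplacian (SmoothFun.contDiff f))⟩
  map_add' f g := by
    ext x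
    have hf : ContDiff ℝ ∞ f.1 := SmoothFun.contDiff f
    have hg : ContDiff ℝ ∞ g.1 := SmoothFun.contDiff g
    have := ContDiffAt.laplacian_add (x := x) ((contDiff_infty.1 hf 2).contDiffAt)
      ((contDiff_infty.1 hg 2).contDiffAt)
    simp only [Submodule.coe_add, Pi.add_apply, this]
    ring
  map_smul' c f := by
    ext x
    have hf : ContDiff ℝ ∞ f.1 := SmoothFun.contDiff f
    have := InnerProductSpace.laplacian_smul (x := x) c
      ((contDiff_infty.1 hf 2).contDiffAt)
    simp only [Submodule.coe_smul, Pi.smul_apply, this, smul_eq_mul, RingHom.id_apply]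
    ring

/-- The functionals `f ↦ (H^N f)(x) / (h^N (N!)^{2s})`, so that
`sup_{N,x} |…| = sup_N ‖H^N f‖_{L^∞} / (h^N (N!)^{2s})`. -/
def pilipovicScale (d : ℕ) (s h : ℝ) :
    ℕ × EuclideanSpace ℝ (Fin d) → SmoothFun d →ₗ[ℂ] ℂ := fun i =>
  (((h ^ i.1 * (i.1.factorial : ℝ) ^ (2 * s))⁻¹ : ℝ) : ℂ) •
    ((LinearMap.proj i.2 ∘ₗ (SmoothFun d).subtype) ∘ₗ (harmonicOscillator d ^ i.1))

/-- The Pilipović space of Beurling type `𝚺_s(ℝ^d)`. -/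
abbrev PilipovicBeurling (d : ℕ) (s : ℝ) : Type := ProjLimit (pilipovicScale d s)

/-- The Pilipović space of Roumieu type `𝓢_s(ℝ^d)`. -/
abbrev PilipovicRoumieu (d : ℕ) (s : ℝ) : Type := IndLimit (pilipovicScale d s)

/-- The function on `ℝ^d` underlying an element of `𝚺_s(ℝ^d)`. -/
def PilipovicBeurling.toFun {d : ℕ} {s : ℝ} (f : PilipovicBeurling d s) :
    EuclideanSpace ℝ (Fin d) → ℂ := f.val.1

/-- The function on `ℝ^d` underlying an element of `𝓢_s(ℝ^d)`. -/
def PilipovicRoumieu.toFun {d : ℕ} {s : ℝ} (f : PilipovicRoumieu d s) :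
    EuclideanSpace ℝ (Fin d) → ℂ := f.val.1

theorem mem_pilipovicRoumieu {d : ℕ} {s : ℝ} (f : SmoothFun d) :
    f ∈ indLimit (pilipovicScale d s) ↔
      ∃ h : ℝ, 0 < h ∧ f ∈ stepSpace (pilipovicScale d s h) := by
  refine mem_indLimit _ (fun h k hh hk i g => ?_) f
  have h0 : 0 < (i.1.factorial : ℝ) ^ (2 * s) :=
    Real.rpow_pos_of_pos (by exact_mod_cast i.1.factorial_pos) _
  have hk0 : 0 < k := hh.trans_le hk
  simp only [pilipovicScale, LinearMap.smul_apply, norm_smul, Complex.norm_real,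
    Real.norm_eq_abs]
  refine mul_le_mul_of_nonneg_right ?_ (norm_nonneg _)
  rw [abs_of_pos (by positivity), abs_of_pos (by positivity)]
  gcongr

/-! ### Hermite series and the flat spaces -/

/-- The Hermite function of order `n` on `ℝ`,
`h_n(t) = π^{-1/4} (-1)^n (2^n n!)^{-1/2} e^{t²/2} (d/dt)^n e^{-t²}`. -/
def hermiteFun (n : ℕ) (t : ℝ) : ℝ :=
  Real.pi ^ (-(1 / 4) : ℝ) * (-1) ^ n * (Real.sqrt (2 ^ n * n.factorial))⁻¹ *
    Real.exp (t ^ 2 / 2) * iteratedDeriv n (fun u : ℝ => Real.exp (-u ^ 2)) t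

/-- The Hermite function of order `α ∈ ℕ^d` on `ℝ^d`, `h_α(x) = ∏ j, h_{α_j}(x_j)`. -/
def hermiteFunction {d : ℕ} (α : Fin d → ℕ) (x : EuclideanSpace ℝ (Fin d)) : ℝ :=
  ∏ j, hermiteFun (α j) (x j)

/-- The functionals `c ↦ c_α / (R^{|α|} (α!)^{-1/2})` on the space of all sequences `(c_α)` on
`ℕ^d`, the coefficients of formal Hermite series `∑ c_α h_α`. -/
def flatScale (d : ℕ) (R : ℝ) : (Fin d → ℕ) → ((Fin d → ℕ) → ℂ) →ₗ[ℂ] ℂ := fun α =>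
  (((R ^ (∑ j, α j) * (Real.sqrt (∏ j, ((α j).factorial : ℝ)))⁻¹)⁻¹ : ℝ) : ℂ) •
    LinearMap.proj α

/-- The space `𝓗_{0,♭}(ℝ^d)` of the Hermite series `∑ c_α h_α` with
`|c_α| ≲ R^{|α|} (α!)^{-1/2}` for every `R > 0`. -/
abbrev FlatBeurling (d : ℕ) : Type := ProjLimit (flatScale d)

/-- The space `𝓗_♭(ℝ^d)` of the Hermite series `∑ c_α h_α` with
`|c_α| ≲ R^{|α|} (α!)^{-1/2}` for some `R > 0`. -/
abbrev FlatRoumieu (d : ℕ) : Type := IndLimit (flatScale d)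

/-- The sum `∑ c_α h_α` of an element of `𝓗_{0,♭}(ℝ^d)`, as a function on `ℝ^d` (the series
converges absolutely at every point). -/
def FlatBeurling.toFun {d : ℕ} (f : FlatBeurling d) (x : EuclideanSpace ℝ (Fin d)) : ℂ :=
  ∑' α, f.val α * (hermiteFunction α x : ℂ)

/-- The sum `∑ c_α h_α` of an element of `𝓗_♭(ℝ^d)`, as a function on `ℝ^d` (the series
converges absolutely at every point). -/
def FlatRoumieu.toFun {d : ℕ} (f : FlatRoumieu d) (x : EuclideanSpace ℝ (Fin d)) : ℂ :=
  ∑' α, f.val α * (hermiteFunction α x : ℂ)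

theorem mem_flatRoumieu {d : ℕ} (c : (Fin d → ℕ) → ℂ) :
    c ∈ indLimit (flatScale d) ↔ ∃ R : ℝ, 0 < R ∧ c ∈ stepSpace (flatScale d R) := by
  refine mem_indLimit _ (fun h k hh hk α g => ?_) c
  have h0 : 0 < (Real.sqrt (∏ j, ((α j).factorial : ℝ)))⁻¹ := by positivity
  have hk0 : 0 < k := hh.trans_le hk
  simp only [flatScale, LinearMap.smul_apply, norm_smul, Complex.norm_real, Real.norm_eq_abs]
  refine mul_le_mul_of_nonneg_right ?_ (norm_nonneg _)
  rw [abs_of_pos (by positivity), abs_of_pos (by positivity)]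
  gcongr

/-! ### Dilations and multiplication

In this part `V` is a topological vector space of functions on `ℝ^d`; `ev f` is the function
underlying `f : V`. The dual `V'` is `V →L[ℂ] ℂ` with the strong topology, which is the topology
Mathlib gives to this type. -/

section Invariance

variable {d : ℕ} {V : Type} [AddCommGroup V] [Module ℂ V] [TopologicalSpace V]

/-- The functional `u ∈ V'` is the one given by the function `F`: `u(φ) = ∫ F φ dx`. -/
def IsGivenBy (ev : V → EuclideanSpace ℝ (Fin d) → ℂ) (u : V →L[ℂ] ℂ)
    (F : EuclideanSpace ℝ (Fin d) → ℂ) : Prop :=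
  ∀ φ : V, Integrable (fun x => F x * ev φ x) ∧ u φ = ∫ x, F x * ev φ x

/-- `V` is invariant under the dilation `f ↦ f(c ·)`. -/
def DilationInvariant (ev : V → EuclideanSpace ℝ (Fin d) → ℂ) (c : ℝ) : Prop :=
  ∀ f : V, ∃ g : V, ∀ x, ev g x = ev f (c • x)

/-- `V'` is invariant under the dilation `f ↦ f(c ·)`: there is a linear map `T : V' → V'`,
continuous from the strong to the weak* topology, which extends the dilation of the functions in
`V`. (Strong-to-strong and weak*-to-weak* continuity are both stronger.) -/
def DualDilationInvariant (ev : V → EuclideanSpace ℝ (Fin d) → ℂ) (c : ℝ) : Prop :=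
  ∃ T : (V →L[ℂ] ℂ) →ₗ[ℂ] (V →L[ℂ] ℂ),
    (∀ φ : V, Continuous fun u : V →L[ℂ] ℂ => T u φ) ∧
    ∀ (f : V) (u : V →L[ℂ] ℂ), IsGivenBy ev u (ev f) → IsGivenBy ev (T u) (fun x => ev f (c • x))

/-- `V` is a test-function module: `(f, g) ↦ f g` is (well defined and) continuous from `V × V`
to `V`. -/
def IsTestFunctionModule (ev : V → EuclideanSpace ℝ (Fin d) → ℂ) : Prop :=
  ∃ m : V × V → V, Continuous m ∧ ∀ f g x, ev (m (f, g)) x = ev f x * ev g x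

/-- `V'` is a test-function module: `(f, g) ↦ f g`, `f, g ∈ V`, extends to a bilinear map from
`V' × V` to `V'` which is continuous in each variable (for the strong topology on the source `V'`
and the weak* topology on the target `V'`; joint continuity, or finer topologies on the
target, would be stronger requirements). -/
def IsDualTestFunctionModule (ev : V → EuclideanSpace ℝ (Fin d) → ℂ) : Prop :=
  ∃ M : (V →L[ℂ] ℂ) →ₗ[ℂ] V →ₗ[ℂ] (V →L[ℂ] ℂ),
    (∀ g φ : V, Continuous fun u : V →L[ℂ] ℂ => M u g φ) ∧
    (∀ (u : V →L[ℂ] ℂ) (φ : V), Continuous fun g : V => M u g φ) ∧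
    ∀ (f g : V) (u : V →L[ℂ] ℂ), IsGivenBy ev u (ev f) →
      IsGivenBy ev (M u g) (fun x => ev f x * ev g x)

end Invariance

/-- Gauss functions on `ℝ^d`: `f(x) = C e^{-⟨Ax,x⟩/2 + L(x)}` with `C ∈ ℂ`, `A` a complex
symmetric `d × d` matrix with positive definite real part, and `L : ℝ^d → ℂ` linear. -/
def IsGaussFunction {d : ℕ} (f : EuclideanSpace ℝ (Fin d) → ℂ) : Prop :=
  ∃ (C : ℂ) (A : Matrix (Fin d) (Fin d) ℂ) (L : EuclideanSpace ℝ (Fin d) →ₗ[ℝ] ℂ),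
    A.IsSymm ∧ (A.map Complex.re).PosDef ∧
    ∀ x, f x = C * Complex.exp (-(∑ i, ∑ j, A i j * (x j : ℂ) * (x i : ℂ)) / 2 + L x)

end

/-! Everything rests on one obstruction. Fix a unit vector v and put φ_n(x) = H_n(⟨v,x⟩)
e^{-|x|²/2}, an eigenfunction of H with eigenvalue 2n+d. For f in any of the spaces considered, the
coefficients a_n = ∫ φ_n f (for the flat spaces, with v a coordinate vector) satisfy R^n |a_n| ≤ C_R
√(n!) for every R > 0. In the Pilipović spaces this follows from (2n+d)^N a_n = ∫ φ_n H^N f with N =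
n (`pow_mul_norm_integral_hermiteGauss_le`); in the flat spaces a_n is a multiple of a single
Hermite coefficient (`exists_hermiteGaussPairing_le`).

Summing against z^n/n!, the generating function of the Hermite polynomials turns this decay into the
bound C_r e^{r|z|²}, for every r > 0, for the entire function z ↦ ∫ e^{2z⟨v,x⟩ - z²} e^{-|x|²/2}
f(x) dx (`integral_generating_growth`). If f is a nonzero Gauss function with matrix A, this
integral is K exp(Qz² + lz) with K ≠ 0 and Q = ⟨S⁻¹v,v⟩ - 1, S = (A+1)/2. Hence Q = 0
(`sum_sq_div_eq_one_of_hermite_coefficients`); when this holds for all real unit v, polarisation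
gives S = 1, that is A = 1. In particular e^{-b|x|²/2} with b > 0, b ≠ 1 violates the decay already
for a single v.

A dilation of φ_0 = e^{-|x|²/2} by c gives b = c², and its square gives b = 2, so no space V is
invariant or a module. For the duals, let u_n be the functional given by φ_n: the same estimates,
uniform on bounded sets, show R^n u_n/√(n!) → 0 strongly for every R. A continuous extension of the
dilation or of the product, tested against φ_0, would therefore make ∫ φ_n e^{-b|x|²/2} dx decay in
the forbidden way, with b = c⁻² or b = 2 (`not_invariant_of_hermite_decay`).

The remaining claim, that e^{L(x)-|x|²/2} lies in 𝚺_{1/2}, comes from an explicit solution, entire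
in τ, of ∂_τ u = Hu. Its τ-derivatives at 0 are the iterates H^N, and Cauchy's estimate on circles
of arbitrary radius bounds them by h^N N! for every h > 0. -/

/-! ### Hermite polynomials -/

/-- The physicists' Hermite polynomials, `H_{n+1} = 2 X H_n - H_n'`. -/
noncomputable def hermitePoly : ℕ → Polynomial ℝ
  | 0 => 1
  | n + 1 => 2 * Polynomial.X * hermitePoly n - Polynomial.derivative (hermitePoly n)

theorem hermitePoly_succ (n : ℕ) : hermitePoly (n + 1) =
    2 * Polynomial.X * hermitePoly n - Polynomial.derivative (hermitePoly n) := rfl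

/-- The lowering rule. Together with the raising rule that defines `hermitePoly` it yields both the
differential equation and orthogonality. -/
theorem derivative_hermitePoly_succ (n : ℕ) :
    Polynomial.derivative (hermitePoly (n + 1)) =
      ((2 * (n + 1) : ℕ) : Polynomial ℝ) * hermitePoly n := by
  induction n with
  | zero => simp [hermitePoly]
  | succ n ih =>
    have h2 : Polynomial.derivative (2 : Polynomial ℝ) = 0 := Polynomial.derivative_ofNat 2
    rw [hermitePoly_succ (n + 1), Polynomial.derivative_sub, ih, Polynomial.derivative_mul,
      Polynomial.derivative_mul, Polynomial.derivative_mul, ih, Polynomial.derivative_natCast,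
      hermitePoly_succ n, h2, Polynomial.derivative_X]
    push_cast
    ring

/-- The Hermite differential equation. -/
theorem hermitePoly_ode (n : ℕ) :
    2 * Polynomial.X * Polynomial.derivative (hermitePoly n)
      - Polynomial.derivative (Polynomial.derivative (hermitePoly n))
      = ((2 * n : ℕ) : Polynomial ℝ) * hermitePoly n := by
  have h := derivative_hermitePoly_succ n
  have h2 : Polynomial.derivative (2 : Polynomial ℝ) = 0 := Polynomial.derivative_ofNat 2
  rw [hermitePoly_succ, Polynomial.derivative_sub, Polynomial.derivative_mul,
      Polynomial.derivative_mul, h2, Polynomial.derivative_X] at h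
  push_cast at h ⊢
  linear_combination h

theorem hasDerivAt_aeval_hermitePoly (n : ℕ) (z : ℂ) :
    HasDerivAt (fun z => Polynomial.aeval z (hermitePoly n))
      (Polynomial.aeval z (Polynomial.derivative (hermitePoly n))) z :=
  Polynomial.hasDerivAt_aeval _ _

theorem iteratedDeriv_exp_neg_sq (n : ℕ) (t : ℝ) :
    iteratedDeriv n (fun u : ℝ => Real.exp (-u ^ 2)) t
      = (-1) ^ n * (hermitePoly n).eval t * Real.exp (-t ^ 2) := by
  induction n generalizing t with
  | zero => simp [hermitePoly]
  | succ n ih =>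
    rw [iteratedDeriv_succ, funext ih]
    have h1 := (hermitePoly n).hasDerivAt t
    have h2 : HasDerivAt (fun u : ℝ => Real.exp (-u ^ 2)) (Real.exp (-t ^ 2) * (-(2 * t))) t := by
      have := ((hasDerivAt_pow 2 t).neg).exp
      simpa using this
    rw [((h1.const_mul ((-1) ^ n)).fun_mul h2).deriv, hermitePoly_succ]
    simp
    ring

theorem hermiteFun_eq (n : ℕ) (t : ℝ) :
    hermiteFun n t = Real.pi ^ (-(1 / 4) : ℝ) * (Real.sqrt (2 ^ n * n.factorial))⁻¹ *
      ((hermitePoly n).eval t * Real.exp (-t ^ 2 / 2)) := by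
  have h1 : Real.exp (t ^ 2 / 2) * Real.exp (-t ^ 2) = Real.exp (-t ^ 2 / 2) := by
    rw [← Real.exp_add]; ring_nf
  have h2 : ((-1 : ℝ) ^ n) * (-1) ^ n = 1 := by rw [← mul_pow]; simp
  rw [hermiteFun, iteratedDeriv_exp_neg_sq, ← h1]
  linear_combination (Real.pi ^ (-(1 / 4) : ℝ) * (Real.sqrt (2 ^ n * n.factorial))⁻¹ *
      ((hermitePoly n).eval t * (Real.exp (t ^ 2 / 2) * Real.exp (-t ^ 2)))) * h2

/-- Differentiating p(t - z) e^{2zt - z²} in z replaces p by 2Xp - p', which is the Hermite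
recursion. The formula is kept at general z so that the induction closes; z = 0 gives the Taylor
coefficients. -/
theorem iteratedDeriv_hermite_generating (n : ℕ) (t z : ℂ) :
    iteratedDeriv n (fun z : ℂ => Complex.exp (2 * z * t - z ^ 2)) z
      = Polynomial.aeval (t - z) (hermitePoly n) * Complex.exp (2 * z * t - z ^ 2) := by
  induction n generalizing z with
  | zero => simp [hermitePoly]
  | succ n ih =>
    rw [iteratedDeriv_succ, funext ih]
    have h1 : HasDerivAt (fun z : ℂ => Polynomial.aeval (t - z) (hermitePoly n))
        (Polynomial.aeval (t - z) (Polynomial.derivative (hermitePoly n)) * (-1)) z :=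
      (hasDerivAt_aeval_hermitePoly n (t - z)).comp z ((hasDerivAt_id z).const_sub t)
    have h2 : HasDerivAt (fun z : ℂ => Complex.exp (2 * z * t - z ^ 2))
        (Complex.exp (2 * z * t - z ^ 2) * (2 * t - 2 * z)) z := by
      have := ((((hasDerivAt_id z).const_mul 2).mul_const t).sub (hasDerivAt_pow 2 z)).cexp
      simpa using this
    have h3 : Polynomial.aeval (t - z) (2 : Polynomial ℝ) = 2 := map_ofNat _ 2
    rw [(h1.fun_mul h2).deriv, hermitePoly_succ]
    simp only [map_sub, map_mul, Polynomial.aeval_X, h3]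
    ring

theorem hasSum_hermite_generating (t z : ℂ) :
    HasSum (fun n : ℕ => z ^ n / n.factorial * Polynomial.aeval t (hermitePoly n))
      (Complex.exp (2 * z * t - z ^ 2)) := by
  have hd : Differentiable ℂ (fun z : ℂ => Complex.exp (2 * z * t - z ^ 2)) := by fun_prop
  have := Complex.hasSum_taylorSeries_of_entire hd 0 z
  simp only [iteratedDeriv_hermite_generating, smul_eq_mul] at this
  convert! this using 2 with n
  simp
  ring

/-- Cauchy's estimate for the generating function on |z| = r, with the radius left free for
optimisation. -/
theorem norm_aeval_hermitePoly_le (n : ℕ) (t : ℂ) {r : ℝ} (hr : 0 < r) :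
    ‖Polynomial.aeval t (hermitePoly n)‖ ≤
      n.factorial * Real.exp (2 * ‖t‖ * r + r ^ 2) / r ^ n := by
  have hd : Differentiable ℂ (fun z : ℂ => Complex.exp (2 * z * t - z ^ 2)) := by fun_prop
  have := Complex.norm_iteratedDeriv_le_of_forall_mem_sphere_norm_le (c := 0) (R := r)
    (C := Real.exp (2 * ‖t‖ * r + r ^ 2)) n hr hd.diffContOnCl (fun z hz => ?_)
  · simpa [iteratedDeriv_hermite_generating] using this
  · have hz' : ‖z‖ = r := by simpa using hz
    refine (Complex.norm_exp_le_exp_norm _).trans (Real.exp_le_exp.2 ?_)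
    refine (norm_sub_le _ _).trans ?_
    simp [hz']
    linarith

/-- The Hermite polynomials are bounded by `√(n!) e^{5n} e^{t²/4}`. -/
theorem abs_eval_hermitePoly_le (n : ℕ) (t : ℝ) :
    |(hermitePoly n).eval t| ≤ Real.sqrt n.factorial * Real.exp 5 ^ n * Real.exp (t ^ 2 / 4) := by
  rcases Nat.eq_zero_or_pos n with rfl | hn
  · simp [hermitePoly]; positivity
  have hn' : (0 : ℝ) < n := by exact_mod_cast hn
  -- With this radius n!/r^n ≤ √(n!), and 2|t|r + r² ≤ t²/4 + 5r² = t²/4 + 5n; this is the origin of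
  -- e^5.
  set r := Real.sqrt n with hr
  have hr0 : 0 < r := Real.sqrt_pos.2 hn'
  have hr2 : r ^ 2 = n := Real.sq_sqrt hn'.le
  have h := norm_aeval_hermitePoly_le n (t : ℂ) hr0
  have e : Polynomial.aeval (t : ℂ) (hermitePoly n) = (((hermitePoly n).eval t : ℝ) : ℂ) :=
    Polynomial.aeval_ofReal (K := ℂ) _ _
  rw [e, Complex.norm_real, Complex.norm_real, Real.norm_eq_abs, Real.norm_eq_abs] at h
  refine h.trans ?_
  have h1 : Real.exp (2 * |t| * r + r ^ 2) ≤ Real.exp 5 ^ n * Real.exp (t ^ 2 / 4) := by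
    rw [← Real.exp_nat_mul, ← Real.exp_add, ← hr2]
    refine Real.exp_le_exp.2 ?_
    nlinarith [sq_nonneg (|t| / 2 - 2 * r), sq_abs t]
  have h2 : (n.factorial : ℝ) / r ^ n ≤ Real.sqrt n.factorial := by
    have hf : (0 : ℝ) ≤ n.factorial := by positivity
    rw [div_le_iff₀ (by positivity)]
    have : Real.sqrt n.factorial ≤ r ^ n := by
      rw [Real.sqrt_le_left (by positivity), ← pow_mul, mul_comm, pow_mul, hr2]
      exact_mod_cast Nat.factorial_le_pow n
    calc (n.factorial : ℝ) = Real.sqrt n.factorial * Real.sqrt n.factorial :=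
          (Real.mul_self_sqrt hf).symm
      _ ≤ _ := by gcongr
  calc _ = (n.factorial : ℝ) / r ^ n * Real.exp (2 * |t| * r + r ^ 2) := by ring
    _ ≤ Real.sqrt n.factorial * (Real.exp 5 ^ n * Real.exp (t ^ 2 / 4)) := by gcongr
    _ = _ := by ring

/-- A polynomial times a Gaussian is integrable. -/
theorem integrable_polynomial_mul_exp_neg_sq (p : Polynomial ℝ) :
    Integrable (fun t : ℝ => p.eval t * Real.exp (-t ^ 2)) := by
  induction p using Polynomial.induction_on' with
  | add p q hp hq => exact (hp.add hq).congr (.of_forall fun t => by simp [add_mul])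
  | monomial n a =>
    have := (integrable_rpow_mul_exp_neg_mul_sq (b := 1) one_pos (s := n)
      (by have : (0 : ℝ) ≤ n := n.cast_nonneg
          linarith)).const_mul a
    simpa [mul_assoc] using this

/-- Integration by parts, as (2Xq - q') e^{-t²} = -(q e^{-t²})': for the Gaussian weight the raising
operator is adjoint to differentiation. -/
theorem integral_eval_derivative_mul_exp_neg_sq (p q : Polynomial ℝ) :
    ∫ t : ℝ, p.eval t * ((2 * Polynomial.X * q - Polynomial.derivative q).eval t) *
      Real.exp (-t ^ 2) = ∫ t : ℝ, (Polynomial.derivative p).eval t * q.eval t *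
      Real.exp (-t ^ 2) := by
  have hv : ∀ t : ℝ, HasDerivAt (fun t => q.eval t * Real.exp (-t ^ 2))
      (-((2 * Polynomial.X * q - Polynomial.derivative q).eval t * Real.exp (-t ^ 2))) t := by
    intro t
    have h2 : HasDerivAt (fun u : ℝ => Real.exp (-u ^ 2)) (Real.exp (-t ^ 2) * (-(2 * t))) t := by
      have := ((hasDerivAt_pow 2 t).neg).exp
      simpa using this
    refine ((q.hasDerivAt t).fun_mul h2).congr_deriv ?_
    simp
    ring
  have i1 := (integrable_polynomial_mul_exp_neg_sq
    (p * (2 * Polynomial.X * q - Polynomial.derivative q))).neg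
  have i2 := integrable_polynomial_mul_exp_neg_sq (Polynomial.derivative p * q)
  have i3 := integrable_polynomial_mul_exp_neg_sq (p * q)
  simp only [Polynomial.eval_mul] at i1 i2 i3
  have := integral_mul_deriv_eq_deriv_mul_of_integrable (u := fun t => p.eval t)
    (fun t _ => p.hasDerivAt t) (fun t _ => hv t)
    (by refine i1.congr (.of_forall fun t => ?_); simp [mul_assoc])
    (by refine i2.congr (.of_forall fun t => ?_); simp [mul_assoc])
    (by refine i3.congr (.of_forall fun t => ?_); simp [mul_assoc])
  simp only [mul_neg, integral_neg, neg_inj] at this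
  simpa only [mul_assoc] using this

theorem integral_hermitePoly_mul_hermitePoly (m n : ℕ) :
    ∫ t : ℝ, (hermitePoly m).eval t * (hermitePoly n).eval t * Real.exp (-t ^ 2)
      = if m = n then 2 ^ n * n.factorial * Real.sqrt Real.pi else 0 := by
  have key : ∀ m n, ∫ t : ℝ, (hermitePoly m).eval t * (hermitePoly (n + 1)).eval t *
      Real.exp (-t ^ 2) = ∫ t : ℝ, (Polynomial.derivative (hermitePoly m)).eval t *
        (hermitePoly n).eval t * Real.exp (-t ^ 2) := fun m n =>
    integral_eval_derivative_mul_exp_neg_sq _ _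
  induction n generalizing m with
  | zero =>
    cases m with
    | zero =>
      have := integral_gaussian 1
      simpa [hermitePoly] using this
    | succ m =>
      have := key 0 m
      simp only [mul_comm ((hermitePoly 0).eval _)] at this
      rw [this]
      simp [hermitePoly]
  | succ n ih =>
    rw [key]
    cases m with
    | zero => simp [hermitePoly]
    | succ m =>
      simp only [derivative_hermitePoly_succ, Polynomial.eval_mul, Polynomial.eval_natCast,
        mul_assoc, integral_const_mul]
      simp only [mul_assoc] at ih
      rw [ih m]
      by_cases h : m = n
      · subst h
        simp [Nat.factorial_succ, pow_succ]
        ring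
      · simp [h]

/-! ### Partial derivatives and symmetry of the harmonic oscillator -/

/-- The partial derivative `∂_i f`. -/
noncomputable def partialDeriv {d : ℕ} (i : Fin d) (f : EuclideanSpace ℝ (Fin d) → ℂ) :
    EuclideanSpace ℝ (Fin d) → ℂ := fun x => fderiv ℝ f x (EuclideanSpace.single i 1)

theorem ContDiff.partialDeriv {d : ℕ} {i : Fin d} {f : EuclideanSpace ℝ (Fin d) → ℂ}
    (hf : ContDiff ℝ ∞ f) : ContDiff ℝ ∞ (partialDeriv i f) :=
  (hf.fderiv_right (m := ∞) le_rfl).clm_apply contDiff_const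

theorem laplacian_eq_sum_partialDeriv {d : ℕ} {f : EuclideanSpace ℝ (Fin d) → ℂ}
    (hf : ContDiff ℝ ∞ f) (x : EuclideanSpace ℝ (Fin d)) :
    (Δ f : EuclideanSpace ℝ (Fin d) → ℂ) x = ∑ i, partialDeriv i (partialDeriv i f) x := by
  rw [InnerProductSpace.laplacian_eq_iteratedFDeriv_orthonormalBasis f
    (EuclideanSpace.basisFun (Fin d) ℝ)]
  refine Finset.sum_congr rfl fun i _ => ?_
  have hd : DifferentiableAt ℝ (fderiv ℝ f) x :=
    ((hf.fderiv_right (m := ∞) le_rfl).differentiable (by simp)).differentiableAt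
  rw [iteratedFDeriv_two_apply]
  have h : partialDeriv i f = fun y => fderiv ℝ f y (EuclideanSpace.single i 1) := rfl
  simp only [partialDeriv]
  rw [h, fderiv_clm_apply hd (differentiableAt_const _)]
  simp

theorem partialDeriv_mul {d : ℕ} {i : Fin d} {f g : EuclideanSpace ℝ (Fin d) → ℂ}
    (hf : ContDiff ℝ ∞ f) (hg : ContDiff ℝ ∞ g) :
    partialDeriv i (fun x => f x * g x) =
      fun x => f x * partialDeriv i g x + partialDeriv i f x * g x := by
  ext x
  have h1 := (hf.differentiable (by simp)).differentiableAt (x := x)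
  have h2 := (hg.differentiable (by simp)).differentiableAt (x := x)
  simp only [partialDeriv]
  rw [fderiv_fun_mul h1 h2]
  simp
  ring

theorem partialDeriv_add {d : ℕ} {i : Fin d} {f g : EuclideanSpace ℝ (Fin d) → ℂ}
    (hf : ContDiff ℝ ∞ f) (hg : ContDiff ℝ ∞ g) :
    partialDeriv i (fun x => f x + g x) = fun x => partialDeriv i f x + partialDeriv i g x := by
  ext x
  have h1 := (hf.differentiable (by simp)).differentiableAt (x := x)
  have h2 := (hg.differentiable (by simp)).differentiableAt (x := x)
  simp only [partialDeriv]
  rw [fderiv_fun_add h1 h2]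
  simp

theorem partialDeriv_partialDeriv_mul {d : ℕ} {i : Fin d} {f g : EuclideanSpace ℝ (Fin d) → ℂ}
    (hf : ContDiff ℝ ∞ f) (hg : ContDiff ℝ ∞ g) (x : EuclideanSpace ℝ (Fin d)) :
    partialDeriv i (partialDeriv i (fun x => f x * g x)) x =
      f x * partialDeriv i (partialDeriv i g) x + 2 * partialDeriv i f x * partialDeriv i g x
        + partialDeriv i (partialDeriv i f) x * g x := by
  rw [partialDeriv_mul hf hg, partialDeriv_add (hf.mul hg.partialDeriv) (hf.partialDeriv.mul hg),
    partialDeriv_mul hf hg.partialDeriv, partialDeriv_mul hf.partialDeriv hg]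
  ring

theorem HasCompactSupport.partialDeriv {d : ℕ} {i : Fin d} {f : EuclideanSpace ℝ (Fin d) → ℂ}
    (hf : HasCompactSupport f) : HasCompactSupport (partialDeriv i f) :=
  HasCompactSupport.comp_left (g := fun A : EuclideanSpace ℝ (Fin d) →L[ℝ] ℂ =>
    A (EuclideanSpace.single i 1)) (hf.fderiv (𝕜 := ℝ)) (by simp)

theorem integral_mul_partialDeriv {d : ℕ} {i : Fin d} {f g : EuclideanSpace ℝ (Fin d) → ℂ}
    (hf : ContDiff ℝ ∞ f) (hg : ContDiff ℝ ∞ g) (hc : HasCompactSupport f) :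
    ∫ x, f x * partialDeriv i g x = - ∫ x, partialDeriv i f x * g x := by
  refine integral_mul_fderiv_eq_neg_fderiv_mul_of_integrable ?_ ?_ ?_
    (fun x _ => hf.differentiable (by simp) x) (fun x _ => hg.differentiable (by simp) x)
  · exact ((hf.partialDeriv (i := i)).continuous.mul hg.continuous).integrable_of_hasCompactSupport
      (hc.partialDeriv.mul_right)
  · exact (hf.continuous.mul (hg.partialDeriv (i := i)).continuous).integrable_of_hasCompactSupport
      (hc.mul_right)
  · exact (hf.continuous.mul hg.continuous).integrable_of_hasCompactSupport (hc.mul_right)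

theorem integral_mul_laplacian {d : ℕ} {f g : EuclideanSpace ℝ (Fin d) → ℂ}
    (hf : ContDiff ℝ ∞ f) (hg : ContDiff ℝ ∞ g) (hc : HasCompactSupport f) :
    ∫ x, f x * (Δ g : EuclideanSpace ℝ (Fin d) → ℂ) x =
      ∫ x, (Δ f : EuclideanSpace ℝ (Fin d) → ℂ) x * g x := by
  simp only [laplacian_eq_sum_partialDeriv hf, laplacian_eq_sum_partialDeriv hg, Finset.mul_sum,
    Finset.sum_mul]
  rw [integral_finsetSum, integral_finsetSum]
  · refine Finset.sum_congr rfl fun i _ => ?_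
    rw [integral_mul_partialDeriv hf hg.partialDeriv hc,
      integral_mul_partialDeriv hf.partialDeriv hg hc.partialDeriv, neg_neg]
  · exact fun i _ => ((hf.partialDeriv (i := i)).partialDeriv.continuous.mul
      hg.continuous).integrable_of_hasCompactSupport (hc.partialDeriv.partialDeriv.mul_right)
  · exact fun i _ => (hf.continuous.mul
      (hg.partialDeriv (i := i)).partialDeriv.continuous).integrable_of_hasCompactSupport
      hc.mul_right

theorem harmonicOscillator_apply {d : ℕ} (f : SmoothFun d) (x : EuclideanSpace ℝ (Fin d)) :
    (harmonicOscillator d f).1 x =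
      ((‖x‖ ^ 2 : ℝ) : ℂ) * f.1 x - (Δ f.1 : EuclideanSpace ℝ (Fin d) → ℂ) x := rfl

theorem partialDeriv_comp_smul {d : ℕ} {i : Fin d} {f : EuclideanSpace ℝ (Fin d) → ℂ}
    (hf : ContDiff ℝ ∞ f) (c : ℝ) :
    partialDeriv i (fun x => f (c • x)) = fun x => (c : ℂ) * partialDeriv i f (c • x) := by
  ext x
  have h1 := (hf.differentiable (by simp)).differentiableAt (x := c • x)
  have h2 : HasFDerivAt (fun x : EuclideanSpace ℝ (Fin d) => c • x)
      (c • ContinuousLinearMap.id ℝ _) x := (hasFDerivAt_id x).const_smul c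
  have h3 := (h1.hasFDerivAt.comp x h2).fderiv
  simp only [partialDeriv]
  rw [show (fun x => f (c • x)) = f ∘ (fun x => c • x) from rfl, h3]
  simp

/-- A sequence of smooth cutoff functions tending to `1`, with derivatives tending to `0`. -/
theorem exists_cutoff (d : ℕ) : ∃ (η : ℕ → EuclideanSpace ℝ (Fin d) → ℂ) (M : ℝ),
    (∀ k, ContDiff ℝ ∞ (η k)) ∧ (∀ k, HasCompactSupport (η k)) ∧
    (∀ k x, ‖η k x‖ ≤ 1) ∧ (∀ x, Filter.Tendsto (fun k => η k x) Filter.atTop (𝓝 1)) ∧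
    (∀ k i x, ‖partialDeriv i (η k) x‖ ≤ M * ((k : ℝ) + 1)⁻¹) ∧
    (∀ k i x, ‖partialDeriv i (partialDeriv i (η k)) x‖ ≤ M * ((k : ℝ) + 1)⁻¹) := by
  let χ : ContDiffBump (0 : EuclideanSpace ℝ (Fin d)) := ⟨1, 2, one_pos, one_lt_two⟩
  let φ : EuclideanSpace ℝ (Fin d) → ℂ := fun x => (χ x : ℂ)
  have hφ : ContDiff ℝ ∞ φ := Complex.ofRealCLM.contDiff.comp χ.contDiff
  have hc : HasCompactSupport φ := χ.hasCompactSupport.comp_left (g := Complex.ofReal) (by simp)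
  have hb : ∀ i, ∃ M, ∀ x, ‖partialDeriv i φ x‖ ≤ M := fun i =>
    hφ.partialDeriv.continuous.bounded_above_of_compact_support hc.partialDeriv
  have hb2 : ∀ i, ∃ M, ∀ x, ‖partialDeriv i (partialDeriv i φ) x‖ ≤ M := fun i =>
    hφ.partialDeriv.partialDeriv.continuous.bounded_above_of_compact_support
      hc.partialDeriv.partialDeriv
  choose M1 hM1 using hb
  choose M2 hM2 using hb2
  have hp1 : ∀ i, 0 ≤ M1 i := fun i => (norm_nonneg _).trans (hM1 i 0)
  have hp2 : ∀ i, 0 ≤ M2 i := fun i => (norm_nonneg _).trans (hM2 i 0)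
  have hs1 : ∀ i, M1 i ≤ ∑ i, (M1 i + M2 i) := fun i =>
    (le_add_of_nonneg_right (hp2 i)).trans (Finset.single_le_sum
      (f := fun i => M1 i + M2 i) (fun j _ => add_nonneg (hp1 j) (hp2 j)) (Finset.mem_univ i))
  have hs2 : ∀ i, M2 i ≤ ∑ i, (M1 i + M2 i) := fun i =>
    (le_add_of_nonneg_left (hp1 i)).trans (Finset.single_le_sum
      (f := fun i => M1 i + M2 i) (fun j _ => add_nonneg (hp1 j) (hp2 j)) (Finset.mem_univ i))
  have hd1 : ∀ (k : ℕ) i, partialDeriv i (fun x => φ ((((k : ℝ) + 1)⁻¹) • x)) =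
      fun x => ((((k : ℝ) + 1)⁻¹ : ℝ) : ℂ) * partialDeriv i φ ((((k : ℝ) + 1)⁻¹) • x) :=
    fun k i => partialDeriv_comp_smul hφ _
  -- Dilates of one bump: each derivative gains a factor 1/(k+1), and the square of this factor is
  -- again at most 1/(k+1). The sum of all bounds serves every coordinate at once.
  refine ⟨fun k x => φ ((((k : ℝ) + 1)⁻¹) • x), ∑ i, (M1 i + M2 i), fun k => ?_, fun k => ?_,
    fun k x => ?_, fun x => ?_, fun k i x => ?_, fun k i x => ?_⟩
  · exact hφ.comp (contDiff_const_smul _)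
  · have h0 : ((k : ℝ) + 1)⁻¹ ≠ 0 := by positivity
    exact hc.comp_homeomorph (Homeomorph.smulOfNeZero _ h0)
  · simp only [φ, Complex.norm_real, Real.norm_eq_abs]
    rw [abs_of_nonneg χ.nonneg]
    exact χ.le_one
  · refine tendsto_const_nhds.congr' ?_
    filter_upwards [Filter.eventually_ge_atTop ⌈‖x‖⌉₊] with k hk
    have : χ ((((k : ℝ) + 1)⁻¹) • x) = 1 := by
      refine χ.one_of_mem_closedBall ?_
      have h1 : ‖x‖ ≤ k := (Nat.le_ceil _).trans (by exact_mod_cast hk)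
      rw [mem_closedBall_zero_iff, norm_smul, Real.norm_eq_abs, abs_of_pos (by positivity),
        inv_mul_le_iff₀ (by positivity)]
      change ‖x‖ ≤ ((k : ℝ) + 1) * 1
      linarith
    simp [φ, this]
  · have hk : ‖((((k : ℝ) + 1)⁻¹ : ℝ) : ℂ)‖ = ((k : ℝ) + 1)⁻¹ := by
      rw [Complex.norm_real, Real.norm_eq_abs, abs_of_pos (by positivity)]
    rw [hd1, norm_mul, hk, mul_comm]
    gcongr
    exact (hM1 i _).trans (hs1 i)
  · have hk : ‖((((k : ℝ) + 1)⁻¹ : ℝ) : ℂ)‖ = ((k : ℝ) + 1)⁻¹ := by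
      rw [Complex.norm_real, Real.norm_eq_abs, abs_of_pos (by positivity)]
    have hk1 : ((k : ℝ) + 1)⁻¹ ≤ 1 := inv_le_one_of_one_le₀ (by linarith [k.cast_nonneg (α := ℝ)])
    have hsm : ContDiff ℝ ∞ (fun x : EuclideanSpace ℝ (Fin d) =>
        partialDeriv i φ ((((k : ℝ) + 1)⁻¹) • x)) :=
      hφ.partialDeriv.comp (contDiff_const_smul _)
    rw [hd1, partialDeriv_mul contDiff_const hsm, partialDeriv_comp_smul hφ.partialDeriv]
    have h0 : partialDeriv i (fun _ : EuclideanSpace ℝ (Fin d) =>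
        ((((k : ℝ) + 1)⁻¹ : ℝ) : ℂ)) x = 0 := by simp [partialDeriv]
    dsimp only at h0 ⊢
    rw [h0, zero_mul, add_zero, norm_mul, norm_mul, hk, mul_comm _ (_ * _)]
    gcongr
    calc _ ≤ 1 * M2 i := by gcongr; exact hM2 i _
      _ ≤ _ := by rw [one_mul]; exact hs2 i

theorem laplacian_cutoff_mul {d : ℕ} {η f : EuclideanSpace ℝ (Fin d) → ℂ}
    (hη : ContDiff ℝ ∞ η) (hf : ContDiff ℝ ∞ f) (x : EuclideanSpace ℝ (Fin d)) :
    (Δ (fun x => η x * f x) : EuclideanSpace ℝ (Fin d) → ℂ) x =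
      η x * (Δ f : EuclideanSpace ℝ (Fin d) → ℂ) x + ∑ i, (2 * partialDeriv i η x *
        partialDeriv i f x + partialDeriv i (partialDeriv i η) x * f x) := by
  rw [laplacian_eq_sum_partialDeriv (hη.mul hf), laplacian_eq_sum_partialDeriv hf, Finset.mul_sum,
    ← Finset.sum_add_distrib]
  refine Finset.sum_congr rfl fun i _ => ?_
  rw [partialDeriv_partialDeriv_mul hη hf]
  ring

/-- Symmetry of the harmonic oscillator: `∫ f Hψ = ∫ (Hf) ψ` if `ψ` and `Hψ` are bounded and
`f`, `∇f`, `Hf` are integrable. -/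
theorem integral_mul_harmonicOscillator {d : ℕ} (f ψ : SmoothFun d)
    (hf : Integrable f.1) (hf1 : ∀ i, Integrable (partialDeriv i f.1))
    (hf2 : Integrable (harmonicOscillator d f).1) {C C' : ℝ}
    (hψ : ∀ x, ‖ψ.1 x‖ ≤ C) (hψ' : ∀ x, ‖(harmonicOscillator d ψ).1 x‖ ≤ C') :
    ∫ x, f.1 x * (harmonicOscillator d ψ).1 x = ∫ x, (harmonicOscillator d f).1 x * ψ.1 x := by
  obtain ⟨η, M, hη, hηc, hη1, hηt, hηd, hηdd⟩ := exists_cutoff d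
  have hfs : ContDiff ℝ ∞ f.1 := f.2
  have hψs : ContDiff ℝ ∞ ψ.1 := ψ.2
  have hM : ∀ (k : ℕ) (i : Fin d), 0 ≤ M := fun k i => by
    have := (norm_nonneg _).trans (hηd 0 i 0)
    simpa using this
  have hk1 : ∀ k : ℕ, ((k : ℝ) + 1)⁻¹ ≤ 1 := fun k =>
    inv_le_one_of_one_le₀ (by linarith [k.cast_nonneg (α := ℝ)])
  have hkt : Filter.Tendsto (fun k : ℕ => M * ((k : ℝ) + 1)⁻¹) Filter.atTop (𝓝 0) := by
    have := (tendsto_one_div_add_atTop_nhds_zero_nat (𝕜 := ℝ)).const_mul M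
    simpa using this
  -- Nothing is known about ∇ψ, so both derivatives are moved onto ηf. The commutator of Δ with η
  -- contains only derivatives of η times f or ∂f, and these terms vanish in the limit.
  have key : ∀ k, ∫ x, (η k x * f.1 x) * (harmonicOscillator d ψ).1 x =
      ∫ x, (η k x * (harmonicOscillator d f).1 x - ∑ i, (2 * partialDeriv i (η k) x *
        partialDeriv i f.1 x + partialDeriv i (partialDeriv i (η k)) x * f.1 x)) * ψ.1 x := by
    intro k
    have hg : ContDiff ℝ ∞ (fun x => η k x * f.1 x) := (hη k).mul hfs
    have hgc : HasCompactSupport (fun x => η k x * f.1 x) := (hηc k).mul_right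
    have h1 := integral_mul_laplacian hg hψs hgc
    have hn : Continuous fun x : EuclideanSpace ℝ (Fin d) => ((‖x‖ ^ 2 : ℝ) : ℂ) := by fun_prop
    have i1 : Integrable fun x => (η k x * f.1 x) * (((‖x‖ ^ 2 : ℝ) : ℂ) * ψ.1 x) :=
      (hg.continuous.mul (hn.mul hψs.continuous)).integrable_of_hasCompactSupport hgc.mul_right
    have i2 : Integrable fun x => (η k x * f.1 x) *
        (Δ ψ.1 : EuclideanSpace ℝ (Fin d) → ℂ) x :=
      (hg.continuous.mul (contDiff_laplacian hψs).continuous).integrable_of_hasCompactSupport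
        hgc.mul_right
    have hgl : HasCompactSupport (Δ (fun x => η k x * f.1 x) : EuclideanSpace ℝ (Fin d) → ℂ) := by
      have : (Δ (fun x => η k x * f.1 x) : EuclideanSpace ℝ (Fin d) → ℂ) =
        fun x => ∑ i, partialDeriv i (partialDeriv i (fun x => η k x * f.1 x)) x :=
        funext (laplacian_eq_sum_partialDeriv hg)
      rw [this]
      refine HasCompactSupport.of_support_subset_isCompact hgc fun x hx => ?_
      by_contra hx'
      refine hx (Finset.sum_eq_zero fun i _ => ?_)
      have h1 := fun h => hx' ((tsupport_fderiv_apply_subset ℝ (EuclideanSpace.single i 1)) h)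
      exact image_eq_zero_of_notMem_tsupport
        (fun h => h1 ((tsupport_fderiv_apply_subset ℝ (EuclideanSpace.single i 1)) h))
    have i3 : Integrable fun x => (Δ (fun x => η k x * f.1 x) : EuclideanSpace ℝ (Fin d) → ℂ) x *
        ψ.1 x :=
      ((contDiff_laplacian hg).continuous.mul hψs.continuous).integrable_of_hasCompactSupport
        hgl.mul_right
    simp only [harmonicOscillator_apply]
    calc _ = ∫ x, ((η k x * f.1 x) * (((‖x‖ ^ 2 : ℝ) : ℂ) * ψ.1 x) -
          (η k x * f.1 x) * (Δ ψ.1 : EuclideanSpace ℝ (Fin d) → ℂ) x) := by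
          simp only [mul_sub]
      _ = ∫ x, ((η k x * f.1 x) * (((‖x‖ ^ 2 : ℝ) : ℂ) * ψ.1 x) -
          (Δ (fun x => η k x * f.1 x) : EuclideanSpace ℝ (Fin d) → ℂ) x * ψ.1 x) := by
          rw [integral_sub i1 i2, h1, integral_sub i1 i3]
      _ = _ := by
          refine integral_congr_ae (.of_forall fun x => ?_)
          simp only [laplacian_cutoff_mul (hη k) hfs]
          ring
  have hC : 0 ≤ C := (norm_nonneg _).trans (hψ 0)
  have hC' : 0 ≤ C' := (norm_nonneg _).trans (hψ' 0)
  have hHψc : Continuous (harmonicOscillator d ψ).1 :=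
    ContDiff.continuous (𝕜 := ℝ) (n := ∞) (harmonicOscillator d ψ).2
  have hHfc : Continuous (harmonicOscillator d f).1 :=
    ContDiff.continuous (𝕜 := ℝ) (n := ∞) (harmonicOscillator d f).2
  have T1 : Filter.Tendsto (fun k => ∫ x, (η k x * f.1 x) * (harmonicOscillator d ψ).1 x)
      Filter.atTop (𝓝 (∫ x, f.1 x * (harmonicOscillator d ψ).1 x)) := by
    refine tendsto_integral_of_dominated_convergence (fun x => ‖f.1 x‖ * C') (fun k => ?_)
      (hf.norm.mul_const C') (fun k => .of_forall fun x => ?_) (.of_forall fun x => ?_)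
    · exact (((hη k).continuous.mul hfs.continuous).mul hHψc).aestronglyMeasurable
    · rw [norm_mul, norm_mul]
      gcongr
      · exact mul_le_of_le_one_left (norm_nonneg _) (hη1 k x)
      · exact hψ' x
    · simpa using ((hηt x).mul_const (f.1 x)).mul_const ((harmonicOscillator d ψ).1 x)
  have T2 : Filter.Tendsto (fun k => ∫ x, (η k x * (harmonicOscillator d f).1 x -
        ∑ i, (2 * partialDeriv i (η k) x *
        partialDeriv i f.1 x + partialDeriv i (partialDeriv i (η k)) x * f.1 x)) * ψ.1 x)
      Filter.atTop (𝓝 (∫ x, (harmonicOscillator d f).1 x * ψ.1 x)) := by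
    refine tendsto_integral_of_dominated_convergence (fun x => (‖(harmonicOscillator d f).1 x‖ +
      ∑ i, (2 * M * ‖partialDeriv i f.1 x‖ + M * ‖f.1 x‖)) * C) (fun k => ?_)
      ?_ (fun k => .of_forall fun x => ?_) (.of_forall fun x => ?_)
    · refine Continuous.aestronglyMeasurable ?_
      refine (((hη k).continuous.mul hHfc).sub (continuous_finsetSum _ fun i _ => ?_)).mul
        hψs.continuous
      exact ((continuous_const.mul (hη k).partialDeriv.continuous).mul
        hfs.partialDeriv.continuous).add ((hη k).partialDeriv.partialDeriv.continuous.mul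
        hfs.continuous)
    · refine (hf2.norm.add (integrable_finsetSum _ fun i _ => ?_)).mul_const C
      exact ((hf1 i).norm.const_mul _).add (hf.norm.const_mul _)
    · rw [norm_mul]
      refine mul_le_mul ?_ (hψ x) (norm_nonneg _) (by
        have := fun i => hM 0 i
        have : ∀ i ∈ Finset.univ, 0 ≤ (2 * M * ‖partialDeriv i f.1 x‖ + M * ‖f.1 x‖) :=
          fun i _ => by have := hM 0 i; positivity
        have := Finset.sum_nonneg this
        positivity)
      refine (norm_sub_le _ _).trans (add_le_add ?_ ((norm_sum_le _ _).trans
        (Finset.sum_le_sum fun i _ => (norm_add_le _ _).trans ?_)))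
      · rw [norm_mul]
        exact mul_le_of_le_one_left (norm_nonneg _) (hη1 k x)
      · have hMk : M * ((k : ℝ) + 1)⁻¹ ≤ M := mul_le_of_le_one_right (hM 0 i) (hk1 k)
        rw [norm_mul, norm_mul, norm_mul, Complex.norm_ofNat]
        gcongr
        · exact (hηd k i x).trans hMk
        · exact (hηdd k i x).trans hMk
    · have h1 : ∀ i, Filter.Tendsto (fun k => partialDeriv i (η k) x) Filter.atTop (𝓝 0) :=
        fun i => squeeze_zero_norm (fun k => hηd k i x) hkt
      have h2 : ∀ i, Filter.Tendsto (fun k => partialDeriv i (partialDeriv i (η k)) x)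
          Filter.atTop (𝓝 0) :=
        fun i => squeeze_zero_norm (fun k => hηdd k i x) hkt
      have h3 := ((hηt x).mul_const ((harmonicOscillator d f).1 x)).sub
        (tendsto_finsetSum Finset.univ fun i _ =>
          (((h1 i).const_mul 2).mul_const (partialDeriv i f.1 x)).add ((h2 i).mul_const (f.1 x)))
      simpa using h3.mul_const (ψ.1 x)
  simp only [key] at T1
  exact tendsto_nhds_unique T1 T2

/-! ### The harmonic oscillator on functions `q(L x) e^{-|x|²/2}` -/

/-- The Gaussian `e^{-|x|²/2}`. -/
noncomputable def stdGauss {d : ℕ} (x : EuclideanSpace ℝ (Fin d)) : ℂ :=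
  Complex.exp (-((‖x‖ ^ 2 : ℝ) : ℂ) / 2)

theorem contDiff_stdGauss {d : ℕ} : ContDiff ℝ ∞ (stdGauss (d := d)) := by
  have h : ContDiff ℝ ∞ fun x : EuclideanSpace ℝ (Fin d) => ((‖x‖ ^ 2 : ℝ) : ℂ) :=
    Complex.ofRealCLM.contDiff.comp (contDiff_norm_sq ℝ)
  exact (h.neg.div_const 2).cexp

theorem stdGauss_eq {d : ℕ} (x : EuclideanSpace ℝ (Fin d)) :
    stdGauss x = ((Real.exp (-‖x‖ ^ 2 / 2) : ℝ) : ℂ) := by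
  rw [stdGauss]; push_cast; rfl

theorem norm_stdGauss {d : ℕ} (x : EuclideanSpace ℝ (Fin d)) :
    ‖stdGauss x‖ = Real.exp (-‖x‖ ^ 2 / 2) := by
  rw [stdGauss_eq, Complex.norm_real, Real.norm_eq_abs, Real.abs_exp]

theorem partialDeriv_stdGauss {d : ℕ} (i : Fin d) :
    partialDeriv i (stdGauss (d := d)) = fun x => -(x i : ℂ) * stdGauss x := by
  ext x
  have h1 : HasFDerivAt (fun x : EuclideanSpace ℝ (Fin d) => ‖x‖ ^ 2)
      (2 • innerSL ℝ x) x := (hasStrictFDerivAt_norm_sq x).hasFDerivAt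
  have h2 := ((Complex.ofRealCLM.hasFDerivAt.comp x h1).neg.mul_const ((1 : ℂ) / 2)).cexp
  have h3 : (stdGauss (d := d)) = fun x => Complex.exp
      ((-(Complex.ofRealCLM ∘ fun x : EuclideanSpace ℝ (Fin d) => ‖x‖ ^ 2)) x * (1 / 2)) := by
    ext x; simp [stdGauss, div_eq_mul_inv]
  rw [partialDeriv, h3, h2.fderiv]
  simp [EuclideanSpace.inner_single_right]
  ring

theorem Differentiable.contDiff_real {q : ℂ → ℂ} (hq : Differentiable ℂ q) : ContDiff ℝ ∞ q :=
  (hq.contDiff (n := ∞)).restrict_scalars ℝ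

theorem Differentiable.differentiable_deriv {q : ℂ → ℂ} (hq : Differentiable ℂ q) :
    Differentiable ℂ (_root_.deriv q) := fun z =>
  ((hq.analyticAt z).deriv).differentiableAt

theorem partialDeriv_comp_linear {d : ℕ} (i : Fin d) {q : ℂ → ℂ} (hq : Differentiable ℂ q)
    (L : EuclideanSpace ℝ (Fin d) →L[ℝ] ℂ) :
    partialDeriv i (fun x => q (L x)) =
      fun x => L (EuclideanSpace.single i 1) * deriv q (L x) := by
  ext x
  have h1 : HasFDerivAt q _ (L x) := (hq (L x)).hasDerivAt.hasFDerivAt.restrictScalars ℝ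
  have h2 := (h1.comp x L.hasFDerivAt).fderiv
  rw [partialDeriv, show (fun x => q (L x)) = q ∘ L from rfl, h2]
  simp

theorem partialDeriv_coord_mul_stdGauss {d : ℕ} (i : Fin d) (x : EuclideanSpace ℝ (Fin d)) :
    partialDeriv i (partialDeriv i (stdGauss (d := d))) x = ((x i : ℂ) ^ 2 - 1) * stdGauss x := by
  have hc : ContDiff ℝ ∞ fun x : EuclideanSpace ℝ (Fin d) => -(x i : ℂ) :=
    (Complex.ofRealCLM.contDiff.comp (EuclideanSpace.proj (𝕜 := ℝ) i).contDiff).neg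
  have h1 : partialDeriv i (fun x : EuclideanSpace ℝ (Fin d) => -(x i : ℂ)) x = -1 := by
    have : HasFDerivAt (fun x : EuclideanSpace ℝ (Fin d) => -(x i : ℂ)) _ x :=
      (Complex.ofRealCLM.hasFDerivAt.comp x (EuclideanSpace.proj (𝕜 := ℝ) i).hasFDerivAt).neg
    rw [partialDeriv, this.fderiv]
    simp
  rw [partialDeriv_stdGauss, partialDeriv_mul hc contDiff_stdGauss, partialDeriv_stdGauss]
  dsimp only
  rw [h1]
  ring

/-- The harmonic oscillator acts on `q(L x) e^{-|x|²/2}` as `q ↦ d q + 2 y q' - κ q''`,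
`κ = ∑ L(e_i)²`. -/
theorem harmonicOscillator_gaussian {d : ℕ} {q : ℂ → ℂ} (hq : Differentiable ℂ q)
    (L : EuclideanSpace ℝ (Fin d) →L[ℝ] ℂ) (f : SmoothFun d)
    (hf : ∀ x, f.1 x = q (L x) * stdGauss x) (x : EuclideanSpace ℝ (Fin d)) :
    (harmonicOscillator d f).1 x = (d * q (L x) + 2 * L x * deriv q (L x) -
      (∑ i, L (EuclideanSpace.single i 1) ^ 2) * deriv (deriv q) (L x)) * stdGauss x := by
  have hf' : f.1 = fun x => q (L x) * stdGauss x := funext hf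
  have hqL : ContDiff ℝ ∞ (fun x => q (L x)) := hq.contDiff_real.comp L.contDiff
  have hqL' : ContDiff ℝ ∞ (fun x => deriv q (L x)) :=
    hq.differentiable_deriv.contDiff_real.comp L.contDiff
  rw [harmonicOscillator_apply, laplacian_eq_sum_partialDeriv f.2, hf']
  have h : ∀ i, partialDeriv i (partialDeriv i fun x => q (L x) * stdGauss x) x =
      (q (L x) * (x i : ℂ) ^ 2 - q (L x) - 2 * deriv q (L x) *
        ((x i : ℂ) * L (EuclideanSpace.single i 1)) +
        L (EuclideanSpace.single i 1) ^ 2 * deriv (deriv q) (L x)) * stdGauss x := by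
    intro i
    rw [partialDeriv_partialDeriv_mul hqL contDiff_stdGauss, partialDeriv_coord_mul_stdGauss,
      partialDeriv_comp_linear i hq, partialDeriv_stdGauss,
      partialDeriv_mul contDiff_const hqL', partialDeriv_comp_linear i hq.differentiable_deriv]
    have h0 : partialDeriv i (fun _ : EuclideanSpace ℝ (Fin d) =>
        L (EuclideanSpace.single i 1)) x = 0 := by simp [partialDeriv]
    dsimp only at h0 ⊢
    rw [h0]
    ring
  have hn : ((‖x‖ ^ 2 : ℝ) : ℂ) = ∑ i, (x i : ℂ) ^ 2 := by
    rw [EuclideanSpace.real_norm_sq_eq]; push_cast; rfl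
  have hL : L x = ∑ i, (x i : ℂ) * L (EuclideanSpace.single i 1) := by
    conv_lhs => rw [← (EuclideanSpace.basisFun (Fin d) ℝ).sum_repr x]
    simp
  simp only [h, ← Finset.sum_mul, Finset.sum_add_distrib, Finset.sum_sub_distrib, ← Finset.mul_sum,
    ← hn, ← hL]
  simp
  ring

/-! ### Hermite functions in a direction -/

/-- The function `H_n(⟨v, x⟩) e^{-|x|²/2}`. -/
noncomputable def hermiteGauss {d : ℕ} (v : EuclideanSpace ℝ (Fin d)) (n : ℕ) : SmoothFun d :=
  ⟨fun x => (((hermitePoly n).eval (inner ℝ v x) * Real.exp (-‖x‖ ^ 2 / 2) : ℝ) : ℂ), by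
    have h1 : ContDiff ℝ ∞ fun x : EuclideanSpace ℝ (Fin d) =>
        (hermitePoly n).eval (inner ℝ v x) :=
      (by simpa using! (hermitePoly n).contDiff_aeval (𝕜 := ℝ) ∞ :
        ContDiff ℝ ∞ fun t => (hermitePoly n).eval t).comp (innerSL ℝ v).contDiff
    exact Complex.ofRealCLM.contDiff.comp
      (h1.mul ((contDiff_norm_sq ℝ).neg.div_const 2).exp)⟩

theorem hermiteGauss_apply {d : ℕ} (v : EuclideanSpace ℝ (Fin d)) (n : ℕ)
    (x : EuclideanSpace ℝ (Fin d)) : (hermiteGauss v n).1 x =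
      (((hermitePoly n).eval (inner ℝ v x) * Real.exp (-‖x‖ ^ 2 / 2) : ℝ) : ℂ) := rfl

theorem hermiteGauss_apply' {d : ℕ} (v : EuclideanSpace ℝ (Fin d)) (n : ℕ)
    (x : EuclideanSpace ℝ (Fin d)) : (hermiteGauss v n).1 x =
      Polynomial.aeval ((Complex.ofRealCLM.comp (innerSL ℝ v)) x) (hermitePoly n) *
        stdGauss x := by
  have e : Polynomial.aeval ((inner ℝ v x : ℝ) : ℂ) (hermitePoly n) =
    (((hermitePoly n).eval (inner ℝ v x) : ℝ) : ℂ) := Polynomial.aeval_ofReal (K := ℂ) _ _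
  rw [hermiteGauss_apply, stdGauss_eq]
  push_cast
  rw [← e]
  simp

theorem sum_ofReal_inner_single_sq {d : ℕ} (v : EuclideanSpace ℝ (Fin d)) :
    ∑ i, ((Complex.ofRealCLM.comp (innerSL ℝ v)) (EuclideanSpace.single i 1)) ^ 2 =
      ((‖v‖ ^ 2 : ℝ) : ℂ) := by
  rw [EuclideanSpace.real_norm_sq_eq]
  simp [EuclideanSpace.inner_single_right]

/-- For a unit vector κ = 1, so the operator on profiles is q ↦ dq + 2yq' - q'', and the Hermite
equation supplies the 2n. -/
theorem harmonicOscillator_hermiteGauss {d : ℕ} {v : EuclideanSpace ℝ (Fin d)} (hv : ‖v‖ = 1)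
    (n : ℕ) : harmonicOscillator d (hermiteGauss v n) = (2 * n + d : ℂ) • hermiteGauss v n := by
  ext x
  have hd : deriv (fun z : ℂ => Polynomial.aeval z (hermitePoly n)) = fun z : ℂ =>
      Polynomial.aeval z (Polynomial.derivative (hermitePoly n)) :=
    funext fun z => (Polynomial.hasDerivAt_aeval _ _).deriv
  have hd2 : deriv (fun z : ℂ => Polynomial.aeval z (Polynomial.derivative (hermitePoly n))) =
      fun z : ℂ => Polynomial.aeval z (Polynomial.derivative
        (Polynomial.derivative (hermitePoly n))) :=
    funext fun z => (Polynomial.hasDerivAt_aeval _ _).deriv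
  rw [harmonicOscillator_gaussian (Polynomial.differentiable_aeval _) _ _
    (hermiteGauss_apply' v n), hd, hd2, sum_ofReal_inner_single_sq, hv]
  set y := (Complex.ofRealCLM.comp (innerSL ℝ v)) x with hy
  have h := congrArg (fun p => Polynomial.aeval y p) (hermitePoly_ode n)
  have h3 : Polynomial.aeval y (2 : Polynomial ℝ) = 2 := map_ofNat _ 2
  simp only [map_sub, map_mul, Polynomial.aeval_X, h3, map_natCast, Nat.cast_mul,
    Nat.cast_ofNat] at h
  have hr : (((2 * n + d : ℂ) • hermiteGauss v n : SmoothFun d)).1 x =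
    (2 * n + d : ℂ) * (hermiteGauss v n).1 x := rfl
  rw [hr, hermiteGauss_apply', ← hy]
  push_cast
  linear_combination stdGauss x * h

theorem harmonicOscillator_pow_hermiteGauss {d : ℕ} {v : EuclideanSpace ℝ (Fin d)} (hv : ‖v‖ = 1)
    (n N : ℕ) : (harmonicOscillator d ^ N) (hermiteGauss v n) =
      ((2 * n + d : ℂ) ^ N) • hermiteGauss v n := by
  induction N with
  | zero => simp
  | succ N ih =>
    rw [pow_succ', Module.End.mul_apply, ih, map_smul, harmonicOscillator_hermiteGauss hv,
      smul_smul, pow_succ]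

theorem abs_inner_le_norm_of_unit {d : ℕ} {v : EuclideanSpace ℝ (Fin d)} (hv : ‖v‖ = 1)
    (x : EuclideanSpace ℝ (Fin d)) : |inner ℝ v x| ≤ ‖x‖ := by
  simpa [hv] using abs_real_inner_le_norm v x

/-- Half of the Gaussian exponent absorbs the factor e^{t²/4} of `abs_eval_hermitePoly_le`, since
|t| = |⟨v,x⟩| ≤ |x|; the other half keeps the bound integrable. -/
theorem norm_hermiteGauss_le {d : ℕ} {v : EuclideanSpace ℝ (Fin d)} (hv : ‖v‖ = 1)
    (n : ℕ) (x : EuclideanSpace ℝ (Fin d)) : ‖(hermiteGauss v n).1 x‖ ≤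
      Real.sqrt n.factorial * Real.exp 5 ^ n * Real.exp (-(1 / 4) * ‖x‖ ^ 2) := by
  rw [hermiteGauss_apply, Complex.norm_real, norm_mul, Real.norm_eq_abs, Real.norm_eq_abs,
    Real.abs_exp]
  calc _ ≤ Real.sqrt n.factorial * Real.exp 5 ^ n * Real.exp ((inner ℝ v x) ^ 2 / 4) *
        Real.exp (-‖x‖ ^ 2 / 2) := by
        gcongr; exact abs_eval_hermitePoly_le _ _
    _ = Real.sqrt n.factorial * Real.exp 5 ^ n *
        Real.exp ((inner ℝ v x) ^ 2 / 4 + -‖x‖ ^ 2 / 2) := by rw [mul_assoc, ← Real.exp_add]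
    _ ≤ _ := by
        gcongr
        have := sq_le_sq' (neg_le_of_abs_le (abs_inner_le_norm_of_unit hv x))
          (le_of_abs_le (abs_inner_le_norm_of_unit hv x))
        linarith

theorem integrable_exp_neg_mul_norm_sq {d : ℕ} {b : ℝ} (hb : 0 < b) :
    Integrable fun x : EuclideanSpace ℝ (Fin d) => Real.exp (-b * ‖x‖ ^ 2) := by
  have := (GaussianFourier.integrable_cexp_neg_mul_sq_norm_add (V := EuclideanSpace ℝ (Fin d))
    (b := (b : ℂ)) (by simpa using hb) 0 0).norm
  refine this.congr (.of_forall fun x => ?_)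
  have : (-(b : ℂ) * (‖x‖ : ℂ) ^ 2) = ((-b * ‖x‖ ^ 2 : ℝ) : ℂ) := by push_cast; ring
  simp [Complex.norm_exp, this]
  left
  norm_cast

theorem SmoothFun.continuous {d : ℕ} (f : SmoothFun d) : Continuous f.1 :=
  ContDiff.continuous (𝕜 := ℝ) (n := ∞) f.2

theorem integrable_hermiteGauss {d : ℕ} {v : EuclideanSpace ℝ (Fin d)} (hv : ‖v‖ = 1)
    (n : ℕ) : Integrable (hermiteGauss v n).1 :=
  ((integrable_exp_neg_mul_norm_sq (by norm_num)).const_mul _).mono'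
    (SmoothFun.continuous (hermiteGauss v n)).aestronglyMeasurable
    (.of_forall (norm_hermiteGauss_le hv n))

theorem integral_norm_hermiteGauss_le {d : ℕ} {v : EuclideanSpace ℝ (Fin d)} (hv : ‖v‖ = 1)
    (n : ℕ) : ∫ x, ‖(hermiteGauss v n).1 x‖ ≤ Real.sqrt n.factorial * Real.exp 5 ^ n *
      ∫ x : EuclideanSpace ℝ (Fin d), Real.exp (-(1 / 4) * ‖x‖ ^ 2) := by
  rw [← integral_const_mul]
  exact integral_mono (integrable_hermiteGauss hv n).norm
    ((integrable_exp_neg_mul_norm_sq (by norm_num)).const_mul _) (norm_hermiteGauss_le hv n)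

/-- The constant 1/8 leaves room for a second such factor, from ‖x‖ + 1, with e^{-|x|²/4} remaining
of the Gaussian. -/
theorem exists_abs_eval_le_exp (p : Polynomial ℝ) :
    ∃ C, 0 ≤ C ∧ ∀ t : ℝ, |p.eval t| ≤ C * Real.exp (t ^ 2 / 8) := by
  induction p using Polynomial.induction_on' with
  | add p q hp hq =>
    obtain ⟨a, ha0, ha⟩ := hp
    obtain ⟨b, hb0, hb⟩ := hq
    refine ⟨a + b, by positivity, fun t => ?_⟩
    rw [Polynomial.eval_add, add_mul]
    exact (abs_add_le _ _).trans (add_le_add (ha t) (hb t))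
  | monomial n a =>
    refine ⟨|a| * (n.factorial * Real.exp 2), by positivity, fun t => ?_⟩
    rw [Polynomial.eval_monomial, abs_mul, abs_pow, mul_assoc]
    gcongr
    have h1 := Real.pow_div_factorial_le_exp |t| (abs_nonneg t) n
    rw [div_le_iff₀ (by positivity)] at h1
    refine h1.trans ?_
    rw [mul_comm, mul_assoc, ← Real.exp_add]
    gcongr
    nlinarith [sq_nonneg (|t| - 4), sq_abs t]

theorem integrable_polynomial_mul_stdGauss {d : ℕ} {v : EuclideanSpace ℝ (Fin d)} (hv : ‖v‖ = 1)
    (p : Polynomial ℝ) {g : EuclideanSpace ℝ (Fin d) → ℂ} (hg : Continuous g)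
    (hg' : ∀ x, ‖g x‖ ≤ ‖x‖ + 1) : Integrable fun x : EuclideanSpace ℝ (Fin d) =>
      g x * ((p.eval (inner ℝ v x) : ℝ) : ℂ) * stdGauss x := by
  obtain ⟨C, hC0, hC⟩ := exists_abs_eval_le_exp p
  refine ((integrable_exp_neg_mul_norm_sq (b := 1 / 4) (by norm_num)).const_mul
    (Real.exp 2 * C)).mono' ?_ (.of_forall fun x => ?_)
  · refine Continuous.aestronglyMeasurable ?_
    refine (hg.mul ?_).mul contDiff_stdGauss.continuous
    exact Complex.continuous_ofReal.comp (p.continuous.comp (innerSL ℝ v).continuous)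
  · rw [norm_mul, norm_mul, norm_stdGauss, Complex.norm_real, Real.norm_eq_abs]
    have h1 : ‖x‖ + 1 ≤ Real.exp 2 * Real.exp (‖x‖ ^ 2 / 8) := by
      rw [← Real.exp_add]
      refine (Real.add_one_le_exp _).trans (Real.exp_le_exp.2 ?_)
      nlinarith [sq_nonneg (‖x‖ - 4)]
    have h2 : |p.eval (inner ℝ v x)| ≤ C * Real.exp (‖x‖ ^ 2 / 8) := by
      refine (hC _).trans ?_
      have := sq_le_sq' (neg_le_of_abs_le (abs_inner_le_norm_of_unit hv x))
          (le_of_abs_le (abs_inner_le_norm_of_unit hv x))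
      gcongr
    calc _ ≤ (Real.exp 2 * Real.exp (‖x‖ ^ 2 / 8)) * (C * Real.exp (‖x‖ ^ 2 / 8)) *
          Real.exp (-‖x‖ ^ 2 / 2) := by
          gcongr
          exact (hg' x).trans h1
      _ = Real.exp 2 * C * (Real.exp (‖x‖ ^ 2 / 8) * Real.exp (‖x‖ ^ 2 / 8) *
          Real.exp (-‖x‖ ^ 2 / 2)) := by ring
      _ = _ := by
          rw [← Real.exp_add, ← Real.exp_add]
          ring_nf

theorem integrable_partialDeriv_hermiteGauss {d : ℕ} {v : EuclideanSpace ℝ (Fin d)} (hv : ‖v‖ = 1)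
    (n : ℕ) (i : Fin d) : Integrable (partialDeriv i (hermiteGauss v n).1) := by
  set L := Complex.ofRealCLM.comp (innerSL ℝ v) with hL
  have hq : Differentiable ℂ fun z : ℂ => Polynomial.aeval z (hermitePoly n) :=
    Polynomial.differentiable_aeval _
  have hd : deriv (fun z : ℂ => Polynomial.aeval z (hermitePoly n)) = fun z : ℂ =>
      Polynomial.aeval z (Polynomial.derivative (hermitePoly n)) :=
    funext fun z => (Polynomial.hasDerivAt_aeval _ _).deriv
  have e : ∀ (p : Polynomial ℝ) (x : EuclideanSpace ℝ (Fin d)),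
      Polynomial.aeval (L x) p = ((p.eval (inner ℝ v x) : ℝ) : ℂ) := fun p x =>
    Polynomial.aeval_ofReal (K := ℂ) _ _
  have h1 : partialDeriv i (hermiteGauss v n).1 = fun x =>
      -((x i : ℂ) * (((hermitePoly n).eval (inner ℝ v x) : ℝ) : ℂ) * stdGauss x) +
        L (EuclideanSpace.single i 1) * (1 *
        (((Polynomial.derivative (hermitePoly n)).eval (inner ℝ v x) : ℝ) : ℂ) * stdGauss x) := by
    rw [show (hermiteGauss v n).1 = _ from funext (hermiteGauss_apply' v n),
      ← hL, partialDeriv_mul (f := fun x => Polynomial.aeval (L x) (hermitePoly n))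
        (hq.contDiff_real.comp L.contDiff) contDiff_stdGauss,
      partialDeriv_comp_linear i hq, partialDeriv_stdGauss, hd]
    ext x
    dsimp only
    rw [e, e]
    ring
  rw [h1]
  refine (integrable_polynomial_mul_stdGauss hv _ (by fun_prop) fun x => ?_).neg.add
    ((integrable_polynomial_mul_stdGauss hv _ continuous_const fun x => by simp).const_mul _)
  rw [Complex.norm_real]
  exact (PiLp.norm_apply_le x i).trans (by linarith)

/-- Iterated symmetry of H against an eigenfunction. The induction passes from ψ to Hψ, so
boundedness is required of all iterates, a condition stable under this step. -/
theorem integral_hermiteGauss_mul_pow {d : ℕ} {v : EuclideanSpace ℝ (Fin d)} (hv : ‖v‖ = 1)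
    (n N : ℕ) (ψ : SmoothFun d)
    (hψ : ∀ N, ∃ C, ∀ x, ‖((harmonicOscillator d ^ N) ψ).1 x‖ ≤ C) :
    ∫ x, (hermiteGauss v n).1 x * ((harmonicOscillator d ^ N) ψ).1 x =
      (2 * n + d : ℂ) ^ N * ∫ x, (hermiteGauss v n).1 x * ψ.1 x := by
  induction N generalizing ψ with
  | zero => simp
  | succ N ih =>
    have h1 : ∀ N, (harmonicOscillator d ^ N) (harmonicOscillator d ψ) =
      (harmonicOscillator d ^ (N + 1)) ψ := fun N => by rw [pow_succ, Module.End.mul_apply]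
    rw [← h1, ih _ (fun N => by rw [h1]; exact hψ _)]
    obtain ⟨C, hC⟩ := hψ 0
    obtain ⟨C', hC'⟩ := hψ 1
    rw [pow_zero, Module.End.one_apply] at hC
    rw [pow_one] at hC'
    have hi : (harmonicOscillator d (hermiteGauss v n)).1 =
        fun x => (2 * n + d : ℂ) * (hermiteGauss v n).1 x := by
      rw [harmonicOscillator_hermiteGauss hv]; rfl
    rw [integral_mul_harmonicOscillator _ _ (integrable_hermiteGauss hv n)
      (integrable_partialDeriv_hermiteGauss hv n)
      (by rw [hi]; exact (integrable_hermiteGauss hv n).const_mul _) hC hC', hi, pow_succ]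
    simp only [mul_assoc, integral_const_mul]

theorem integrable_hermiteGauss_mul {d : ℕ} {v : EuclideanSpace ℝ (Fin d)} (hv : ‖v‖ = 1)
    (n : ℕ) {ψ : EuclideanSpace ℝ (Fin d) → ℂ} (hc : AEStronglyMeasurable ψ) {C : ℝ}
    (hψ : ∀ x, ‖ψ x‖ ≤ C) : Integrable fun x => (hermiteGauss v n).1 x * ψ x :=
  (integrable_hermiteGauss hv n).mul_bdd (c := C) hc (.of_forall hψ)

/-- The Hermite coefficients of `ψ` in terms of the powers of the harmonic oscillator. -/
theorem norm_integral_hermiteGauss_mul_le {d : ℕ} {v : EuclideanSpace ℝ (Fin d)} (hv : ‖v‖ = 1)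
    (n N : ℕ) (ψ : SmoothFun d) (B : ℕ → ℝ)
    (hψ : ∀ N x, ‖((harmonicOscillator d ^ N) ψ).1 x‖ ≤ B N) :
    (2 * n + d : ℝ) ^ N * ‖∫ x, (hermiteGauss v n).1 x * ψ.1 x‖ ≤
      Real.sqrt n.factorial * Real.exp 5 ^ n *
      (∫ x : EuclideanSpace ℝ (Fin d), Real.exp (-(1 / 4) * ‖x‖ ^ 2)) * B N := by
  have h := integral_hermiteGauss_mul_pow hv n N ψ fun N => ⟨B N, hψ N⟩
  have h2 : ‖(2 * n + d : ℂ)‖ = 2 * n + d := by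
    have : (2 * n + d : ℂ) = ((2 * n + d : ℝ) : ℂ) := by push_cast; rfl
    rw [this, Complex.norm_real, Real.norm_eq_abs, abs_of_nonneg (by positivity)]
  have h3 := congrArg norm h
  rw [norm_mul, norm_pow, h2] at h3
  rw [← h3]
  have hB : 0 ≤ B N := (norm_nonneg _).trans (hψ N 0)
  calc _ ≤ ∫ x, ‖(hermiteGauss v n).1 x * ((harmonicOscillator d ^ N) ψ).1 x‖ :=
        norm_integral_le_integral_norm _
    _ ≤ ∫ x, ‖(hermiteGauss v n).1 x‖ * B N := by
        refine integral_mono (integrable_hermiteGauss_mul hv n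
          (SmoothFun.continuous _).aestronglyMeasurable (hψ N)).norm
          ((integrable_hermiteGauss hv n).norm.mul_const _) fun x => ?_
        dsimp only
        rw [norm_mul]
        gcongr
        exact hψ N x
    _ = (∫ x, ‖(hermiteGauss v n).1 x‖) * B N := integral_mul_const _ _
    _ ≤ _ := by gcongr; exact integral_norm_hermiteGauss_le hv n

/-! ### Gaussian integrals with complex symmetric matrices -/

theorem Matrix.IsHermitian.exists_transpose_mul_mul_eq_diagonal {d : ℕ}
    {A : Matrix (Fin d) (Fin d) ℝ} (hA : A.IsHermitian) :
    ∃ U : Matrix (Fin d) (Fin d) ℝ, U.transpose * U = 1 ∧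
      U.transpose * A * U = Matrix.diagonal hA.eigenvalues := by
  have hs : (star (hA.eigenvectorUnitary : Matrix (Fin d) (Fin d) ℝ)) =
      (hA.eigenvectorUnitary : Matrix (Fin d) (Fin d) ℝ).transpose := by
    rw [Matrix.star_eq_conjTranspose, Matrix.conjTranspose_eq_transpose_of_trivial]
  refine ⟨hA.eigenvectorUnitary, ?_, ?_⟩
  · rw [← hs]
    exact Unitary.coe_star_mul_self _
  · rw [← hs]
    have := hA.conjStarAlgAut_star_eigenvectorUnitary
    rw [Unitary.conjStarAlgAut_star_apply] at this
    simpa using this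

/-- A congruence by UD, with D the inverse square root of the eigenvalues, turns P into 1. An
orthogonal V then diagonalises the transformed Q without disturbing the 1. -/
theorem Matrix.PosDef.exists_simultaneous_diagonalization {d : ℕ}
    {P Q : Matrix (Fin d) (Fin d) ℝ} (hP : P.PosDef) (hQ : Q.transpose = Q) :
    ∃ (T : Matrix (Fin d) (Fin d) ℝ) (q : Fin d → ℝ), T.det ≠ 0 ∧
      T.transpose * P * T = 1 ∧ T.transpose * Q * T = Matrix.diagonal q := by
  obtain ⟨U, hU, hUP⟩ := hP.1.exists_transpose_mul_mul_eq_diagonal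
  set p := hP.1.eigenvalues with hp
  have hp0 : ∀ i, 0 < p i := hP.eigenvalues_pos
  set D : Matrix (Fin d) (Fin d) ℝ := Matrix.diagonal fun i => (Real.sqrt (p i))⁻¹ with hD
  have hDt : D.transpose = D := Matrix.diagonal_transpose _
  have hDD : D * Matrix.diagonal p * D = 1 := by
    rw [hD, Matrix.diagonal_mul_diagonal, Matrix.diagonal_mul_diagonal, ← Matrix.diagonal_one]
    congr 1
    ext i
    have h1 : Real.sqrt (p i) ≠ 0 := (Real.sqrt_pos.2 (hp0 i)).ne'
    have h2 : Real.sqrt (p i) * Real.sqrt (p i) = p i := Real.mul_self_sqrt (hp0 i).le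
    field_simp
    nlinarith
  have hT0 : (U * D).transpose * P * (U * D) = 1 := by
    rw [Matrix.transpose_mul, hDt, ← hDD, ← hUP]
    simp only [Matrix.mul_assoc]
  have hW : ((U * D).transpose * Q * (U * D)).IsHermitian := by
    rw [Matrix.IsHermitian, Matrix.conjTranspose_eq_transpose_of_trivial]
    simp only [Matrix.transpose_mul, Matrix.transpose_transpose, hQ, Matrix.mul_assoc]
  obtain ⟨V, hV, hVW⟩ := hW.exists_transpose_mul_mul_eq_diagonal
  have h1 : (U * D * V).transpose * P * (U * D * V) = 1 := by
    rw [Matrix.transpose_mul, ← hV]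
    calc _ = V.transpose * ((U * D).transpose * P * (U * D)) * V := by
          simp only [Matrix.mul_assoc]
      _ = _ := by rw [hT0, Matrix.mul_one]
  refine ⟨U * D * V, hW.eigenvalues, ?_, h1, ?_⟩
  · intro h0
    have := congrArg Matrix.det h1
    simp [-Matrix.det_mul, Matrix.det_mul _ (U * D * V), h0] at this
  · rw [← hVW, Matrix.transpose_mul]
    simp only [Matrix.mul_assoc]

/-- Real and imaginary parts are diagonalised simultaneously, which gives l = 1 + iq. That T is real
is essential: it will serve as a change of variables in ℝ^d. -/
theorem Matrix.IsSymm.exists_complex_diagonalization {d : ℕ} {S : Matrix (Fin d) (Fin d) ℂ}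
    (hS : S.IsSymm) (hP : (S.map Complex.re).PosDef) :
    ∃ (T : Matrix (Fin d) (Fin d) ℝ) (l : Fin d → ℂ), T.det ≠ 0 ∧ (∀ i, 0 < (l i).re) ∧
      (T.map Complex.ofReal).transpose * S * T.map Complex.ofReal = Matrix.diagonal l := by
  have hQ : (S.map Complex.im).transpose = S.map Complex.im := by
    ext i j
    simpa using congrArg Complex.im (hS.apply i j)
  obtain ⟨T, q, hT, h1, h2⟩ := hP.exists_simultaneous_diagonalization hQ
  refine ⟨T, fun i => 1 + q i * Complex.I, hT, fun i => by simp, ?_⟩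
  have hS' : S = (S.map Complex.re).map Complex.ofReal +
      Complex.I • (S.map Complex.im).map Complex.ofReal := by
    ext i j
    simp [mul_comm Complex.I, Complex.re_add_im]
  have e1 := congrArg (fun M => M.map Complex.ofRealHom) h1
  have e2 := congrArg (fun M => M.map Complex.ofRealHom) h2
  simp only [Matrix.map_mul] at e1 e2
  have e0 : ∀ M : Matrix (Fin d) (Fin d) ℝ, M.map Complex.ofRealHom = M.map Complex.ofReal :=
    fun M => rfl
  simp only [e0, Matrix.transpose_map] at e1 e2
  rw [hS', Matrix.mul_add, Matrix.add_mul, Matrix.mul_smul, Matrix.smul_mul]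
  rw [e1, e2]
  ext i j
  by_cases h : i = j
  · subst h; simp [mul_comm]
  · simp [h]

theorem integral_comp_mulVec {d : ℕ} {T : Matrix (Fin d) (Fin d) ℝ} (hT : T.det ≠ 0)
    {g : (Fin d → ℝ) → ℂ} (hg : Continuous g) :
    ∫ y, g y = ((|T.det| : ℝ) : ℂ) * ∫ y, g (T.mulVec y) := by
  have h := Real.map_matrix_volume_pi_eq_smul_volume_pi hT
  have h2 := integral_map (μ := volume) (φ := Matrix.toLin' T)
    (LinearMap.continuous_on_pi _).aemeasurable (f := g) hg.aestronglyMeasurable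
  rw [h, integral_smul_measure, ENNReal.toReal_ofReal (abs_nonneg _)] at h2
  simp only [Matrix.toLin'_apply] at h2
  rw [← h2, abs_inv, Complex.real_smul, ← mul_assoc]
  have : ((|T.det| : ℝ) : ℂ) ≠ 0 := by simpa using hT
  push_cast
  rw [mul_inv_cancel₀ this, one_mul]

/-- The substitution y = Ty' splits the integral into one-dimensional Gaussian integrals; the
exponent is ⟨S⁻¹c,c⟩/4 in diagonal coordinates. Only K ≠ 0 and its independence of c matter, so the
branch of the square root plays no role. -/
theorem integral_cexp_neg_matrix {d : ℕ} {S : Matrix (Fin d) (Fin d) ℂ}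
    {T : Matrix (Fin d) (Fin d) ℝ} {l : Fin d → ℂ} (hT : T.det ≠ 0) (hl : ∀ i, 0 < (l i).re)
    (hTS : (T.map Complex.ofReal).transpose * S * T.map Complex.ofReal = Matrix.diagonal l) :
    ∃ K : ℂ, K ≠ 0 ∧ ∀ c : Fin d → ℂ,
      ∫ y : Fin d → ℝ, Complex.exp (-(∑ i, ∑ j, S i j * (y j : ℂ) * (y i : ℂ)) +
        ∑ i, c i * y i) =
      K * Complex.exp (∑ k, ((T.map Complex.ofReal).transpose.mulVec c) k ^ 2 / (4 * l k)) := by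
  have hl0 : ∀ i, l i ≠ 0 := fun i h => by have := hl i; simp [h] at this
  refine ⟨((|T.det| : ℝ) : ℂ) * ∏ i, (Real.pi / l i) ^ (1 / 2 : ℂ), ?_, fun c => ?_⟩
  · refine mul_ne_zero (by simpa using hT) (Finset.prod_ne_zero_iff.2 fun i _ => ?_)
    rw [Complex.cpow_ne_zero_iff]
    left
    exact div_ne_zero (by exact_mod_cast Real.pi_ne_zero) (hl0 i)
  · rw [integral_comp_mulVec hT (by fun_prop), mul_assoc, Complex.exp_sum, ← Finset.prod_mul_distrib,
      ← GaussianFourier.integral_cexp_neg_sum_mul_add hl]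
    congr 1
    refine integral_congr_ae (.of_forall fun y => ?_)
    dsimp only
    set T' := T.map Complex.ofReal with hT'
    set y' : Fin d → ℂ := fun i => (y i : ℂ) with hy'
    have hTy : ∀ i, ((T.mulVec y i : ℝ) : ℂ) = T'.mulVec y' i := fun i => by
      simp [Matrix.mulVec, dotProduct, T', y']
    simp only [hTy]
    have h1 : ∑ i, ∑ j, S i j * T'.mulVec y' j * T'.mulVec y' i = ∑ i, l i * (y i : ℂ) ^ 2 := by
      have e : (T'.mulVec y') ⬝ᵥ (S.mulVec (T'.mulVec y')) =
          y' ⬝ᵥ ((Matrix.diagonal l).mulVec y') := by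
        rw [← hTS, ← Matrix.mulVec_mulVec, ← Matrix.mulVec_mulVec, Matrix.mulVec_transpose,
          dotProduct_comm y', ← Matrix.dotProduct_mulVec, dotProduct_comm]
      simp only [dotProduct, Matrix.mulVec_diagonal] at e
      have hS : ∀ u i, S.mulVec u i = ∑ j, S i j * u j := fun _ _ => rfl
      simp only [hS, Finset.mul_sum] at e
      calc _ = _ := Finset.sum_congr rfl fun i _ => Finset.sum_congr rfl fun j _ => by ring
        _ = _ := e
        _ = _ := Finset.sum_congr rfl fun i _ => by simp only [hy']; ring
    have h2 : ∑ i, c i * T'.mulVec y' i = ∑ i, T'.transpose.mulVec c i * (y i : ℂ) := by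
      have e : c ⬝ᵥ (T'.mulVec y') = (T'.transpose.mulVec c) ⬝ᵥ y' := by
        rw [Matrix.mulVec_transpose, Matrix.dotProduct_mulVec]
      exact e
    rw [h1, h2]

/-- Choose a direction w with w²Q = |Q| and multiply the values at tw and -tw, so that the linear
term cancels. With r = |Q|/2 this gives |K|² e^{t²|Q|} ≤ C² for all real t, impossible unless Q = 0.
-/
theorem eq_zero_of_exp_quadratic_growth {K Q l : ℂ} (hK : K ≠ 0)
    (h : ∀ r : ℝ, 0 < r → ∃ C : ℝ, ∀ z : ℂ,
      ‖K * Complex.exp (z ^ 2 * Q + z * l)‖ ≤ C * Real.exp (r * ‖z‖ ^ 2)) : Q = 0 := by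
  by_contra hQ
  have hQ' : 0 < ‖Q‖ := norm_pos_iff.2 hQ
  obtain ⟨w, hw⟩ := IsAlgClosed.exists_pow_nat_eq ((‖Q‖ : ℂ) / Q) (n := 2) two_pos
  have hw1 : ‖w‖ ^ 2 = 1 := by
    rw [← norm_pow, hw, norm_div, Complex.norm_real, norm_norm, div_self hQ'.ne']
  have hwQ : w ^ 2 * Q = ‖Q‖ := by rw [hw, div_mul_cancel₀ _ hQ]
  obtain ⟨C, hC⟩ := h (‖Q‖ / 2) (by positivity)
  have key : ∀ t : ℝ, ‖K‖ ^ 2 * (t ^ 2 * ‖Q‖) ≤ C ^ 2 := by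
    intro t
    have ht : ‖(t : ℂ) * w‖ ^ 2 = t ^ 2 := by
      rw [norm_mul, mul_pow, hw1, Complex.norm_real, mul_one, Real.norm_eq_abs, sq_abs]
    have hre : (2 * (t : ℂ) ^ 2 * (‖Q‖ : ℂ)).re = t ^ 2 * ‖Q‖ + t ^ 2 * ‖Q‖ := by
      rw [show (2 * (t : ℂ) ^ 2 * (‖Q‖ : ℂ)) = ((2 * t ^ 2 * ‖Q‖ : ℝ) : ℂ) by push_cast; ring,
        Complex.ofReal_re]
      ring
    have h1 := hC (t * w)
    have h2 := hC (-(t * w))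
    rw [norm_neg, ht] at h2
    rw [ht] at h1
    have h3 := mul_le_mul h1 h2 (norm_nonneg _) ((norm_nonneg _).trans h1)
    rw [← norm_mul, show K * Complex.exp ((t * w) ^ 2 * Q + t * w * l) *
      (K * Complex.exp ((-(t * w)) ^ 2 * Q + -(t * w) * l)) = K ^ 2 *
      (Complex.exp ((t * w) ^ 2 * Q + t * w * l) *
        Complex.exp ((-(t * w)) ^ 2 * Q + -(t * w) * l)) by ring, ← Complex.exp_add,
      show (t * w) ^ 2 * Q + t * w * l + ((-(t * w)) ^ 2 * Q + -(t * w) * l) =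
        2 * t ^ 2 * (w ^ 2 * Q) by ring, hwQ, norm_mul, norm_pow, Complex.norm_exp,
      hre, Real.exp_add (t ^ 2 * ‖Q‖),
      show C * Real.exp (‖Q‖ / 2 * t ^ 2) * (C * Real.exp (‖Q‖ / 2 * t ^ 2)) = C ^ 2 *
        (Real.exp (‖Q‖ / 2 * t ^ 2) * Real.exp (‖Q‖ / 2 * t ^ 2)) by ring,
      ← Real.exp_add (‖Q‖ / 2 * t ^ 2),
      show ‖Q‖ / 2 * t ^ 2 + ‖Q‖ / 2 * t ^ 2 = t ^ 2 * ‖Q‖ by ring, ← mul_assoc] at h3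
    have h4 := le_of_mul_le_mul_right h3 (Real.exp_pos _)
    refine le_trans ?_ h4
    gcongr
    linarith [Real.add_one_le_exp (t ^ 2 * ‖Q‖)]
  have hK' : 0 < ‖K‖ ^ 2 * ‖Q‖ := by have := norm_pos_iff.2 hK; positivity
  have := key (Real.sqrt ((C ^ 2 + 1) / (‖K‖ ^ 2 * ‖Q‖)))
  rw [Real.sq_sqrt (by positivity)] at this
  have e : ‖K‖ ^ 2 * ((C ^ 2 + 1) / (‖K‖ ^ 2 * ‖Q‖) * ‖Q‖) = C ^ 2 + 1 := by
    field_simp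
  linarith

/-! ### Growth of the Hermite generating function of a function with small Hermite coefficients -/

/-- The square root of (4s²)^n/n! ≤ e^{4s²}; the 4 is inserted to leave a summable factor 2^{-n}. -/
theorem pow_div_sqrt_factorial_le (s : ℝ) (n : ℕ) :
    |s| ^ n / Real.sqrt n.factorial ≤ (1 / 2) ^ n * Real.exp (2 * s ^ 2) := by
  have hf : (0 : ℝ) < n.factorial := by positivity
  have h1 := Real.pow_div_factorial_le_exp (4 * s ^ 2) (by positivity) n
  refine le_of_sq_le_sq ?_ (by positivity)
  have e1 : ((1 / 2 : ℝ) ^ n * Real.exp (2 * s ^ 2)) ^ 2 = (1 / 4) ^ n * Real.exp (4 * s ^ 2) := by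
    rw [mul_pow, ← pow_mul, mul_comm n 2, pow_mul, ← Real.exp_nat_mul]
    norm_num
    ring_nf
  have e2 : (|s| ^ n / Real.sqrt n.factorial) ^ 2 = (1 / 4) ^ n * ((4 * s ^ 2) ^ n / n.factorial) := by
    rw [div_pow, Real.sq_sqrt hf.le, ← pow_mul, mul_comm n 2, pow_mul, sq_abs, ← mul_div_assoc,
      ← mul_pow]
    ring_nf
  rw [e1, e2]
  gcongr

/-- The integral equals ∑ z^n a_n/n! with a_n = ∫ φ_n f. Inserting |a_n| ≤ C√(n!)/R^n bounds the sum
by 2C e^{2|z|²/R²}, and R is chosen so that 2/R² = r. -/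
theorem integral_generating_growth {d : ℕ} {v : EuclideanSpace ℝ (Fin d)} (hv : ‖v‖ = 1)
    {f : EuclideanSpace ℝ (Fin d) → ℂ} (hf : AEStronglyMeasurable f) {B : ℝ} (hB : ∀ x, ‖f x‖ ≤ B)
    (ha : ∀ R : ℝ, 0 < R → ∃ C : ℝ, ∀ n : ℕ,
      R ^ n * ‖∫ x, (hermiteGauss v n).1 x * f x‖ ≤ C * Real.sqrt n.factorial)
    {r : ℝ} (hr : 0 < r) : ∃ C : ℝ, ∀ z : ℂ,
      ‖∫ x, Complex.exp (2 * z * (inner ℝ v x : ℝ) - z ^ 2) * stdGauss x * f x‖ ≤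
        C * Real.exp (r * ‖z‖ ^ 2) := by
  have hB0 : 0 ≤ B := (norm_nonneg _).trans (hB 0)
  set R := Real.sqrt (2 / r) with hR
  have hR0 : 0 < R := Real.sqrt_pos.2 (by positivity)
  have hR2 : R ^ 2 = 2 / r := Real.sq_sqrt (by positivity)
  obtain ⟨C, hC⟩ := ha R hR0
  set I := ∫ x : EuclideanSpace ℝ (Fin d), Real.exp (-(1 / 4) * ‖x‖ ^ 2) with hI
  have hI0 : 0 ≤ I := integral_nonneg fun x => (Real.exp_pos _).le
  have hC0 : 0 ≤ C := by
    have := hC 0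
    simp at this
    exact (norm_nonneg _).trans this
  refine ⟨C * 2, fun z => ?_⟩
  set F : ℕ → EuclideanSpace ℝ (Fin d) → ℂ := fun n x =>
    z ^ n / n.factorial * ((hermiteGauss v n).1 x * f x) with hF
  have hFi : ∀ n, Integrable (F n) := fun n =>
    (integrable_hermiteGauss_mul hv n hf hB).const_mul _
  -- A crude bound that ignores the decay of the a_n; it only justifies exchanging sum and integral.
  have hFn : ∀ n, ∫ x, ‖F n x‖ ≤ (1 / 2) ^ n * (Real.exp (2 * (‖z‖ * Real.exp 5) ^ 2) * I * B) := by
    intro n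
    have hs : (0 : ℝ) < Real.sqrt n.factorial := by positivity
    have hss : Real.sqrt n.factorial * Real.sqrt n.factorial = (n.factorial : ℝ) :=
      Real.mul_self_sqrt (by positivity)
    calc ∫ x, ‖F n x‖ ≤ ∫ x, ‖z‖ ^ n / n.factorial * (‖(hermiteGauss v n).1 x‖ * B) := by
          refine integral_mono (hFi n).norm
            (((integrable_hermiteGauss hv n).norm.mul_const _).const_mul _) fun x => ?_
          simp only [hF, norm_mul, norm_div, norm_pow, Complex.norm_natCast]
          gcongr
          exact hB x
      _ = ‖z‖ ^ n / n.factorial * ((∫ x, ‖(hermiteGauss v n).1 x‖) * B) := by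
          rw [integral_const_mul, integral_mul_const]
      _ ≤ ‖z‖ ^ n / n.factorial * ((Real.sqrt n.factorial * Real.exp 5 ^ n * I) * B) := by
          gcongr
          exact integral_norm_hermiteGauss_le hv n
      _ = |‖z‖ * Real.exp 5| ^ n / Real.sqrt n.factorial * (I * B) := by
          rw [abs_of_nonneg (by positivity), mul_pow]
          generalize Real.sqrt n.factorial = s at hs hss ⊢
          rw [← hss]
          field_simp
      _ ≤ ((1 / 2) ^ n * Real.exp (2 * (‖z‖ * Real.exp 5) ^ 2)) * (I * B) := by
          gcongr
          exact pow_div_sqrt_factorial_le _ _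
      _ = _ := by ring
  have hFs : Summable fun n => ∫ x, ‖F n x‖ :=
    Summable.of_nonneg_of_le (fun n => integral_nonneg fun x => norm_nonneg _) hFn
      ((summable_geometric_of_lt_one (by norm_num) (by norm_num)).mul_right _)
  have hsum := hasSum_integral_of_summable_integral_norm hFi hFs
  have hpt : ∀ x, ∑' n, F n x =
      Complex.exp (2 * z * (inner ℝ v x : ℝ) - z ^ 2) * stdGauss x * f x := by
    intro x
    have := ((hasSum_hermite_generating ((inner ℝ v x : ℝ) : ℂ) z).mul_right
      (stdGauss x * f x)).tsum_eq
    rw [mul_assoc, ← this]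
    refine tsum_congr fun n => ?_
    simp only [hF]
    rw [hermiteGauss_apply']
    simp
    ring
  simp only [hpt] at hsum
  rw [← hsum.tsum_eq]
  have hterm : ∀ n, ‖∫ x, F n x‖ ≤ (1 / 2) ^ n * (C * Real.exp (r * ‖z‖ ^ 2)) := by
    intro n
    have hs : (0 : ℝ) < Real.sqrt n.factorial := by positivity
    have hss : Real.sqrt n.factorial * Real.sqrt n.factorial = (n.factorial : ℝ) :=
      Real.mul_self_sqrt (by positivity)
    simp only [hF]
    rw [integral_const_mul, norm_mul, norm_div, norm_pow, Complex.norm_natCast]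
    have h1 : ‖∫ x, (hermiteGauss v n).1 x * f x‖ ≤ C * Real.sqrt n.factorial / R ^ n := by
      rw [le_div_iff₀ (by positivity), mul_comm]
      exact hC n
    calc _ ≤ ‖z‖ ^ n / n.factorial * (C * Real.sqrt n.factorial / R ^ n) := by gcongr
      _ = |‖z‖ / R| ^ n / Real.sqrt n.factorial * C := by
          rw [abs_of_nonneg (by positivity), div_pow]
          generalize Real.sqrt n.factorial = s at hs hss ⊢
          rw [← hss]
          field_simp
      _ ≤ ((1 / 2) ^ n * Real.exp (2 * (‖z‖ / R) ^ 2)) * C := by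
          gcongr
          exact pow_div_sqrt_factorial_le _ _
      _ = _ := by
          rw [div_pow ‖z‖, hR2, show 2 * (‖z‖ ^ 2 / (2 / r)) = r * ‖z‖ ^ 2 by field_simp]
          ring
  have hg := (hasSum_geometric_two).mul_right (C * Real.exp (r * ‖z‖ ^ 2))
  refine (tsum_of_norm_bounded hg hterm).trans (le_of_eq (by ring))

/-! ### Gauss functions with small Hermite coefficients -/

/-- The weight e^{-|x|²/2} changes A/2 into S = (A+1)/2, and the linear term is c = 2zv + L. The sum
is ⟨S⁻¹v,v⟩ in diagonal coordinates, so the coefficient of z² in the exponent is this sum minus 1,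
and it must vanish by the growth bound. -/
theorem sum_sq_div_eq_one_of_hermite_coefficients {d : ℕ} {v : EuclideanSpace ℝ (Fin d)}
    (hv : ‖v‖ = 1) {A : Matrix (Fin d) (Fin d) ℂ} {T : Matrix (Fin d) (Fin d) ℝ} {l : Fin d → ℂ}
    (hT : T.det ≠ 0) (hl : ∀ i, 0 < (l i).re)
    (hTS : (T.map Complex.ofReal).transpose * ((1 / 2 : ℂ) • (A + 1)) * T.map Complex.ofReal =
      Matrix.diagonal l)
    {C : ℂ} (hC : C ≠ 0) {L : EuclideanSpace ℝ (Fin d) →ₗ[ℝ] ℂ}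
    {f : EuclideanSpace ℝ (Fin d) → ℂ}
    (hf : ∀ x, f x = C * Complex.exp (-(∑ i, ∑ j, A i j * (x j : ℂ) * (x i : ℂ)) / 2 + L x))
    {B : ℝ} (hB : ∀ x, ‖f x‖ ≤ B)
    (ha : ∀ R : ℝ, 0 < R → ∃ C : ℝ, ∀ n : ℕ,
      R ^ n * ‖∫ x, (hermiteGauss v n).1 x * f x‖ ≤ C * Real.sqrt n.factorial) :
    ∑ k, ((T.map Complex.ofReal).transpose.mulVec (fun i => (v i : ℂ))) k ^ 2 / l k = 1 := by
  have hl0 : ∀ i, l i ≠ 0 := fun i h => by have := hl i; simp [h] at this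
  have hLs : ∀ x, L x = ∑ i, L (EuclideanSpace.single i 1) * (x i : ℂ) := fun x => by
    conv_lhs => rw [← (EuclideanSpace.basisFun (Fin d) ℝ).sum_repr x]
    simp [mul_comm]
  have hfc : Continuous f := by
    rw [funext hf]
    have : Continuous L := L.continuous_of_finiteDimensional
    fun_prop
  obtain ⟨K, hK, hKc⟩ := integral_cexp_neg_matrix hT hl hTS
  set T' := T.map Complex.ofReal
  set v' : Fin d → ℂ := fun i => (v i : ℂ) with hv'
  set L' : Fin d → ℂ := fun i => L (EuclideanSpace.single i 1) with hL'
  set a := T'.transpose.mulVec v' with ha'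
  set b := T'.transpose.mulVec L' with hb'
  have key : ∀ z : ℂ, ∫ x, Complex.exp (2 * z * (inner ℝ v x : ℝ) - z ^ 2) * stdGauss x * f x =
      (C * K * Complex.exp (∑ k, b k ^ 2 / (4 * l k))) *
        Complex.exp (z ^ 2 * (∑ k, a k ^ 2 / l k - 1) + z * ∑ k, a k * b k / l k) := by
    intro z
    rw [← (PiLp.volume_preserving_toLp (Fin d)).integral_comp'
      (f := MeasurableEquiv.toLp 2 (Fin d → ℝ))]
    have h1 : ∀ y : Fin d → ℝ, Complex.exp (2 * z * (inner ℝ v (MeasurableEquiv.toLp 2 _ y) : ℝ) -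
        z ^ 2) * stdGauss (MeasurableEquiv.toLp 2 _ y) * f (MeasurableEquiv.toLp 2 _ y) =
        (C * Complex.exp (-z ^ 2)) * Complex.exp (-(∑ i, ∑ j, ((1 / 2 : ℂ) • (A + 1)) i j * (y j : ℂ) *
        (y i : ℂ)) + ∑ i, ((2 * z) • v' + L') i * y i) := by
      intro y
      have e1 : (inner ℝ v (MeasurableEquiv.toLp 2 _ y) : ℝ) = ∑ i, v i * y i := by
        simp [PiLp.inner_apply, mul_comm]
      have e2 : ‖(MeasurableEquiv.toLp 2 _ y : EuclideanSpace ℝ (Fin d))‖ ^ 2 = ∑ i, y i ^ 2 := by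
        rw [EuclideanSpace.real_norm_sq_eq]
        simp
      have e3 : ∑ i, ∑ j, ((1 / 2 : ℂ) • (A + 1)) i j * (y j : ℂ) * (y i : ℂ) =
          (∑ i, ∑ j, A i j * (y j : ℂ) * (y i : ℂ)) / 2 + (∑ i, (y i : ℂ) ^ 2) / 2 := by
        rw [Finset.sum_div, Finset.sum_div, ← Finset.sum_add_distrib]
        refine Finset.sum_congr rfl fun i _ => ?_
        have : (y i : ℂ) ^ 2 = ∑ j, (1 : Matrix (Fin d) (Fin d) ℂ) i j * y j * y i := by
          simp [Matrix.one_apply, sq]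
        rw [this, Finset.sum_div, Finset.sum_div, ← Finset.sum_add_distrib]
        refine Finset.sum_congr rfl fun j _ => ?_
        simp only [Matrix.smul_apply, Matrix.add_apply, smul_eq_mul]
        ring
      have e4 : ∑ i, ((2 * z) • v' + L') i * (y i : ℂ) =
          2 * z * ∑ i, (v i : ℂ) * y i + L (MeasurableEquiv.toLp 2 _ y) := by
        rw [hLs, Finset.mul_sum, ← Finset.sum_add_distrib]
        refine Finset.sum_congr rfl fun i _ => ?_
        simp [hv', hL']
        ring
      have hr : ∀ a b c e : ℂ, a * b * (c * e) = c * (a * b * e) := fun a b c e => by ring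
      rw [stdGauss, hf, e1, e2, e3, e4, hr, mul_assoc C]
      simp only [← Complex.exp_add]
      congr 2
      push_cast
      simp only [MeasurableEquiv.toLp_apply]
      ring
    simp only [h1]
    rw [integral_const_mul, hKc, Matrix.mulVec_add, Matrix.mulVec_smul, ← ha', ← hb']
    have h2 : ∑ k, ((2 * z) • a + b) k ^ 2 / (4 * l k) = ∑ k, b k ^ 2 / (4 * l k) +
        (z ^ 2 * ∑ k, a k ^ 2 / l k + z * ∑ k, a k * b k / l k) := by
      rw [Finset.mul_sum, Finset.mul_sum, ← Finset.sum_add_distrib, ← Finset.sum_add_distrib]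
      refine Finset.sum_congr rfl fun k _ => ?_
      have := hl0 k
      simp only [Pi.add_apply, Pi.smul_apply, smul_eq_mul]
      field_simp
      ring
    rw [h2, mul_sub, mul_one, Complex.exp_add, sub_add_eq_add_sub, sub_eq_add_neg _ (z ^ 2),
      Complex.exp_add _ (-z ^ 2)]
    ring
  have hq := eq_zero_of_exp_quadratic_growth (K := C * K * Complex.exp (∑ k, b k ^ 2 / (4 * l k)))
    (Q := ∑ k, a k ^ 2 / l k - 1) (l := ∑ k, a k * b k / l k)
    (mul_ne_zero (mul_ne_zero hC hK) (Complex.exp_ne_zero _)) fun r hr => by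
      obtain ⟨C', hC'⟩ := integral_generating_growth hv hfc.aestronglyMeasurable hB ha hr
      exact ⟨C', fun z => by rw [← key]; exact hC' z⟩
  exact sub_eq_zero.1 hq

theorem Matrix.IsSymm.posDef_half_add_one {d : ℕ} {A : Matrix (Fin d) (Fin d) ℂ}
    (hA : A.IsSymm) (hP : (A.map Complex.re).PosDef) :
    ((1 / 2 : ℂ) • (A + 1)).IsSymm ∧ (((1 / 2 : ℂ) • (A + 1)).map Complex.re).PosDef := by
  constructor
  · exact (hA.add Matrix.isSymm_one).smul _
  · have : ((1 / 2 : ℂ) • (A + 1)).map Complex.re = (1 / 2 : ℝ) • (A.map Complex.re + 1) := by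
      ext i j
      by_cases h : i = j
      · subst h; simp; ring
      · simp [h]
    rw [this]
    exact (hP.add Matrix.PosDef.one).smul (by norm_num)

/-- If the Hermite coefficients of a Gauss function in all directions decay faster than
exponentially, the Gauss function is `C e^{-|x|²/2 + L(x)}`. -/
theorem matrix_eq_one_of_hermite_coefficients {d : ℕ}
    {A : Matrix (Fin d) (Fin d) ℂ} (hA : A.IsSymm) (hP : (A.map Complex.re).PosDef)
    {C : ℂ} (hC : C ≠ 0) {L : EuclideanSpace ℝ (Fin d) →ₗ[ℝ] ℂ}
    {f : EuclideanSpace ℝ (Fin d) → ℂ}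
    (hf : ∀ x, f x = C * Complex.exp (-(∑ i, ∑ j, A i j * (x j : ℂ) * (x i : ℂ)) / 2 + L x))
    {B : ℝ} (hB : ∀ x, ‖f x‖ ≤ B)
    (ha : ∀ v : EuclideanSpace ℝ (Fin d), ‖v‖ = 1 → ∀ R : ℝ, 0 < R → ∃ C : ℝ, ∀ n : ℕ,
      R ^ n * ‖∫ x, (hermiteGauss v n).1 x * f x‖ ≤ C * Real.sqrt n.factorial) :
    A = 1 := by
  obtain ⟨hS, hSP⟩ := hA.posDef_half_add_one hP
  obtain ⟨T, l, hT, hl, hTS⟩ := hS.exists_complex_diagonalization hSP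
  have hl0 : ∀ i, l i ≠ 0 := fun i h => by have := hl i; simp [h] at this
  have h1 := fun v hv => sum_sq_div_eq_one_of_hermite_coefficients hv hT hl hTS hC hf hB (ha v hv)
  set T' := T.map Complex.ofReal with hT'
  -- M is S⁻¹ for S = (A+1)/2. The hypothesis says that its quadratic form is 1 on real unit
  -- vectors, hence by homogeneity |w|² on all real w.
  set M := T' * Matrix.diagonal (fun i => (l i)⁻¹) * T'.transpose with hM
  have hMt : M.transpose = M := by
    simp only [hM, Matrix.transpose_mul, Matrix.transpose_transpose, Matrix.diagonal_transpose,
      Matrix.mul_assoc]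
  have hMv : ∀ w : Fin d → ℂ, ∑ k, (T'.transpose.mulVec w) k ^ 2 / l k = w ⬝ᵥ M.mulVec w := by
    intro w
    rw [hM, ← Matrix.mulVec_mulVec, ← Matrix.mulVec_mulVec, Matrix.dotProduct_mulVec,
      ← Matrix.mulVec_transpose, dotProduct]
    refine Finset.sum_congr rfl fun k _ => ?_
    rw [Matrix.mulVec_diagonal]
    ring
  have h2 : ∀ w : Fin d → ℝ, (fun i => (w i : ℂ)) ⬝ᵥ M.mulVec (fun i => (w i : ℂ)) =
      ((∑ i, w i ^ 2 : ℝ) : ℂ) := by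
    intro w
    by_cases hw : w = 0
    · subst hw; simp
    set x : EuclideanSpace ℝ (Fin d) := WithLp.toLp 2 w with hx
    have hx0 : x ≠ 0 := fun h => hw (by simpa [hx] using h)
    have hxn : ‖x‖ ≠ 0 := norm_ne_zero_iff.2 hx0
    have h3 := h1 (‖x‖⁻¹ • x) (by rw [norm_smul, norm_inv, norm_norm, inv_mul_cancel₀ hxn])
    have h4 : (fun i => (((‖x‖⁻¹ • x) i : ℝ) : ℂ)) = ((‖x‖⁻¹ : ℝ) : ℂ) • fun i => (w i : ℂ) := by
      ext i; simp [hx]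
    rw [h4, hMv, Matrix.mulVec_smul, smul_dotProduct, dotProduct_smul, smul_eq_mul,
      smul_eq_mul] at h3
    have h5 : ∑ i, w i ^ 2 = ‖x‖ ^ 2 := by rw [EuclideanSpace.real_norm_sq_eq]
    have hxn' : (‖x‖ : ℂ) ≠ 0 := by exact_mod_cast hxn
    rw [h5]
    push_cast at h3 ⊢
    field_simp at h3
    exact h3
  -- Polarisation: e_i gives the diagonal entries, and e_i + e_j together with the symmetry of M
  -- gives the others.
  have hM1 : M = 1 := by
    have hd : ∀ i, M i i = 1 := fun i => by
      have := h2 (Pi.single i 1)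
      have e : (fun j => (((Pi.single i 1 : Fin d → ℝ) j : ℝ) : ℂ)) = Pi.single i 1 := by
        ext j; by_cases h : j = i
        · subst h; simp
        · simp [h]
      rw [e] at this
      simpa [Pi.single_apply] using this
    ext i j
    by_cases hij : i = j
    · subst hij; simp [hd]
    · have := h2 (Pi.single i 1 + Pi.single j 1)
      have e : (fun k => (((Pi.single i 1 + Pi.single j 1 : Fin d → ℝ) k : ℝ) : ℂ)) =
          Pi.single i 1 + Pi.single j 1 := by
        ext k
        simp only [Pi.add_apply, Pi.single_apply]
        split_ifs <;> simp
      have e2 : ∑ k, ((Pi.single i 1 + Pi.single j 1 : Fin d → ℝ) k) ^ 2 = 2 := by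
        have : ∀ k, ((Pi.single i 1 + Pi.single j 1 : Fin d → ℝ) k) ^ 2 =
            (Pi.single i 1 : Fin d → ℝ) k + (Pi.single j 1 : Fin d → ℝ) k := by
          intro k
          by_cases h : k = i <;> by_cases h' : k = j
          · exact absurd (h.symm.trans h') hij
          all_goals simp [h, h', Pi.single_apply]
          all_goals simp [hij, Ne.symm hij]
        simp only [this, Finset.sum_add_distrib]
        simp
        norm_num
      rw [e, e2, Matrix.mulVec_add] at this
      simp only [dotProduct_add, add_dotProduct, single_one_dotProduct, Matrix.mulVec_single_one,
        Matrix.col_apply] at this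
      have hs : M j i = M i j := congrFun (congrFun hMt i) j
      rw [hd, hd, hs] at this
      push_cast at this
      rw [Matrix.one_apply_ne hij]
      linear_combination this / 2
  have hdet : T'.det ≠ 0 := by
    have : T'.det = ((T.det : ℝ) : ℂ) := (RingHom.map_det Complex.ofRealHom T).symm
    rw [this]
    exact_mod_cast hT
  have hu : IsUnit T'.det := hdet.isUnit
  have hDD : Matrix.diagonal l * Matrix.diagonal (fun i => (l i)⁻¹) = 1 := by
    rw [Matrix.diagonal_mul_diagonal, ← Matrix.diagonal_one]
    congr 1
    ext i
    exact mul_inv_cancel₀ (hl0 i)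
  -- Inserting M = 1 on the right makes the diagonalised product appear, and it cancels against the
  -- inverse diagonal inside M.
  have h6 : T'.transpose * ((1 / 2 : ℂ) • (A + 1)) = T'.transpose := by
    calc _ = T'.transpose * ((1 / 2 : ℂ) • (A + 1)) * M := by rw [hM1, Matrix.mul_one]
      _ = (T'.transpose * ((1 / 2 : ℂ) • (A + 1)) * T') * Matrix.diagonal (fun i => (l i)⁻¹) *
          T'.transpose := by rw [hM]; simp only [Matrix.mul_assoc]
      _ = _ := by rw [hTS, hDD, Matrix.one_mul]
  have h7 : (1 / 2 : ℂ) • (A + 1) = 1 := by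
    have hu' : IsUnit T'.transpose.det := by rwa [Matrix.det_transpose]
    have := congrArg (fun X => T'.transpose⁻¹ * X) h6
    simpa only [← Matrix.mul_assoc, Matrix.nonsing_inv_mul _ hu', Matrix.one_mul] using this
  have h8 : A + 1 = (2 : ℂ) • (1 : Matrix (Fin d) (Fin d) ℂ) := by
    have := congrArg (fun X => (2 : ℂ) • X) h7
    simp only [smul_smul] at this
    rw [← this]
    norm_num
  rw [eq_sub_of_add_eq h8, two_smul, add_sub_cancel_right]

/-- The Hermite coefficients of `e^{-b|x|²/2}`, `b ≠ 1`, in a given direction do not decay faster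
than exponentially. -/
theorem not_hermite_coefficients_gaussian {d : ℕ} {v : EuclideanSpace ℝ (Fin d)} (hv : ‖v‖ = 1)
    {b : ℝ} (hb : 0 < b) (hb1 : b ≠ 1) :
    ¬ ∀ R : ℝ, 0 < R → ∃ C : ℝ, ∀ n : ℕ, R ^ n *
      ‖∫ x, (hermiteGauss v n).1 x * ((Real.exp (-b * ‖x‖ ^ 2 / 2) : ℝ) : ℂ)‖ ≤
        C * Real.sqrt n.factorial := by
  intro ha
  -- Here S = (b+1)/2 times the identity is already diagonal, so the conclusion reads 2/(b+1) = 1.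
  have h := sum_sq_div_eq_one_of_hermite_coefficients hv (A := (b : ℂ) • 1) (T := 1)
    (l := fun _ => ((b : ℂ) + 1) / 2) (C := 1) (L := 0) (B := 1)
    (f := fun x => ((Real.exp (-b * ‖x‖ ^ 2 / 2) : ℝ) : ℂ)) (by simp)
    (fun i => by simp; positivity) ?_ one_ne_zero ?_ (fun x => ?_) ha
  · have h2 : ∑ k, (v k : ℂ) ^ 2 = 1 := by
      have := EuclideanSpace.real_norm_sq_eq v
      rw [hv] at this
      norm_num at this
      exact_mod_cast this.symm
    have e : (Matrix.map 1 Complex.ofReal : Matrix (Fin d) (Fin d) ℂ) = 1 := by simp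
    rw [e, Matrix.transpose_one, Matrix.one_mulVec, ← Finset.sum_div, h2] at h
    have hb' : (b : ℂ) + 1 ≠ 0 := by
      have : (b : ℝ) + 1 ≠ 0 := by positivity
      exact_mod_cast this
    field_simp at h
    apply hb1
    have : (b : ℂ) = 1 := by linear_combination -h
    exact_mod_cast this
  · have e : (Matrix.map 1 Complex.ofReal : Matrix (Fin d) (Fin d) ℂ) = 1 := by simp
    rw [e, Matrix.transpose_one, Matrix.one_mul, Matrix.mul_one]
    ext i j
    by_cases h : i = j
    · subst h; simp; ring
    · simp [h]
  · intro x
    have : ∑ i, ∑ j, ((b : ℂ) • (1 : Matrix (Fin d) (Fin d) ℂ)) i j * (x j : ℂ) * (x i : ℂ) =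
        ((b * ‖x‖ ^ 2 : ℝ) : ℂ) := by
      rw [EuclideanSpace.real_norm_sq_eq]
      push_cast
      rw [Finset.mul_sum]
      refine Finset.sum_congr rfl fun i _ => ?_
      simp [Matrix.one_apply]
      ring
    rw [this]
    push_cast
    simp
  · rw [Complex.norm_real, Real.norm_eq_abs, Real.abs_exp, Real.exp_le_one_iff]
    have : 0 ≤ b * ‖x‖ ^ 2 := by positivity
    linarith

/-! ### Continuous functionals and bounded sets in projective and inductive limits -/

section LimitLemmas

variable {X ι : Type} [AddCommGroup X] [Module ℂ X] {Λ : ℝ → ι → X →ₗ[ℂ] ℂ}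

theorem ProjLimit.withSeminorms :
    haveI : Nonempty {h : ℝ // 0 < h} := ⟨⟨1, one_pos⟩⟩
    WithSeminorms (ProjLimit.seminorms Λ) :=
  ⟨rfl⟩

theorem IndLimit.withSeminorms :
    haveI : Nonempty {q : Seminorm ℂ (IndLimit Λ) // IndLimit.IsAdmissible Λ q} :=
      ⟨⟨0, fun _ _ => ⟨0, fun _ _ => by simp⟩⟩⟩
    WithSeminorms (IndLimit.seminorms Λ) :=
  ⟨rfl⟩

theorem stepNorm_nonneg (ℓ : ι → X →ₗ[ℂ] ℂ) (f : X) : 0 ≤ stepNorm ℓ f :=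
  Real.iSup_nonneg fun _ => norm_nonneg _

theorem norm_le_stepNorm {ℓ : ι → X →ₗ[ℂ] ℂ} {f : X} (hf : f ∈ stepSpace ℓ) (i : ι) :
    ‖ℓ i f‖ ≤ stepNorm ℓ f :=
  le_ciSup (f := fun i => ‖ℓ i f‖) hf i

theorem ProjLimit.mem_stepSpace (f : ProjLimit Λ) {h : ℝ} (hh : 0 < h) :
    f.val ∈ stepSpace (Λ h) :=
  f.bddAbove hh

theorem ProjLimit.continuous_of_bound (φ : ProjLimit Λ →ₗ[ℂ] ℂ) {h C : ℝ} (hh : 0 < h)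
    (hφ : ∀ f, ‖φ f‖ ≤ C * stepNorm (Λ h) f.val) : Continuous φ := by
  refine WithSeminorms.continuous_normedSpace_rng ℂ ProjLimit.withSeminorms φ
    ⟨{⟨h, hh⟩}, Real.toNNReal C, fun f => ?_⟩
  rw [Finset.sup_singleton]
  refine (hφ f).trans ?_
  change _ ≤ (Real.toNNReal C : ℝ) * stepNorm (Λ h) f.val
  exact mul_le_mul_of_nonneg_right (Real.le_coe_toNNReal C) (stepNorm_nonneg _ _)

/-- The bounds on the steps say that |φ| is itself an admissible seminorm, hence one of those
defining the topology. -/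
theorem IndLimit.continuous_of_bound (φ : IndLimit Λ →ₗ[ℂ] ℂ)
    (hφ : ∀ h : ℝ, 0 < h → ∃ C : ℝ, ∀ f : IndLimit Λ, f.val ∈ stepSpace (Λ h) →
      ‖φ f‖ ≤ C * stepNorm (Λ h) f.val) : Continuous φ := by
  refine WithSeminorms.continuous_normedSpace_rng ℂ IndLimit.withSeminorms φ
    ⟨{⟨(normSeminorm ℂ ℂ).comp φ, hφ⟩}, 1, ?_⟩
  rw [Finset.sup_singleton, one_smul]
  exact le_rfl

theorem ProjLimit.exists_bound_of_isVonNBounded {h : ℝ} (hh : 0 < h) {B : Set (ProjLimit Λ)}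
    (hB : Bornology.IsVonNBounded ℂ B) : ∃ C, ∀ f ∈ B, stepNorm (Λ h) f.val ≤ C := by
  obtain ⟨r, -, hr⟩ := (WithSeminorms.isVonNBounded_iff_seminorm_bounded
    (ProjLimit.withSeminorms (Λ := Λ))).1 hB ⟨h, hh⟩
  exact ⟨r, fun f hf => (hr f hf).le⟩

/-- Weighted suprema of functionals on an inductive limit are bounded on bounded sets. -/
theorem IndLimit.exists_bound_of_isVonNBounded
    (hΛ : ∀ f : IndLimit Λ, ∃ h : ℝ, 0 < h ∧ f.val ∈ stepSpace (Λ h))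
    (u : ℕ → IndLimit Λ →ₗ[ℂ] ℂ)
    (hu : ∀ h : ℝ, 0 < h → ∃ C : ℝ, ∀ n (f : IndLimit Λ), f.val ∈ stepSpace (Λ h) →
      ‖u n f‖ ≤ C * stepNorm (Λ h) f.val) :
    ∃ q : IndLimit Λ → ℝ, (∀ B, Bornology.IsVonNBounded ℂ B → ∃ C, ∀ f ∈ B, q f ≤ C) ∧
      ∀ n f, ‖u n f‖ ≤ q f := by
  have hb : ∀ f, BddAbove (Set.range fun n => ‖u n f‖) := by
    intro f
    obtain ⟨h, hh, hf⟩ := hΛ f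
    obtain ⟨C, hC⟩ := hu h hh
    refine ⟨C * stepNorm (Λ h) f.val, ?_⟩
    rintro _ ⟨n, rfl⟩
    exact hC n f hf
  -- The supremum is finite because every element lies in some step, and it is again admissible. It
  -- is therefore bounded on bounded sets, with no need to know that a bounded set lies in a single
  -- step.
  let q : Seminorm ℂ (IndLimit Λ) := Seminorm.of (fun f => ⨆ n, ‖u n f‖)
    (fun f g => ciSup_le fun n => by
      rw [map_add]
      exact (norm_add_le _ _).trans (add_le_add (le_ciSup (hb f) n) (le_ciSup (hb g) n)))
    (fun c f => by
      simp only [map_smul, norm_smul]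
      exact (Real.mul_iSup_of_nonneg (norm_nonneg c) _).symm)
  have hq : IndLimit.IsAdmissible Λ q := by
    intro h hh
    obtain ⟨C, hC⟩ := hu h hh
    exact ⟨C, fun f hf => ciSup_le fun n => hC n f hf⟩
  refine ⟨q, fun B hB => ?_, fun n f => le_ciSup (hb f) n⟩
  obtain ⟨r, -, hr⟩ := (WithSeminorms.isVonNBounded_iff_seminorm_bounded
    (IndLimit.withSeminorms (Λ := Λ))).1 hB ⟨q, hq⟩
  exact ⟨r, fun f hf => (hr f hf).le⟩

end LimitLemmas

/-! ### Obstructions to invariance under dilations and multiplication -/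

section Obstructions

variable {d : ℕ} {V : Type} [AddCommGroup V] [Module ℂ V] [TopologicalSpace V]

/-- The hypothesis at 2R gives a spare factor 2^{-n} uniformly on bounded sets, so R^n u_n/√(n!) → 0
in the strong topology. A continuous φ maps this to a convergent, hence bounded, sequence. -/
theorem exists_bound_of_continuous_on_dual {u : ℕ → V →L[ℂ] ℂ}
    (hq : ∀ R : ℝ, 0 < R → ∃ q : V → ℝ,
      (∀ B, Bornology.IsVonNBounded ℂ B → ∃ C, ∀ ψ ∈ B, q ψ ≤ C) ∧
      ∀ n ψ, R ^ n * ‖u n ψ‖ ≤ q ψ * Real.sqrt n.factorial)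
    (φ : (V →L[ℂ] ℂ) →ₗ[ℂ] ℂ) (hφ : Continuous φ) {R : ℝ} (hR : 0 < R) :
    ∃ C : ℝ, ∀ n, R ^ n * ‖φ (u n)‖ ≤ C * Real.sqrt n.factorial := by
  obtain ⟨q, hqB, hqu⟩ := hq (2 * R) (by positivity)
  have hT : Filter.Tendsto (fun n => ((R ^ n / Real.sqrt n.factorial : ℝ) : ℂ) • u n)
      Filter.atTop (𝓝 0) := by
    refine (UniformConvergenceCLM.tendsto_iff_tendstoUniformlyOn (RingHom.id ℂ) ℂ
      {S | Bornology.IsVonNBounded ℂ S}).2 fun B hB => ?_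
    obtain ⟨C, hC⟩ := hqB B hB
    rw [Metric.tendstoUniformlyOn_iff]
    intro ε hε
    have ht : Filter.Tendsto (fun n : ℕ => (1 / 2 : ℝ) ^ n * C) Filter.atTop (𝓝 0) := by
      simpa using (tendsto_pow_atTop_nhds_zero_of_lt_one (r := (1 / 2 : ℝ)) (by norm_num)
        (by norm_num)).mul_const C
    filter_upwards [ht.eventually_lt_const hε] with n hn ψ hψ
    refine lt_of_le_of_lt ?_ hn
    change dist (0 : ℂ) (((R ^ n / Real.sqrt n.factorial : ℝ) : ℂ) • u n ψ) ≤ _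
    have hs : 0 < Real.sqrt n.factorial := by positivity
    have h1 := hqu n ψ
    rw [dist_zero_left, norm_smul, Complex.norm_real, Real.norm_eq_abs,
      abs_of_pos (by positivity), div_mul_eq_mul_div, div_le_iff₀ hs]
    calc R ^ n * ‖u n ψ‖ = (1 / 2) ^ n * ((2 * R) ^ n * ‖u n ψ‖) := by
          rw [mul_pow, ← mul_assoc, ← mul_assoc, ← mul_pow]; norm_num
      _ ≤ (1 / 2) ^ n * (q ψ * Real.sqrt n.factorial) := by gcongr
      _ ≤ (1 / 2) ^ n * (C * Real.sqrt n.factorial) := by gcongr; exact hC ψ hψ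
      _ = _ := by ring
  have hT2 := ((hφ.tendsto 0).comp hT).norm.bddAbove_range
  obtain ⟨C, hC⟩ := hT2
  refine ⟨C, fun n => ?_⟩
  have h1 := hC ⟨n, rfl⟩
  have hs : 0 < Real.sqrt n.factorial := by positivity
  simp only [Function.comp_apply, map_smul, norm_smul, Complex.norm_real, Real.norm_eq_abs] at h1
  rw [abs_of_pos (by positivity), div_mul_eq_mul_div, div_le_iff₀ hs] at h1
  exact h1

/-- If `V` contains the functions `H_n(⟨v, x⟩) e^{-|x|²/2}`, and these define functionals on `V`
which decay faster than exponentially on bounded sets, then neither `V` nor `V'` is invariant under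
dilations or a test-function module. -/
theorem not_invariant_of_hermite_decay {ev : V → EuclideanSpace ℝ (Fin d) → ℂ}
    {v : EuclideanSpace ℝ (Fin d)} (hv : ‖v‖ = 1) {f : ℕ → V} {u : ℕ → V →L[ℂ] ℂ}
    (hf : ∀ n x, ev (f n) x = (hermiteGauss v n).1 x)
    (hu : ∀ n, IsGivenBy ev (u n) (ev (f n)))
    (hq : ∀ R : ℝ, 0 < R → ∃ q : V → ℝ,
      (∀ B, Bornology.IsVonNBounded ℂ B → ∃ C, ∀ ψ ∈ B, q ψ ≤ C) ∧
      ∀ n ψ, R ^ n * ‖u n ψ‖ ≤ q ψ * Real.sqrt n.factorial) :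
    (∀ c : ℝ, c ≠ 0 → |c| ≠ 1 → ¬ DilationInvariant ev c ∧ ¬ DualDilationInvariant ev c) ∧
      ¬ IsTestFunctionModule ev ∧ ¬ IsDualTestFunctionModule ev := by
  have hf0 : ∀ x, ev (f 0) x = ((Real.exp (-‖x‖ ^ 2 / 2) : ℝ) : ℂ) := fun x => by
    rw [hf, hermiteGauss_apply]; simp [hermitePoly]
  -- The obstruction in V: no Gaussian with b ≠ 1 belongs to it.
  have hV : ∀ (b : ℝ) (ψ : V), 0 < b → b ≠ 1 →
      ¬ ∀ x, ev ψ x = ((Real.exp (-b * ‖x‖ ^ 2 / 2) : ℝ) : ℂ) := by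
    intro b ψ hb hb1 hψ
    refine not_hermite_coefficients_gaussian hv hb hb1 fun R hR => ?_
    obtain ⟨q, -, h2⟩ := hq R hR
    refine ⟨q ψ, fun n => ?_⟩
    have h3 := (hu n ψ).2
    simp only [hf, hψ] at h3
    rw [← h3]
    exact h2 n ψ
  -- The obstruction in V': no continuous functional on V' acts on the u_n as such a Gaussian would.
  have hV' : ∀ (b : ℝ) (φ : (V →L[ℂ] ℂ) →ₗ[ℂ] ℂ) (K : ℂ), 0 < b → b ≠ 1 → K ≠ 0 →
      Continuous φ → ¬ ∀ n, φ (u n) = K * ∫ x, (hermiteGauss v n).1 x *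
        ((Real.exp (-b * ‖x‖ ^ 2 / 2) : ℝ) : ℂ) := by
    intro b φ K hb hb1 hK hφ h
    refine not_hermite_coefficients_gaussian hv hb hb1 fun R hR => ?_
    obtain ⟨C, hC⟩ := exists_bound_of_continuous_on_dual hq φ hφ hR
    have hK' : 0 < ‖K‖ := norm_pos_iff.2 hK
    refine ⟨C / ‖K‖, fun n => ?_⟩
    have h3 := hC n
    rw [h n, norm_mul] at h3
    rw [div_mul_eq_mul_div, le_div_iff₀ hK']
    linarith
  have hc2 : ∀ c : ℝ, c ≠ 0 → |c| ≠ 1 → 0 < c ^ 2 ∧ c ^ 2 ≠ 1 := by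
    intro c hc hc1
    refine ⟨by positivity, fun h => hc1 ?_⟩
    rcases sq_eq_one_iff.1 h with h | h <;> simp [h]
  refine ⟨fun c hc hc1 => ⟨fun h => ?_, ?_⟩, ?_, ?_⟩
  · obtain ⟨g, hg⟩ := h (f 0)
    refine hV (c ^ 2) g (hc2 c hc hc1).1 (hc2 c hc hc1).2 fun x => ?_
    rw [hg, hf0, norm_smul, mul_pow, Real.norm_eq_abs, sq_abs, neg_mul]
  · rintro ⟨T, hT, hTf⟩
    -- T(u_n) is tested on e^{-|x|²/2}. The substitution x ↦ x/c moves the dilation from φ_n to this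
    -- Gaussian, hence b = c⁻² and the Jacobian |c|^{-d} as K.
    refine hV' ((c⁻¹) ^ 2) ⟨⟨fun w => T w (f 0), fun w w' => by simp⟩, fun a w => by simp⟩
      ((|(c ^ Module.finrank ℝ (EuclideanSpace ℝ (Fin d)))⁻¹| : ℝ) : ℂ)
      (by positivity) ?_ ?_ (hT (f 0)) fun n => ?_
    · rw [inv_pow]
      exact fun h => (hc2 c hc hc1).2 (inv_eq_one.1 h)
    · have : |(c ^ Module.finrank ℝ (EuclideanSpace ℝ (Fin d)))⁻¹| ≠ 0 := by
        rw [abs_ne_zero]; positivity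
      exact_mod_cast this
    · change T (u n) (f 0) = _
      rw [(hTf (f n) (u n) (hu n) (f 0)).2]
      have := Measure.integral_comp_smul (volume : Measure (EuclideanSpace ℝ (Fin d)))
        (fun x => (hermiteGauss v n).1 x *
          ((Real.exp (-(c⁻¹) ^ 2 * ‖x‖ ^ 2 / 2) : ℝ) : ℂ)) c
      rw [Complex.real_smul] at this
      rw [← this]
      refine integral_congr_ae (.of_forall fun x => ?_)
      dsimp only
      rw [hf, hf0, norm_smul, mul_pow, Real.norm_eq_abs, sq_abs]
      congr 4
      field_simp
  · rintro ⟨m, -, hm⟩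
    refine hV 2 (m (f 0, f 0)) two_pos (by norm_num) fun x => ?_
    rw [hm, hf0, ← Complex.ofReal_mul, ← Real.exp_add]
    congr 2
    ring
  · rintro ⟨M, hM, -, hMf⟩
    -- One factor e^{-|x|²/2} comes from the product and one from the test function, so b = 2.
    refine hV' 2 ⟨⟨fun w => M w (f 0) (f 0), fun w w' => by simp⟩, fun a w => by simp⟩
      1 two_pos (by norm_num) one_ne_zero (hM (f 0) (f 0)) fun n => ?_
    change M (u n) (f 0) (f 0) = _
    rw [(hMf (f n) (f 0) (u n) (hu n) (f 0)).2, one_mul]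
    refine integral_congr_ae (.of_forall fun x => ?_)
    dsimp only
    rw [hf, hf0, mul_assoc, ← Complex.ofReal_mul, ← Real.exp_add]
    congr 3
    ring

end Obstructions

/-! ### Application to the Pilipović spaces -/

/-- The ε-th power of x^n ≤ n! e^x at x = a^{1/ε}: any positive power of n! beats every exponential.
-/
theorem exists_pow_le_mul_factorial_rpow {a ε : ℝ} (ha : 0 ≤ a) (hε : 0 < ε) :
    ∃ C : ℝ, 0 ≤ C ∧ ∀ n : ℕ, a ^ n ≤ C * (n.factorial : ℝ) ^ ε := by
  refine ⟨Real.exp (a ^ (1 / ε)) ^ ε, by positivity, fun n => ?_⟩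
  have h0 : 0 ≤ a ^ (1 / ε) := Real.rpow_nonneg ha _
  have h1 := Real.pow_div_factorial_le_exp (a ^ (1 / ε)) h0 n
  rw [div_le_iff₀ (by positivity)] at h1
  rw [← Real.mul_rpow (by positivity) (by positivity)]
  calc a ^ n = ((a ^ (1 / ε)) ^ n) ^ ε := by
        rw [← Real.rpow_natCast (a ^ (1 / ε)), ← Real.rpow_mul ha, ← Real.rpow_mul ha,
          ← Real.rpow_natCast a]
        congr 1
        field_simp
    _ ≤ _ := Real.rpow_le_rpow (by positivity) h1 hε.le

theorem norm_harmonicOscillator_pow_le {d : ℕ} {s h : ℝ} (hh : 0 < h) {ψ : SmoothFun d}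
    (hψ : ψ ∈ stepSpace (pilipovicScale d s h)) (N : ℕ) (x : EuclideanSpace ℝ (Fin d)) :
    ‖((harmonicOscillator d ^ N) ψ).1 x‖ ≤
      h ^ N * (N.factorial : ℝ) ^ (2 * s) * stepNorm (pilipovicScale d s h) ψ := by
  have h0 : 0 < (N.factorial : ℝ) ^ (2 * s) := Real.rpow_pos_of_pos (by positivity) _
  have h1 := norm_le_stepNorm hψ (N, x)
  have h2 : pilipovicScale d s h (N, x) ψ =
    (((h ^ N * (N.factorial : ℝ) ^ (2 * s))⁻¹ : ℝ) : ℂ) * ((harmonicOscillator d ^ N) ψ).1 x := rfl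
  rw [h2, norm_mul, Complex.norm_real, Real.norm_eq_abs, abs_of_pos (by positivity),
    inv_mul_le_iff₀ (by positivity)] at h1
  exact h1

theorem norm_le_stepNorm_pilipovic {d : ℕ} {s h : ℝ} (hh : 0 < h) {ψ : SmoothFun d}
    (hψ : ψ ∈ stepSpace (pilipovicScale d s h)) (x : EuclideanSpace ℝ (Fin d)) :
    ‖ψ.1 x‖ ≤ stepNorm (pilipovicScale d s h) ψ := by
  simpa using norm_harmonicOscillator_pow_le hh hψ 0 x

/-- The `L¹` norm of `e^{-|x|²/4}`. -/
noncomputable def gaussMass (d : ℕ) : ℝ :=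
  ∫ x : EuclideanSpace ℝ (Fin d), Real.exp (-(1 / 4) * ‖x‖ ^ 2)

theorem gaussMass_nonneg (d : ℕ) : 0 ≤ gaussMass d :=
  integral_nonneg fun _ => (Real.exp_pos _).le

/-- Taking N = n in `norm_integral_hermiteGauss_mul_le`, the eigenvalue power satisfies (2n+d)^n ≥
n^n ≥ n!. Against the (n!)^{2s} of the norm this leaves the exponent 2s - 1, which is where the
threshold s = 1/2 enters. -/
theorem pow_mul_norm_integral_hermiteGauss_le {d : ℕ} {v : EuclideanSpace ℝ (Fin d)}
    (hv : ‖v‖ = 1) {s h : ℝ} (hh : 0 < h) {ψ : SmoothFun d}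
    (hψ : ψ ∈ stepSpace (pilipovicScale d s h)) (n : ℕ) {R : ℝ} (hR : 0 < R) :
    R ^ n * ‖∫ x, (hermiteGauss v n).1 x * ψ.1 x‖ ≤
      gaussMass d * ((R * Real.exp 5 * h) ^ n * (n.factorial : ℝ) ^ (2 * s - 1)) *
        stepNorm (pilipovicScale d s h) ψ * Real.sqrt n.factorial := by
  have h1 := norm_integral_hermiteGauss_mul_le hv n n ψ _ (norm_harmonicOscillator_pow_le hh hψ)
  have hf : (0 : ℝ) < n.factorial := by positivity
  have h2 : (n.factorial : ℝ) ≤ (2 * n + d : ℝ) ^ n := by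
    calc (n.factorial : ℝ) ≤ (n : ℝ) ^ n := by exact_mod_cast Nat.factorial_le_pow n
      _ ≤ _ := by
        gcongr
        have : (0 : ℝ) ≤ d := d.cast_nonneg
        have : (0 : ℝ) ≤ n := n.cast_nonneg
        linarith
  have h3 := (mul_le_mul_of_nonneg_right h2
    (norm_nonneg (∫ x, (hermiteGauss v n).1 x * ψ.1 x))).trans h1
  rw [← le_div_iff₀' hf] at h3
  have h4 : (n.factorial : ℝ) ^ (2 * s - 1) = (n.factorial : ℝ) ^ (2 * s) / n.factorial :=
    Real.rpow_sub_one hf.ne' _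
  calc _ ≤ R ^ n * _ := mul_le_mul_of_nonneg_left h3 (by positivity)
    _ = _ := by
      rw [h4, gaussMass, mul_pow, mul_pow]
      ring

/-- Since H^N acts as (2n+d)^N, membership only compares this power with h^N (N!)^{2s}. For s > 0
the comparison holds for every h, for s = 0 once h ≥ 2n+d. -/
theorem mem_stepSpace_hermiteGauss {d : ℕ} {v : EuclideanSpace ℝ (Fin d)}
    (hv : ‖v‖ = 1) {s h C : ℝ} (hh : 0 < h) (n : ℕ)
    (hC : ∀ N : ℕ, ((2 * n + d) / h) ^ N ≤ C * (N.factorial : ℝ) ^ (2 * s)) :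
    hermiteGauss v n ∈ stepSpace (pilipovicScale d s h) := by
  refine ⟨C * (Real.sqrt n.factorial * Real.exp 5 ^ n), ?_⟩
  rintro _ ⟨⟨N, x⟩, rfl⟩
  have h0 : 0 < (N.factorial : ℝ) ^ (2 * s) := Real.rpow_pos_of_pos (by positivity) _
  have h2 : pilipovicScale d s h (N, x) (hermiteGauss v n) =
    (((h ^ N * (N.factorial : ℝ) ^ (2 * s))⁻¹ : ℝ) : ℂ) *
      ((harmonicOscillator d ^ N) (hermiteGauss v n)).1 x := rfl
  have h3 : ((harmonicOscillator d ^ N) (hermiteGauss v n)).1 x =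
      (((2 * n + d) ^ N : ℝ) : ℂ) * (hermiteGauss v n).1 x := by
    rw [harmonicOscillator_pow_hermiteGauss hv]
    push_cast
    rfl
  have h4 : ‖(hermiteGauss v n).1 x‖ ≤ Real.sqrt n.factorial * Real.exp 5 ^ n := by
    refine (norm_hermiteGauss_le hv n x).trans (mul_le_of_le_one_right (by positivity) ?_)
    rw [Real.exp_le_one_iff]
    have : 0 ≤ ‖x‖ ^ 2 := by positivity
    linarith
  dsimp only
  rw [h2, h3, ← mul_assoc, norm_mul, ← Complex.ofReal_mul, Complex.norm_real, Real.norm_eq_abs,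
    abs_of_nonneg (by positivity)]
  refine mul_le_mul ?_ h4 (norm_nonneg _) ?_
  · rw [mul_inv, mul_comm, ← mul_assoc, ← div_eq_mul_inv, ← div_eq_mul_inv, ← div_pow,
      div_le_iff₀ h0]
    exact hC N
  · have := hC 0
    simp at this
    linarith

/-- Integration against `F`, as a functional on a space of functions. -/
noncomputable def integralFunctional {d : ℕ} {V : Type} [AddCommGroup V] [Module ℂ V]
    (ev : V →ₗ[ℂ] (EuclideanSpace ℝ (Fin d) → ℂ)) (F : EuclideanSpace ℝ (Fin d) → ℂ)
    (hF : ∀ φ, Integrable fun x => F x * ev φ x) : V →ₗ[ℂ] ℂ where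
  toFun φ := ∫ x, F x * ev φ x
  map_add' φ ψ := by
    simp only [map_add, Pi.add_apply, mul_add]
    exact integral_add (hF φ) (hF ψ)
  map_smul' c φ := by
    simp only [map_smul, Pi.smul_apply, smul_eq_mul, RingHom.id_apply]
    rw [← integral_const_mul]
    simp only [mul_left_comm]

theorem integrable_hermiteGauss_mul_of_mem {d : ℕ} {v : EuclideanSpace ℝ (Fin d)}
    (hv : ‖v‖ = 1) {s h : ℝ} (hh : 0 < h) {ψ : SmoothFun d}
    (hψ : ψ ∈ stepSpace (pilipovicScale d s h)) (n : ℕ) :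
    Integrable fun x => (hermiteGauss v n).1 x * ψ.1 x :=
  integrable_hermiteGauss_mul hv n (SmoothFun.continuous ψ).aestronglyMeasurable
    (norm_le_stepNorm_pilipovic hh hψ)

/-- The step h = (R e^5)⁻¹ makes the exponential factor (R e^5 h)^n equal to 1. Such small h are
available in the Beurling case, so the endpoint s = 1/2 is allowed. -/
theorem pilipovicBeurling_decay {d : ℕ} {v : EuclideanSpace ℝ (Fin d)}
    (hv : ‖v‖ = 1) {s : ℝ} (hs : s ≤ 1 / 2) {ψ : SmoothFun d} {R : ℝ} (hR : 0 < R)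
    (hψ : ψ ∈ stepSpace (pilipovicScale d s (R * Real.exp 5)⁻¹)) (n : ℕ) :
    R ^ n * ‖∫ x, (hermiteGauss v n).1 x * ψ.1 x‖ ≤
      gaussMass d * stepNorm (pilipovicScale d s (R * Real.exp 5)⁻¹) ψ *
        Real.sqrt n.factorial := by
  refine (pow_mul_norm_integral_hermiteGauss_le hv (by positivity) hψ n hR).trans ?_
  have hR' : R * Real.exp 5 ≠ 0 := by positivity
  have h1 : (n.factorial : ℝ) ^ (2 * s - 1) ≤ 1 :=
    Real.rpow_le_one_of_one_le_of_nonpos (by exact_mod_cast n.factorial_pos) (by linarith)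
  rw [mul_inv_cancel₀ hR', one_pow, one_mul]
  have := stepNorm_nonneg (pilipovicScale d s (R * Real.exp 5)⁻¹) ψ
  have := gaussMass_nonneg d
  gcongr
  exact mul_le_of_le_one_right (gaussMass_nonneg d) h1

theorem pilipovicBeurling_not_invariant {d : ℕ} (hd : 1 ≤ d) {s : ℝ} (hs0 : 0 < s)
    (hs : s ≤ 1 / 2) :
    (∀ c : ℝ, c ≠ 0 → |c| ≠ 1 →
        ¬ DilationInvariant (PilipovicBeurling.toFun (d := d) (s := s)) c ∧
        ¬ DualDilationInvariant (PilipovicBeurling.toFun (d := d) (s := s)) c) ∧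
      ¬ IsTestFunctionModule (PilipovicBeurling.toFun (d := d) (s := s)) ∧
      ¬ IsDualTestFunctionModule (PilipovicBeurling.toFun (d := d) (s := s)) := by
  set v : EuclideanSpace ℝ (Fin d) := EuclideanSpace.single ⟨0, hd⟩ 1 with hv'
  have hv : ‖v‖ = 1 := by simp [hv']
  have hmem : ∀ n, hermiteGauss v n ∈ projLimit (pilipovicScale d s) := by
    intro n
    rw [mem_projLimit]
    intro h hh
    obtain ⟨C, -, hC⟩ := exists_pow_le_mul_factorial_rpow (a := (2 * n + d) / h) (ε := 2 * s)
      (by positivity) (by positivity)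
    exact mem_stepSpace_hermiteGauss hv hh n hC
  have hint : ∀ n (ψ : PilipovicBeurling d s),
      Integrable fun x => (hermiteGauss v n).1 x * ψ.val.1 x := fun n ψ =>
    integrable_hermiteGauss_mul_of_mem hv one_pos (ψ.mem_stepSpace one_pos) n
  let U : ℕ → PilipovicBeurling d s →ₗ[ℂ] ℂ := fun n =>
    integralFunctional ((SmoothFun d).subtype ∘ₗ ProjLimit.val) (hermiteGauss v n).1 (hint n)
  have hU : ∀ R : ℝ, 0 < R → ∀ n ψ, R ^ n * ‖U n ψ‖ ≤
      gaussMass d * stepNorm (pilipovicScale d s (R * Real.exp 5)⁻¹) ψ.val *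
        Real.sqrt n.factorial := fun R hR n ψ =>
    pilipovicBeurling_decay hv hs hR (ψ.mem_stepSpace (by positivity)) n
  have hUc : ∀ n, Continuous (U n) := fun n =>
    ProjLimit.continuous_of_bound (U n) (h := (1 * Real.exp 5)⁻¹)
      (C := gaussMass d * Real.sqrt n.factorial) (by positivity) fun ψ => by
        have := hU 1 one_pos n ψ
        rw [one_pow, one_mul] at this
        linarith
  refine not_invariant_of_hermite_decay hv (f := fun n => ⟨hermiteGauss v n, hmem n⟩)
    (u := fun n => ⟨U n, hUc n⟩) (fun n x => rfl) (fun n ψ => ⟨hint n ψ, rfl⟩) fun R hR =>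
    ⟨fun ψ => gaussMass d * stepNorm (pilipovicScale d s (R * Real.exp 5)⁻¹) ψ.val,
      fun B hB => ?_, hU R hR⟩
  obtain ⟨C, hC⟩ := ProjLimit.exists_bound_of_isVonNBounded
    (h := (R * Real.exp 5)⁻¹) (by positivity) hB
  exact ⟨gaussMass d * C, fun ψ hψ => mul_le_mul_of_nonneg_left (hC ψ hψ) (gaussMass_nonneg d)⟩

theorem pilipovicRoumieu_not_invariant {d : ℕ} (hd : 1 ≤ d) {s : ℝ} (hs0 : 0 ≤ s)
    (hs : s < 1 / 2) :
    (∀ c : ℝ, c ≠ 0 → |c| ≠ 1 →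
        ¬ DilationInvariant (PilipovicRoumieu.toFun (d := d) (s := s)) c ∧
        ¬ DualDilationInvariant (PilipovicRoumieu.toFun (d := d) (s := s)) c) ∧
      ¬ IsTestFunctionModule (PilipovicRoumieu.toFun (d := d) (s := s)) ∧
      ¬ IsDualTestFunctionModule (PilipovicRoumieu.toFun (d := d) (s := s)) := by
  set v : EuclideanSpace ℝ (Fin d) := EuclideanSpace.single ⟨0, hd⟩ 1 with hv'
  have hv : ‖v‖ = 1 := by simp [hv']
  have hd0 : (0 : ℝ) < d := by exact_mod_cast hd
  have hmem : ∀ n, hermiteGauss v n ∈ indLimit (pilipovicScale d s) := by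
    intro n
    rw [mem_pilipovicRoumieu]
    have h0 : (0 : ℝ) < 2 * n + d := by positivity
    -- With h equal to the eigenvalue the ratio is 1, which covers s = 0 as well.
    refine ⟨2 * n + d, h0, mem_stepSpace_hermiteGauss hv (C := 1) h0 n fun N => ?_⟩
    rw [div_self h0.ne', one_pow, one_mul]
    exact Real.one_le_rpow (by exact_mod_cast N.factorial_pos) (by positivity)
  have hstep : ∀ ψ : PilipovicRoumieu d s, ∃ h : ℝ, 0 < h ∧
      ψ.val ∈ stepSpace (pilipovicScale d s h) := fun ψ => (mem_pilipovicRoumieu ψ.val).1 ψ.2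
  have hint : ∀ n (ψ : PilipovicRoumieu d s),
      Integrable fun x => (hermiteGauss v n).1 x * ψ.val.1 x := fun n ψ => by
    obtain ⟨h, hh, hψ⟩ := hstep ψ
    exact integrable_hermiteGauss_mul_of_mem hv hh hψ n
  let U : ℕ → PilipovicRoumieu d s →ₗ[ℂ] ℂ := fun n =>
    integralFunctional ((SmoothFun d).subtype ∘ₗ IndLimit.val) (hermiteGauss v n).1 (hint n)
  have hU : ∀ R : ℝ, 0 < R → ∀ h : ℝ, 0 < h → ∃ C : ℝ, ∀ n (ψ : PilipovicRoumieu d s),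
      ψ.val ∈ stepSpace (pilipovicScale d s h) → R ^ n * ‖U n ψ‖ ≤
      C * stepNorm (pilipovicScale d s h) ψ.val * Real.sqrt n.factorial := by
    intro R hR h hh
    -- Here h cannot be made small; instead (n!)^{2s-1} absorbs the exponential, which needs the
    -- strict inequality s < 1/2.
    obtain ⟨C, hC0, hC⟩ := exists_pow_le_mul_factorial_rpow (a := R * Real.exp 5 * h)
      (ε := 1 - 2 * s) (by positivity) (by linarith)
    refine ⟨gaussMass d * C, fun n ψ hψ =>
      (pow_mul_norm_integral_hermiteGauss_le hv hh hψ n hR).trans ?_⟩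
    have hf : (0 : ℝ) < n.factorial := by positivity
    have h1 : (R * Real.exp 5 * h) ^ n * (n.factorial : ℝ) ^ (2 * s - 1) ≤ C := by
      calc _ ≤ C * (n.factorial : ℝ) ^ (1 - 2 * s) * (n.factorial : ℝ) ^ (2 * s - 1) := by
            gcongr
            exact hC n
        _ = C := by
            rw [mul_assoc, ← Real.rpow_add hf]
            simp
    have := stepNorm_nonneg (pilipovicScale d s h) ψ.val
    have := gaussMass_nonneg d
    gcongr
  have hUc : ∀ n, Continuous (U n) := fun n =>
    IndLimit.continuous_of_bound (U n) fun h hh => by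
      obtain ⟨C, hC⟩ := hU 1 one_pos h hh
      refine ⟨C * Real.sqrt n.factorial, fun ψ hψ => ?_⟩
      have := hC n ψ hψ
      rw [one_pow, one_mul] at this
      linarith
  refine not_invariant_of_hermite_decay hv (f := fun n => ⟨hermiteGauss v n, hmem n⟩)
    (u := fun n => ⟨U n, hUc n⟩) (fun n x => rfl) (fun n ψ => ⟨hint n ψ, rfl⟩) fun R hR => ?_
  -- The rescaled functionals R^n u_n/√(n!) are bounded on each step uniformly in n, so their
  -- supremum is the required q.
  obtain ⟨q, hqB, hq⟩ := IndLimit.exists_bound_of_isVonNBounded hstep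
    (fun n => ((R ^ n / Real.sqrt n.factorial : ℝ) : ℂ) • U n) fun h hh => by
      obtain ⟨C, hC⟩ := hU R hR h hh
      refine ⟨C, fun n ψ hψ => ?_⟩
      rw [LinearMap.smul_apply, norm_smul, Complex.norm_real, Real.norm_eq_abs,
        abs_of_pos (by positivity), div_mul_eq_mul_div, div_le_iff₀ (by positivity)]
      exact hC n ψ hψ
  refine ⟨q, hqB, fun n ψ => ?_⟩
  have := hq n ψ
  rw [LinearMap.smul_apply, norm_smul, Complex.norm_real, Real.norm_eq_abs,
    abs_of_pos (by positivity), div_mul_eq_mul_div, div_le_iff₀ (by positivity)] at this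
  exact this

/-! ### Hermite functions on `ℝ^d` and the flat spaces -/

theorem continuous_hermiteFun (n : ℕ) : Continuous (hermiteFun n) := by
  simp only [funext (hermiteFun_eq n)]
  fun_prop

theorem continuous_hermiteFunction {d : ℕ} (α : Fin d → ℕ) :
    Continuous (hermiteFunction α) := by
  unfold hermiteFunction
  exact continuous_finsetProd _ fun j _ => (continuous_hermiteFun _).comp (by fun_prop)

theorem abs_hermiteFun_le (n : ℕ) (t : ℝ) :
    |hermiteFun n t| ≤ Real.exp 5 ^ n * Real.exp (-(1 / 4) * t ^ 2) := by
  have hf : 0 < Real.sqrt n.factorial := by positivity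
  have h1 := abs_eval_hermitePoly_le n t
  have h2 : Real.pi ^ (-(1 / 4) : ℝ) ≤ 1 :=
    Real.rpow_le_one_of_one_le_of_nonpos (by linarith [Real.pi_gt_three]) (by norm_num)
  have h3 : Real.sqrt n.factorial ≤ Real.sqrt (2 ^ n * n.factorial) :=
    Real.sqrt_le_sqrt (le_mul_of_one_le_left (by positivity) (one_le_pow₀ (by norm_num)))
  have h4 : (Real.sqrt (2 ^ n * n.factorial))⁻¹ * Real.sqrt n.factorial ≤ 1 := by
    rw [inv_mul_le_iff₀ (by positivity), mul_one]
    exact h3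
  rw [hermiteFun_eq, abs_mul, abs_mul, abs_mul, Real.abs_exp, abs_of_pos (by positivity),
    abs_of_pos (by positivity)]
  calc _ ≤ 1 * (Real.sqrt (2 ^ n * n.factorial))⁻¹ * (Real.sqrt n.factorial * Real.exp 5 ^ n *
        Real.exp (t ^ 2 / 4) * Real.exp (-t ^ 2 / 2)) := by gcongr
    _ = ((Real.sqrt (2 ^ n * n.factorial))⁻¹ * Real.sqrt n.factorial) *
        (Real.exp 5 ^ n * Real.exp (-(1 / 4) * t ^ 2)) := by
      rw [show -(1 / 4) * t ^ 2 = t ^ 2 / 4 + -t ^ 2 / 2 by ring, Real.exp_add]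
      ring
    _ ≤ _ := mul_le_of_le_one_left (by positivity) h4

theorem abs_hermiteFunction_le {d : ℕ} (α : Fin d → ℕ) (x : EuclideanSpace ℝ (Fin d)) :
    |hermiteFunction α x| ≤ (∏ j, Real.exp 5 ^ α j) * Real.exp (-(1 / 4) * ‖x‖ ^ 2) := by
  rw [hermiteFunction, Finset.abs_prod, EuclideanSpace.real_norm_sq_eq, Finset.mul_sum,
    Real.exp_sum, ← Finset.prod_mul_distrib]
  exact Finset.prod_le_prod (fun _ _ => abs_nonneg _) fun j _ => abs_hermiteFun_le _ _

theorem integral_hermiteFun_mul_hermiteFun (m n : ℕ) :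
    ∫ t, hermiteFun m t * hermiteFun n t = if m = n then 1 else 0 := by
  have h : ∀ t, hermiteFun m t * hermiteFun n t = (Real.pi ^ (-(1 / 4) : ℝ) *
      (Real.sqrt (2 ^ m * m.factorial))⁻¹ * (Real.pi ^ (-(1 / 4) : ℝ) *
      (Real.sqrt (2 ^ n * n.factorial))⁻¹)) *
      ((hermitePoly m).eval t * (hermitePoly n).eval t * Real.exp (-t ^ 2)) := by
    intro t
    have he : Real.exp (-t ^ 2) = Real.exp (-t ^ 2 / 2) * Real.exp (-t ^ 2 / 2) := by
      rw [← Real.exp_add, add_halves]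
    rw [hermiteFun_eq, hermiteFun_eq, he]
    ring
  simp only [h]
  rw [integral_const_mul, integral_hermitePoly_mul_hermitePoly]
  split_ifs with hmn
  · subst hmn
    have h1 : Real.pi ^ (-(1 / 4) : ℝ) * Real.pi ^ (-(1 / 4) : ℝ) * Real.sqrt Real.pi = 1 := by
      rw [Real.sqrt_eq_rpow, ← Real.rpow_add Real.pi_pos, ← Real.rpow_add Real.pi_pos]
      norm_num
    have h2 : (Real.sqrt (2 ^ m * m.factorial))⁻¹ * (Real.sqrt (2 ^ m * m.factorial))⁻¹ *
        (2 ^ m * m.factorial) = 1 := by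
      rw [← mul_inv, Real.mul_self_sqrt (by positivity)]
      exact inv_mul_cancel₀ (by positivity)
    linear_combination (Real.pi ^ (-(1 / 4) : ℝ) * Real.pi ^ (-(1 / 4) : ℝ) * Real.sqrt Real.pi) * h2
      + h1
  · simp

theorem integral_hermiteFunction_mul_hermiteFunction {d : ℕ} (α β : Fin d → ℕ) :
    ∫ x, hermiteFunction α x * hermiteFunction β x = if α = β then 1 else 0 := by
  have h : ∀ x : EuclideanSpace ℝ (Fin d), hermiteFunction α x * hermiteFunction β x =
      (fun y : Fin d → ℝ => ∏ j, hermiteFun (α j) (y j) * hermiteFun (β j) (y j))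
        (WithLp.ofLp x) := fun x => by
    simp only [hermiteFunction, Finset.prod_mul_distrib]
  simp only [h]
  rw [(PiLp.volume_preserving_ofLp (Fin d)).integral_comp
    (MeasurableEquiv.toLp 2 (Fin d → ℝ)).symm.measurableEmbedding
    (fun y : Fin d → ℝ => ∏ j, hermiteFun (α j) (y j) * hermiteFun (β j) (y j)),
    integral_fintype_prod_volume_eq_prod
      (f := fun j (t : ℝ) => hermiteFun (α j) t * hermiteFun (β j) t)]
  simp only [integral_hermiteFun_mul_hermiteFun]
  split_ifs with hαβ
  · simp [hαβ]
  · obtain ⟨j, hj⟩ := Function.ne_iff.1 hαβ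
    exact Finset.prod_eq_zero (Finset.mem_univ j) (if_neg hj)

/-- Every finite set of multi-indices lies in a cube, over which the sum factorises into d equal
one-dimensional sums. -/
theorem summable_prod_pow_div_sqrt_factorial (d : ℕ) {a : ℝ} (ha : 0 ≤ a) :
    Summable fun α : Fin d → ℕ => ∏ j, a ^ α j / Real.sqrt (α j).factorial := by
  have hg0 : ∀ n : ℕ, 0 ≤ a ^ n / Real.sqrt n.factorial := fun n => by positivity
  have hg : Summable fun n : ℕ => a ^ n / Real.sqrt n.factorial := by
    refine Summable.of_nonneg_of_le hg0 (fun n => ?_)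
      ((summable_geometric_of_lt_one (r := (1 / 2 : ℝ)) (by norm_num) (by norm_num)).mul_right
        (Real.exp (2 * a ^ 2)))
    have := pow_div_sqrt_factorial_le a n
    rwa [abs_of_nonneg ha] at this
  refine summable_of_sum_le (c := (∑' n : ℕ, a ^ n / Real.sqrt n.factorial) ^ d)
    (fun α => Finset.prod_nonneg fun _ _ => hg0 _) fun T => ?_
  set N := T.sup (fun α => Finset.univ.sup α) + 1 with hN
  have hT : T ⊆ Fintype.piFinset fun _ => Finset.range N := by
    intro α hα
    rw [Fintype.mem_piFinset]
    intro j
    rw [Finset.mem_range, hN, Nat.lt_succ_iff]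
    exact (Finset.le_sup (f := α) (Finset.mem_univ j)).trans
      (Finset.le_sup (f := fun α : Fin d → ℕ => Finset.univ.sup α) hα)
  calc _ ≤ ∑ α ∈ Fintype.piFinset fun _ : Fin d => Finset.range N,
        ∏ j, a ^ α j / Real.sqrt (α j).factorial :=
        Finset.sum_le_sum_of_subset_of_nonneg hT fun α _ _ => Finset.prod_nonneg fun _ _ => hg0 _
    _ = ∏ _j : Fin d, ∑ n ∈ Finset.range N, a ^ n / Real.sqrt n.factorial :=
        (Finset.prod_univ_sum (fun _ : Fin d => Finset.range N)
          fun _ n => a ^ n / Real.sqrt n.factorial).symm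
    _ = (∑ n ∈ Finset.range N, a ^ n / Real.sqrt n.factorial) ^ d := by simp
    _ ≤ _ := pow_le_pow_left₀ (Finset.sum_nonneg fun n _ => hg0 n)
        (hg.sum_le_tsum _ fun n _ => hg0 n) d

theorem norm_le_stepNorm_flat {d : ℕ} {R : ℝ} (hR : 0 < R) {c : (Fin d → ℕ) → ℂ}
    (hc : c ∈ stepSpace (flatScale d R)) (α : Fin d → ℕ) :
    ‖c α‖ ≤ stepNorm (flatScale d R) c * ∏ j, R ^ α j / Real.sqrt (α j).factorial := by
  have h1 := norm_le_stepNorm hc α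
  have h2 : flatScale d R α c =
    (((R ^ (∑ j, α j) * (Real.sqrt (∏ j, ((α j).factorial : ℝ)))⁻¹)⁻¹ : ℝ) : ℂ) * c α := rfl
  have h3 : R ^ (∑ j, α j) * (Real.sqrt (∏ j, ((α j).factorial : ℝ)))⁻¹ =
      ∏ j, R ^ α j / Real.sqrt (α j).factorial := by
    rw [Finset.prod_div_distrib, Finset.prod_pow_eq_pow_sum, div_eq_mul_inv,
      Real.sqrt_prod _ fun _ _ => by positivity]
  have h4 : 0 < ∏ j, R ^ α j / Real.sqrt (α j).factorial :=
    Finset.prod_pos fun j _ => by positivity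
  rw [h2, h3, norm_mul, Complex.norm_real, Real.norm_eq_abs, abs_of_pos (by positivity),
    inv_mul_le_iff₀ h4, mul_comm] at h1
  exact h1

theorem norm_mul_hermiteFunction_le {d : ℕ} {R : ℝ} (hR : 0 < R) {c : (Fin d → ℕ) → ℂ}
    (hc : c ∈ stepSpace (flatScale d R)) (α : Fin d → ℕ) (x : EuclideanSpace ℝ (Fin d)) :
    ‖c α * (hermiteFunction α x : ℂ)‖ ≤ stepNorm (flatScale d R) c *
      (∏ j, (R * Real.exp 5) ^ α j / Real.sqrt (α j).factorial) *
        Real.exp (-(1 / 4) * ‖x‖ ^ 2) := by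
  rw [norm_mul, Complex.norm_real, Real.norm_eq_abs]
  have h0 := stepNorm_nonneg (flatScale d R) c
  calc _ ≤ (stepNorm (flatScale d R) c * ∏ j, R ^ α j / Real.sqrt (α j).factorial) *
        ((∏ j, Real.exp 5 ^ α j) * Real.exp (-(1 / 4) * ‖x‖ ^ 2)) :=
      mul_le_mul (norm_le_stepNorm_flat hR hc α) (abs_hermiteFunction_le α x) (abs_nonneg _)
        (mul_nonneg h0 (Finset.prod_nonneg fun j _ => by positivity))
    _ = _ := by
      have : ∏ j, (R * Real.exp 5) ^ α j / Real.sqrt (α j).factorial =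
          (∏ j, R ^ α j / Real.sqrt (α j).factorial) * ∏ j, Real.exp 5 ^ α j := by
        rw [← Finset.prod_mul_distrib]
        exact Finset.prod_congr rfl fun j _ => by rw [mul_pow]; ring
      rw [this]
      ring

/-- A Hermite series in `𝓗_♭` may be integrated termwise against a Hermite function. -/
theorem integral_hermiteFunction_mul_tsum {d : ℕ} {R : ℝ} (hR : 0 < R) {c : (Fin d → ℕ) → ℂ}
    (hc : c ∈ stepSpace (flatScale d R)) (β : Fin d → ℕ) :
    Integrable (fun x => (hermiteFunction β x : ℂ) * ∑' α, c α * (hermiteFunction α x : ℂ)) ∧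
      ∫ x, (hermiteFunction β x : ℂ) * ∑' α, c α * (hermiteFunction α x : ℂ) = c β := by
  set S := stepNorm (flatScale d R) c
  set K := ∏ j, Real.exp 5 ^ β j
  set g : (Fin d → ℕ) → ℝ := fun α =>
    ∏ j, (R * Real.exp 5) ^ α j / Real.sqrt (α j).factorial with hg'
  have hS : 0 ≤ S := stepNorm_nonneg _ _
  have hK : 0 ≤ K := Finset.prod_nonneg fun j _ => by positivity
  have hg : Summable g := summable_prod_pow_div_sqrt_factorial d (by positivity)
  have hg0 : ∀ α, 0 ≤ g α := fun α => Finset.prod_nonneg fun j _ => by positivity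
  have he1 : ∀ x : EuclideanSpace ℝ (Fin d), Real.exp (-(1 / 4) * ‖x‖ ^ 2) ≤ 1 := fun x => by
    rw [Real.exp_le_one_iff]
    have : 0 ≤ ‖x‖ ^ 2 := by positivity
    linarith
  have hE : Integrable fun x : EuclideanSpace ℝ (Fin d) => Real.exp (-(1 / 4) * ‖x‖ ^ 2) :=
    integrable_exp_neg_mul_norm_sq (by norm_num)
  have hcont : ∀ α : Fin d → ℕ, Continuous fun x : EuclideanSpace ℝ (Fin d) =>
      (hermiteFunction α x : ℂ) := fun α =>
    Complex.continuous_ofReal.comp (continuous_hermiteFunction α)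
  have hβ : ∀ x, ‖(hermiteFunction β x : ℂ)‖ ≤ K := fun x => by
    rw [Complex.norm_real, Real.norm_eq_abs]
    exact (abs_hermiteFunction_le β x).trans (mul_le_of_le_one_right hK (he1 x))
  have hterm : ∀ α x, ‖c α * (hermiteFunction α x : ℂ)‖ ≤
      S * g α * Real.exp (-(1 / 4) * ‖x‖ ^ 2) := norm_mul_hermiteFunction_le hR hc
  have hsum : ∀ x, Summable fun α => c α * (hermiteFunction α x : ℂ) := fun x =>
    Summable.of_norm_bounded ((hg.mul_left S).mul_right _) fun α => hterm α x
  have hF : ∀ α x, ‖(hermiteFunction β x : ℂ) * (c α * (hermiteFunction α x : ℂ))‖ ≤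
      K * (S * g α) * Real.exp (-(1 / 4) * ‖x‖ ^ 2) := fun α x => by
    rw [norm_mul, mul_assoc]
    exact mul_le_mul (hβ x) (hterm α x) (norm_nonneg _) hK
  have hFi : ∀ α, Integrable fun x =>
      (hermiteFunction β x : ℂ) * (c α * (hermiteFunction α x : ℂ)) := fun α =>
    (hE.const_mul _).mono' ((hcont β).mul ((hcont α).const_mul _)).aestronglyMeasurable
      (.of_forall (hF α))
  constructor
  · have hcs : Continuous fun x : EuclideanSpace ℝ (Fin d) =>
        ∑' α, c α * (hermiteFunction α x : ℂ) :=
      continuous_tsum (fun α => (hcont α).const_mul _) (hg.mul_left S) fun α x =>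
        (hterm α x).trans (mul_le_of_le_one_right (mul_nonneg hS (hg0 α)) (he1 x))
    refine (hE.const_mul (K * (S * ∑' α, g α))).mono'
      ((hcont β).mul hcs).aestronglyMeasurable (.of_forall fun x => ?_)
    rw [norm_mul, mul_assoc K]
    refine mul_le_mul (hβ x) ?_ (norm_nonneg _) hK
    exact tsum_of_norm_bounded ((hg.hasSum.mul_left S).mul_right _) fun α => hterm α x
  · have h1 := hasSum_integral_of_summable_integral_norm hFi (Summable.of_nonneg_of_le
      (fun α => integral_nonneg fun x => norm_nonneg _)
      (fun α => (integral_mono (hFi α).norm (hE.const_mul _) (hF α)).trans_eq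
        (integral_const_mul _ _)) (((hg.mul_left S).mul_left K).mul_right _))
    simp only [tsum_mul_left] at h1
    rw [← h1.tsum_eq, tsum_eq_single β]
    · have h2 := integral_hermiteFunction_mul_hermiteFunction β β
      rw [if_pos rfl] at h2
      simp only [mul_left_comm _ (c β), integral_const_mul, ← Complex.ofReal_mul,
        integral_complex_ofReal, h2]
      simp
    · intro α hα
      have h2 := integral_hermiteFunction_mul_hermiteFunction β α
      rw [if_neg hα.symm] at h2
      simp only [mul_left_comm _ (c α), integral_const_mul, ← Complex.ofReal_mul,
        integral_complex_ofReal, h2]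
      simp

/-- As H_0 = 1, only the i-th coordinate contributes a polynomial. In a coordinate direction φ_n is
thus a multiple of one Hermite function, and pairing with it reads off one coefficient. -/
theorem hermiteGauss_single_eq {d : ℕ} (i : Fin d) (n : ℕ) (x : EuclideanSpace ℝ (Fin d)) :
    (hermiteGauss (EuclideanSpace.single i 1) n).1 x =
      (((Real.pi ^ (1 / 4 : ℝ)) ^ d * Real.sqrt (2 ^ n * n.factorial) *
        hermiteFunction (Pi.single i n) x : ℝ) : ℂ) := by
  rw [hermiteGauss_apply]
  congr 1
  have hs : ∀ g : ℕ → ℝ, g 0 = 1 → ∏ j, g ((Pi.single i n : Fin d → ℕ) j) = g n := by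
    intro g hg
    rw [Finset.prod_eq_single i]
    · simp
    · intro j _ hj
      simp [hj, hg]
    · simp
  have h1 : ∏ j, (hermitePoly ((Pi.single i n : Fin d → ℕ) j)).eval (x j) =
      (hermitePoly n).eval (x i) := by
    rw [Finset.prod_eq_single i]
    · simp
    · intro j _ hj
      simp [hj, hermitePoly]
    · simp
  have h2 := hs (fun m => (Real.sqrt (2 ^ m * m.factorial))⁻¹) (by simp)
  have h3 : Real.pi ^ (1 / 4 : ℝ) * Real.pi ^ (-(1 / 4) : ℝ) = 1 := by
    rw [← Real.rpow_add Real.pi_pos]; simp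
  simp only [hermiteFunction, hermiteFun_eq, Finset.prod_mul_distrib, Finset.prod_const,
    Finset.card_univ, Fintype.card_fin, h1, h2, ← Real.exp_sum, ← Finset.sum_div,
    Finset.sum_neg_distrib]
  rw [← EuclideanSpace.real_norm_sq_eq]
  have h4 : Real.sqrt (2 ^ n * n.factorial) ≠ 0 := by positivity
  rw [show (Real.pi ^ (1 / 4 : ℝ)) ^ d * Real.sqrt (2 ^ n * n.factorial) *
      ((Real.pi ^ (-(1 / 4) : ℝ)) ^ d * (Real.sqrt (2 ^ n * n.factorial))⁻¹ *
      ((hermitePoly n).eval (x i) * Real.exp (-‖x‖ ^ 2 / 2))) =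
      (Real.pi ^ (1 / 4 : ℝ) * Real.pi ^ (-(1 / 4) : ℝ)) ^ d *
      (Real.sqrt (2 ^ n * n.factorial) * (Real.sqrt (2 ^ n * n.factorial))⁻¹) *
      ((hermitePoly n).eval (x i) * Real.exp (-‖x‖ ^ 2 / 2)) by rw [mul_pow]; ring, h3,
    mul_inv_cancel₀ h4]
  simp [EuclideanSpace.inner_single_left]

/-- The Hermite coefficients of `H_n(x_i) e^{-|x|²/2}`. -/
noncomputable def hermiteGaussCoeff {d : ℕ} (i : Fin d) (n : ℕ) : (Fin d → ℕ) → ℂ :=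
  Pi.single (Pi.single i n)
    (((Real.pi ^ (1 / 4 : ℝ)) ^ d * Real.sqrt (2 ^ n * n.factorial) : ℝ) : ℂ)

theorem tsum_hermiteGaussCoeff {d : ℕ} (i : Fin d) (n : ℕ) (x : EuclideanSpace ℝ (Fin d)) :
    ∑' α, hermiteGaussCoeff i n α * (hermiteFunction α x : ℂ) =
      (hermiteGauss (EuclideanSpace.single i 1) n).1 x := by
  rw [tsum_eq_single (Pi.single i n) fun α hα => by
    rw [hermiteGaussCoeff, Pi.single_eq_of_ne hα, zero_mul], hermiteGauss_single_eq,
    hermiteGaussCoeff, Pi.single_eq_same, ← Complex.ofReal_mul]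

theorem mem_stepSpace_hermiteGaussCoeff {d : ℕ} (i : Fin d) (n : ℕ) (R : ℝ) :
    hermiteGaussCoeff i n ∈ stepSpace (flatScale d R) := by
  refine ⟨‖flatScale d R (Pi.single i n) (hermiteGaussCoeff i n)‖, ?_⟩
  rintro _ ⟨α, rfl⟩
  by_cases h : α = Pi.single i n
  · rw [h]
  · have : flatScale d R α (hermiteGaussCoeff i n) = 0 := by
      rw [flatScale, LinearMap.smul_apply, LinearMap.proj_apply, hermiteGaussCoeff,
        Pi.single_eq_of_ne h, smul_zero]
    simp [this]

/-- The functional `c ↦ ∫ H_n(x_i) e^{-|x|²/2} ∑ c_α h_α(x) dx` on formal Hermite series. -/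
noncomputable def hermiteGaussPairing {d : ℕ} (i : Fin d) (n : ℕ) :
    ((Fin d → ℕ) → ℂ) →ₗ[ℂ] ℂ :=
  (((Real.pi ^ (1 / 4 : ℝ)) ^ d * Real.sqrt (2 ^ n * n.factorial) : ℝ) : ℂ) •
    LinearMap.proj (Pi.single i n)

theorem hermiteGaussPairing_eq {d : ℕ} (i : Fin d) (n : ℕ) {R : ℝ} (hR : 0 < R)
    {c : (Fin d → ℕ) → ℂ} (hc : c ∈ stepSpace (flatScale d R)) :
    Integrable (fun x => (∑' α, hermiteGaussCoeff i n α * (hermiteFunction α x : ℂ)) *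
      ∑' α, c α * (hermiteFunction α x : ℂ)) ∧ hermiteGaussPairing i n c =
      ∫ x, (∑' α, hermiteGaussCoeff i n α * (hermiteFunction α x : ℂ)) *
        ∑' α, c α * (hermiteFunction α x : ℂ) := by
  obtain ⟨h1, h2⟩ := integral_hermiteFunction_mul_tsum hR hc (Pi.single i n)
  simp only [tsum_hermiteGaussCoeff, hermiteGauss_single_eq]
  simp only [Complex.ofReal_mul _ (hermiteFunction _ _), mul_assoc (Complex.ofReal (_ * _))]
  refine ⟨h1.const_mul _, ?_⟩
  rw [integral_const_mul, h2]
  rfl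

/-- The coefficient is at most a multiple of h^n/√(n!), and the normalisation √(2^n n!) cancels this
factorial. What remains is exponential in n, so √(n!) dominates it for every R on every step. -/
theorem exists_hermiteGaussPairing_le (d : ℕ) {R h : ℝ} (hR : 0 < R) (hh : 0 < h) :
    ∃ C : ℝ, 0 ≤ C ∧ ∀ (i : Fin d) (n : ℕ) (c : (Fin d → ℕ) → ℂ),
      c ∈ stepSpace (flatScale d h) → R ^ n * ‖hermiteGaussPairing i n c‖ ≤
        C * stepNorm (flatScale d h) c * Real.sqrt n.factorial := by
  refine ⟨(Real.pi ^ (1 / 4 : ℝ)) ^ d * Real.exp (2 * (R * Real.sqrt 2 * h) ^ 2), by positivity,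
    fun i n c hc => ?_⟩
  have h0 := stepNorm_nonneg (flatScale d h) c
  have h1 := norm_le_stepNorm_flat hh hc (Pi.single i n)
  have h2 : ∏ j, h ^ (Pi.single i n : Fin d → ℕ) j /
      Real.sqrt ((Pi.single i n : Fin d → ℕ) j).factorial = h ^ n / Real.sqrt n.factorial := by
    rw [Finset.prod_eq_single i]
    · simp
    · intro j _ hj
      simp [hj]
    · simp
  have h3 : (R * Real.sqrt 2 * h) ^ n / Real.sqrt n.factorial ≤
      Real.exp (2 * (R * Real.sqrt 2 * h) ^ 2) := by
    have := pow_div_sqrt_factorial_le (R * Real.sqrt 2 * h) n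
    rw [abs_of_nonneg (by positivity)] at this
    exact this.trans (mul_le_of_le_one_left (by positivity)
      (pow_le_one₀ (by norm_num) (by norm_num)))
  have h4 : Real.sqrt (2 ^ n * n.factorial) = Real.sqrt 2 ^ n * Real.sqrt n.factorial := by
    rw [Real.sqrt_mul (by positivity)]
    congr 1
    rw [Real.sqrt_eq_iff_mul_self_eq (by positivity) (by positivity), ← mul_pow,
      Real.mul_self_sqrt (by norm_num)]
  rw [h2] at h1
  rw [hermiteGaussPairing, LinearMap.smul_apply, norm_smul, Complex.norm_real, Real.norm_eq_abs,
    abs_of_pos (by positivity), LinearMap.proj_apply, h4]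
  calc _ ≤ R ^ n * ((Real.pi ^ (1 / 4 : ℝ)) ^ d * (Real.sqrt 2 ^ n * Real.sqrt n.factorial) *
        (stepNorm (flatScale d h) c * (h ^ n / Real.sqrt n.factorial))) := by gcongr
    _ = (Real.pi ^ (1 / 4 : ℝ)) ^ d * ((R * Real.sqrt 2 * h) ^ n / Real.sqrt n.factorial) *
        stepNorm (flatScale d h) c * Real.sqrt n.factorial := by
      rw [mul_pow, mul_pow]
      ring
    _ ≤ _ := by gcongr

theorem flatBeurling_not_invariant {d : ℕ} (hd : 1 ≤ d) :
    (∀ c : ℝ, c ≠ 0 → |c| ≠ 1 →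
        ¬ DilationInvariant (FlatBeurling.toFun (d := d)) c ∧
        ¬ DualDilationInvariant (FlatBeurling.toFun (d := d)) c) ∧
      ¬ IsTestFunctionModule (FlatBeurling.toFun (d := d)) ∧
      ¬ IsDualTestFunctionModule (FlatBeurling.toFun (d := d)) := by
  have hv : ‖(EuclideanSpace.single ⟨0, hd⟩ 1 : EuclideanSpace ℝ (Fin d))‖ = 1 := by simp
  let U : ℕ → FlatBeurling d →ₗ[ℂ] ℂ := fun n => hermiteGaussPairing ⟨0, hd⟩ n ∘ₗ ProjLimit.val
  have hUc : ∀ n, Continuous (U n) := fun n => by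
    obtain ⟨C, -, hC⟩ := exists_hermiteGaussPairing_le d one_pos one_pos
    refine ProjLimit.continuous_of_bound (U n) (h := 1) (C := C * Real.sqrt n.factorial) one_pos
      fun ψ => ?_
    have := hC ⟨0, hd⟩ n ψ.val (ψ.mem_stepSpace one_pos)
    rw [one_pow, one_mul] at this
    exact this.trans_eq (by ring)
  refine not_invariant_of_hermite_decay hv
    (f := fun n => ⟨hermiteGaussCoeff ⟨0, hd⟩ n, (mem_projLimit _ _).2 fun h _ =>
      mem_stepSpace_hermiteGaussCoeff _ n h⟩)
    (u := fun n => ⟨U n, hUc n⟩) (fun n x => tsum_hermiteGaussCoeff _ n x)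
    (fun n ψ => hermiteGaussPairing_eq _ n one_pos (ψ.mem_stepSpace one_pos)) fun R hR => ?_
  -- The step h = 1 serves all R.
  obtain ⟨C, hC0, hC⟩ := exists_hermiteGaussPairing_le d hR one_pos
  refine ⟨fun ψ => C * stepNorm (flatScale d 1) ψ.val, fun B hB => ?_, fun n ψ =>
    hC _ n ψ.val (ψ.mem_stepSpace one_pos)⟩
  obtain ⟨K, hK⟩ := ProjLimit.exists_bound_of_isVonNBounded one_pos hB
  exact ⟨C * K, fun ψ hψ => mul_le_mul_of_nonneg_left (hK ψ hψ) hC0⟩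

theorem flatRoumieu_not_invariant {d : ℕ} (hd : 1 ≤ d) :
    (∀ c : ℝ, c ≠ 0 → |c| ≠ 1 →
        ¬ DilationInvariant (FlatRoumieu.toFun (d := d)) c ∧
        ¬ DualDilationInvariant (FlatRoumieu.toFun (d := d)) c) ∧
      ¬ IsTestFunctionModule (FlatRoumieu.toFun (d := d)) ∧
      ¬ IsDualTestFunctionModule (FlatRoumieu.toFun (d := d)) := by
  have hv : ‖(EuclideanSpace.single ⟨0, hd⟩ 1 : EuclideanSpace ℝ (Fin d))‖ = 1 := by simp
  have hstep : ∀ ψ : FlatRoumieu d, ∃ h : ℝ, 0 < h ∧ ψ.val ∈ stepSpace (flatScale d h) :=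
    fun ψ => (mem_flatRoumieu ψ.val).1 ψ.2
  let U : ℕ → FlatRoumieu d →ₗ[ℂ] ℂ := fun n => hermiteGaussPairing ⟨0, hd⟩ n ∘ₗ IndLimit.val
  have hUc : ∀ n, Continuous (U n) := fun n =>
    IndLimit.continuous_of_bound (U n) fun h hh => by
      obtain ⟨C, -, hC⟩ := exists_hermiteGaussPairing_le d one_pos hh
      refine ⟨C * Real.sqrt n.factorial, fun ψ hψ => ?_⟩
      have := hC ⟨0, hd⟩ n ψ.val hψ
      rw [one_pow, one_mul] at this
      exact this.trans_eq (by ring)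
  refine not_invariant_of_hermite_decay hv
    (f := fun n => ⟨hermiteGaussCoeff ⟨0, hd⟩ n, (mem_flatRoumieu _).2 ⟨1, one_pos,
      mem_stepSpace_hermiteGaussCoeff _ n 1⟩⟩)
    (u := fun n => ⟨U n, hUc n⟩) (fun n x => tsum_hermiteGaussCoeff _ n x) (fun n ψ => by
      obtain ⟨h, hh, hψ⟩ := hstep ψ
      exact hermiteGaussPairing_eq _ n hh hψ) fun R hR => ?_
  have hconv : ∀ n ψ (K : ℝ), ‖(((R ^ n / Real.sqrt n.factorial : ℝ) : ℂ) • U n) ψ‖ ≤ K ↔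
      R ^ n * ‖U n ψ‖ ≤ K * Real.sqrt n.factorial := fun n ψ K => by
    rw [LinearMap.smul_apply, norm_smul, Complex.norm_real, Real.norm_eq_abs,
      abs_of_pos (by positivity), div_mul_eq_mul_div, div_le_iff₀ (by positivity)]
  obtain ⟨q, hqB, hq⟩ := IndLimit.exists_bound_of_isVonNBounded hstep
    (fun n => ((R ^ n / Real.sqrt n.factorial : ℝ) : ℂ) • U n) fun h hh => by
      obtain ⟨C, -, hC⟩ := exists_hermiteGaussPairing_le d hR hh
      exact ⟨C, fun n ψ hψ => (hconv n ψ _).2 (hC _ n ψ.val hψ)⟩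
  exact ⟨q, hqB, fun n ψ => (hconv n ψ _).1 (hq n ψ)⟩

/-! ### Gauss functions in `𝚺_{1/2}` -/

/-- The sequence `Q_{k,N}`, `Q_{k,0}(y) = e^y`, with
`H^N (e^{L} e^{-|x|²/2}) = Q_{0,N}(L) e^{-|x|²/2}` when `κ = ∑ L(e_i)²`. -/
noncomputable def oscillatorIterate (d : ℕ) (κ : ℂ) : ℕ → ℕ → ℂ → ℂ
  | 0, _ => Complex.exp
  | N + 1, k => fun y => (k + d) * oscillatorIterate d κ N k y -
      κ * oscillatorIterate d κ N (k + 4) y + 2 * y * oscillatorIterate d κ N (k + 2) y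

/-- In the flow a y-derivative produces e^{2τ}, that is, raises k by 2. At k = 0 the recursion for
`oscillatorIterate` therefore reads q ↦ dq + 2yq' - κq'', the action of H on profiles. -/
theorem hasDerivAt_oscillatorIterate (d : ℕ) (κ : ℂ) (N k : ℕ) (y : ℂ) :
    HasDerivAt (oscillatorIterate d κ N k) (oscillatorIterate d κ N (k + 2) y) y := by
  induction N generalizing k with
  | zero => exact Complex.hasDerivAt_exp y
  | succ N ih =>
    have h := (((ih k).const_mul (k + d : ℂ)).fun_sub ((ih (k + 4)).const_mul κ)).fun_add
      (((hasDerivAt_id y).const_mul 2).fun_mul (ih (k + 2)))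
    refine h.congr_deriv ?_
    simp only [oscillatorIterate, id]
    push_cast
    ring

/-- The solution `e^{kτ + dτ + κ(1 - e^{4τ})/4 + e^{2τ} y}`, whose `τ`-derivatives at `0` are
the `Q_{k,N}(y)`. -/
noncomputable def oscillatorFlow (d : ℕ) (κ y : ℂ) (k : ℕ) (τ : ℂ) : ℂ :=
  Complex.exp ((k + d) * τ + κ / 4 * (1 - Complex.exp (4 * τ)) + Complex.exp (2 * τ) * y)

theorem hasDerivAt_oscillatorFlow (d : ℕ) (κ y : ℂ) (k : ℕ) (τ : ℂ) :
    HasDerivAt (oscillatorFlow d κ y k) ((k + d) * oscillatorFlow d κ y k τ -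
      κ * oscillatorFlow d κ y (k + 4) τ + 2 * y * oscillatorFlow d κ y (k + 2) τ) τ := by
  have h4 : ∀ c : ℂ, HasDerivAt (fun τ => Complex.exp (c * τ)) (Complex.exp (c * τ) * c) τ :=
    fun c => by simpa using ((hasDerivAt_id τ).const_mul c).cexp
  have h := ((((hasDerivAt_id τ).const_mul (k + d : ℂ)).fun_add
    (((h4 4).const_sub 1).const_mul (κ / 4))).fun_add ((h4 2).mul_const y)).cexp
  refine h.congr_deriv ?_
  have e : ∀ j : ℕ, oscillatorFlow d κ y (k + j) τ =
      Complex.exp (j * τ) * oscillatorFlow d κ y k τ := fun j => by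
    rw [oscillatorFlow, oscillatorFlow, ← Complex.exp_add]
    congr 1
    push_cast
    ring
  rw [e, e]
  simp only [oscillatorFlow, id]
  push_cast
  ring

theorem differentiable_oscillatorFlow (d : ℕ) (κ y : ℂ) (k : ℕ) :
    Differentiable ℂ (oscillatorFlow d κ y k) := fun τ =>
  (hasDerivAt_oscillatorFlow d κ y k τ).differentiableAt

/-- The flow satisfies in τ the same three-term relation in k that defines the iterates, and both
start from e^y. -/
theorem iteratedDeriv_oscillatorFlow (d : ℕ) (κ y : ℂ) (N k : ℕ) :
    iteratedDeriv N (oscillatorFlow d κ y k) 0 = oscillatorIterate d κ N k y := by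
  induction N generalizing k with
  | zero => simp [oscillatorIterate, oscillatorFlow]
  | succ N ih =>
    have h0 : ∀ (k : ℕ) (c : ℂ), ContDiffAt ℂ N (fun τ => c * oscillatorFlow d κ y k τ) 0 :=
      fun k c => ((differentiable_oscillatorFlow d κ y k).const_mul c).contDiff.contDiffAt
    have hd : deriv (oscillatorFlow d κ y k) = fun τ => (k + d) * oscillatorFlow d κ y k τ -
        κ * oscillatorFlow d κ y (k + 4) τ + 2 * y * oscillatorFlow d κ y (k + 2) τ :=
      funext fun τ => (hasDerivAt_oscillatorFlow d κ y k τ).deriv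
    rw [iteratedDeriv_succ', hd, iteratedDeriv_fun_add ((h0 _ _).sub (h0 _ _)) (h0 _ _),
      iteratedDeriv_fun_sub (h0 _ _) (h0 _ _), iteratedDeriv_const_mul_field,
      iteratedDeriv_const_mul_field, iteratedDeriv_const_mul_field, ih, ih, ih]
    rfl

/-- Cauchy's estimate on |τ| = r. The flow is entire in τ, so r is arbitrary; r = 1/h gives exactly
the growth h^N N! allowed in 𝚺_{1/2}, with only e^{const·|y|} to pay. -/
theorem norm_oscillatorIterate_le (d : ℕ) (κ : ℂ) (N : ℕ) (y : ℂ) {r : ℝ} (hr : 0 < r) :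
    ‖oscillatorIterate d κ N 0 y‖ ≤ N.factorial * Real.exp (d * r + ‖κ‖ / 4 *
      (1 + Real.exp (4 * r)) + Real.exp (2 * r) * ‖y‖) / r ^ N := by
  rw [← iteratedDeriv_oscillatorFlow]
  refine Complex.norm_iteratedDeriv_le_of_forall_mem_sphere_norm_le N hr
    (differentiable_oscillatorFlow d κ y 0).diffContOnCl fun z hz => ?_
  have hz' : ‖z‖ = r := by simpa using hz
  have he : ∀ c : ℝ, 0 ≤ c → ‖Complex.exp (c * z)‖ ≤ Real.exp (c * r) := fun c hc => by
    refine (Complex.norm_exp_le_exp_norm _).trans_eq ?_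
    rw [norm_mul, hz', Complex.norm_real, Real.norm_eq_abs, abs_of_nonneg hc]
  have h4 := he 4 (by norm_num)
  have h2 := he 2 (by norm_num)
  push_cast at h4 h2
  refine (Complex.norm_exp_le_exp_norm _).trans (Real.exp_le_exp.2 ?_)
  refine (norm_add₃_le).trans (add_le_add (add_le_add ?_ ?_) ?_)
  · simp [hz']
  · rw [norm_mul, norm_div]
    refine mul_le_mul (by simp) ((norm_sub_le _ _).trans ?_) (norm_nonneg _) (by positivity)
    rw [norm_one]
    gcongr
  · rw [norm_mul]
    gcongr

/-- The function `e^{L(x)} e^{-|x|²/2}`. -/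
noncomputable def expGauss {d : ℕ} (L : EuclideanSpace ℝ (Fin d) →L[ℝ] ℂ) : SmoothFun d :=
  ⟨fun x => Complex.exp (L x) * stdGauss x, L.contDiff.cexp.mul contDiff_stdGauss⟩

theorem harmonicOscillator_pow_expGauss {d : ℕ} (L : EuclideanSpace ℝ (Fin d) →L[ℝ] ℂ) (N : ℕ)
    (x : EuclideanSpace ℝ (Fin d)) : ((harmonicOscillator d ^ N) (expGauss L)).1 x =
      oscillatorIterate d (∑ i, L (EuclideanSpace.single i 1) ^ 2) N 0 (L x) * stdGauss x := by
  induction N generalizing x with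
  | zero => rfl
  | succ N ih =>
    have hd : ∀ k, deriv (oscillatorIterate d (∑ i, L (EuclideanSpace.single i 1) ^ 2) N k) =
        oscillatorIterate d (∑ i, L (EuclideanSpace.single i 1) ^ 2) N (k + 2) := fun k =>
      funext fun y => (hasDerivAt_oscillatorIterate _ _ _ _ y).deriv
    rw [pow_succ', Module.End.mul_apply, harmonicOscillator_gaussian
      (fun y => (hasDerivAt_oscillatorIterate _ _ _ _ y).differentiableAt) L _ ih, hd, hd,
      oscillatorIterate]
    push_cast
    ring

theorem expGauss_mem_projLimit {d : ℕ} (L : EuclideanSpace ℝ (Fin d) →L[ℝ] ℂ) :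
    expGauss L ∈ projLimit (pilipovicScale d (1 / 2)) := by
  rw [mem_projLimit]
  intro h hh
  set κ := ∑ i, L (EuclideanSpace.single i 1) ^ 2
  set K := d * h⁻¹ + ‖κ‖ / 4 * (1 + Real.exp (4 * h⁻¹))
  set a := Real.exp (2 * h⁻¹) * ‖L‖
  -- The Gaussian absorbs the exponential growth in x: a|x| - |x|²/2 ≤ a²/2.
  refine ⟨Real.exp (K + a ^ 2 / 2), ?_⟩
  rintro _ ⟨⟨N, x⟩, rfl⟩
  have h1 : pilipovicScale d (1 / 2) h (N, x) (expGauss L) =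
    (((h ^ N * (N.factorial : ℝ) ^ (2 * (1 / 2) : ℝ))⁻¹ : ℝ) : ℂ) *
      ((harmonicOscillator d ^ N) (expGauss L)).1 x := rfl
  dsimp only
  rw [h1, harmonicOscillator_pow_expGauss, norm_mul, Complex.norm_real, Real.norm_eq_abs,
    show (2 * (1 / 2) : ℝ) = 1 by norm_num, Real.rpow_one, abs_of_pos (by positivity),
    inv_mul_le_iff₀ (by positivity), norm_mul, norm_stdGauss]
  have h2 := norm_oscillatorIterate_le d κ N (L x) (inv_pos.2 hh)
  have h3 : Real.exp (2 * h⁻¹) * ‖L x‖ ≤ a * ‖x‖ := by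
    rw [mul_assoc]
    exact mul_le_mul_of_nonneg_left (L.le_opNorm x) (by positivity)
  calc _ ≤ N.factorial * Real.exp (K + Real.exp (2 * h⁻¹) * ‖L x‖) / h⁻¹ ^ N *
        Real.exp (-‖x‖ ^ 2 / 2) := by gcongr
    _ = h ^ N * N.factorial *
        Real.exp (K + Real.exp (2 * h⁻¹) * ‖L x‖ + -‖x‖ ^ 2 / 2) := by
      rw [Real.exp_add _ (-‖x‖ ^ 2 / 2), inv_pow, div_inv_eq_mul]
      ring
    _ ≤ _ := by
      gcongr _ * Real.exp ?_
      nlinarith [sq_nonneg (a - ‖x‖)]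

theorem exists_pilipovicBeurling_eq_gaussian {d : ℕ} (C : ℂ)
    (L : EuclideanSpace ℝ (Fin d) →ₗ[ℝ] ℂ) :
    ∃ g : PilipovicBeurling d (1 / 2), g.toFun = fun x =>
      C * Complex.exp (-((‖x‖ ^ 2 : ℝ) : ℂ) / 2 + L x) := by
  refine ⟨⟨C • expGauss (LinearMap.toContinuousLinearMap L),
    Submodule.smul_mem _ _ (expGauss_mem_projLimit _)⟩, funext fun x => ?_⟩
  change C * (Complex.exp (L x) * stdGauss x) = _
  rw [stdGauss, ← Complex.exp_add, add_comm]

theorem matrix_eq_one_of_gaussian_mem_pilipovicBeurling {d : ℕ}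
    {A : Matrix (Fin d) (Fin d) ℂ} (hA : A.IsSymm) (hP : (A.map Complex.re).PosDef)
    {C : ℂ} (hC : C ≠ 0) {L : EuclideanSpace ℝ (Fin d) →ₗ[ℝ] ℂ} (g : PilipovicBeurling d (1 / 2))
    (hg : ∀ x, g.toFun x =
      C * Complex.exp (-(∑ i, ∑ j, A i j * (x j : ℂ) * (x i : ℂ)) / 2 + L x)) : A = 1 := by
  refine matrix_eq_one_of_hermite_coefficients hA hP hC
    hg
    (norm_le_stepNorm_pilipovic one_pos (g.mem_stepSpace one_pos)) fun v hv R hR =>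
    ⟨_, pilipovicBeurling_decay hv le_rfl hR (g.mem_stepSpace (by positivity))⟩

theorem gaussian_mem_pilipovicBeurling_iff {d : ℕ} {f : EuclideanSpace ℝ (Fin d) → ℂ}
    (hf : IsGaussFunction f) :
    (∃ g : PilipovicBeurling d (1 / 2), g.toFun = f) ↔
      ∃ (C : ℂ) (L : EuclideanSpace ℝ (Fin d) →ₗ[ℝ] ℂ),
        ∀ x, f x = C * Complex.exp (-((‖x‖ ^ 2 : ℝ) : ℂ) / 2 + L x) := by
  constructor
  · rintro ⟨g, rfl⟩
    obtain ⟨C, A, L, hA, hP, hg⟩ := hf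
    -- The zero function says nothing about A, so it is treated apart, with L = 0.
    by_cases hC : C = 0
    · exact ⟨0, 0, fun x => by rw [hg, hC, zero_mul, zero_mul]⟩
    · obtain rfl := matrix_eq_one_of_gaussian_mem_pilipovicBeurling hA hP hC g hg
      refine ⟨C, L, fun x => ?_⟩
      rw [hg, EuclideanSpace.real_norm_sq_eq]
      simp [Matrix.one_apply, pow_two]
  · rintro ⟨C, L, hf⟩
    obtain ⟨g, hg⟩ := exists_pilipovicBeurling_eq_gaussian C L
    exact ⟨g, hg.trans (funext hf).symm⟩

theorem mainTheorem8 (d : ℕ) (hd : 1 ≤ d) :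
    (∀ f : EuclideanSpace ℝ (Fin d) → ℂ, IsGaussFunction f →
      ((∃ g : PilipovicBeurling d (1 / 2), g.toFun = f) ↔
        ∃ (C : ℂ) (L : EuclideanSpace ℝ (Fin d) →ₗ[ℝ] ℂ),
          ∀ x, f x = C * Complex.exp (-((‖x‖ ^ 2 : ℝ) : ℂ) / 2 + L x))) ∧
    (∀ s : ℝ, 0 < s → s ≤ 1 / 2 →
      (∀ c : ℝ, c ≠ 0 → |c| ≠ 1 →
        ¬ DilationInvariant (PilipovicBeurling.toFun (d := d) (s := s)) c ∧
        ¬ DualDilationInvariant (PilipovicBeurling.toFun (d := d) (s := s)) c) ∧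
      ¬ IsTestFunctionModule (PilipovicBeurling.toFun (d := d) (s := s)) ∧
      ¬ IsDualTestFunctionModule (PilipovicBeurling.toFun (d := d) (s := s))) ∧
    (∀ s : ℝ, 0 ≤ s → s < 1 / 2 →
      (∀ c : ℝ, c ≠ 0 → |c| ≠ 1 →
        ¬ DilationInvariant (PilipovicRoumieu.toFun (d := d) (s := s)) c ∧
        ¬ DualDilationInvariant (PilipovicRoumieu.toFun (d := d) (s := s)) c) ∧
      ¬ IsTestFunctionModule (PilipovicRoumieu.toFun (d := d) (s := s)) ∧
      ¬ IsDualTestFunctionModule (PilipovicRoumieu.toFun (d := d) (s := s))) ∧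
    ((∀ c : ℝ, c ≠ 0 → |c| ≠ 1 →
        ¬ DilationInvariant (FlatBeurling.toFun (d := d)) c ∧
        ¬ DualDilationInvariant (FlatBeurling.toFun (d := d)) c) ∧
      ¬ IsTestFunctionModule (FlatBeurling.toFun (d := d)) ∧
      ¬ IsDualTestFunctionModule (FlatBeurling.toFun (d := d))) ∧
    ((∀ c : ℝ, c ≠ 0 → |c| ≠ 1 →
        ¬ DilationInvariant (FlatRoumieu.toFun (d := d)) c ∧
        ¬ DualDilationInvariant (FlatRoumieu.toFun (d := d)) c) ∧
      ¬ IsTestFunctionModule (FlatRoumieu.toFun (d := d)) ∧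
      ¬ IsDualTestFunctionModule (FlatRoumieu.toFun (d := d))) :=
  ⟨fun _ hf => gaussian_mem_pilipovicBeurling_iff hf,
    fun _ hs0 hs => pilipovicBeurling_not_invariant hd hs0 hs,
    fun _ hs0 hs => pilipovicRoumieu_not_invariant hd hs0 hs,
    flatBeurling_not_invariant hd, flatRoumieu_not_invariant hd⟩
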